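/- **Setting.** Let $\mathcal G$ be a finite directed graph without loops, with nodes $\mathcal I=\{1,\dots,N\}$; for $i\in\mathcal I$ let $\mathcal V(i)\subset\mathcal I\setminus\{i\}$ be the set of nodes $j$ such that there is an edge from $i$ to $j$. Let $T>0$, $r\ge 0$, $g:\mathcal I\to\mathbb R$, and for every $i\in\mathcal I$ let $L(i,\cdot):\mathbb R_+^{\mathcal V(i)}\to\mathbb R\cup\{+\infty\}$ be such that 1. for every $i$ there is a vector $\lambda$ with all coordinates positive and $L(i,\lambda)<+\infty$; 2. every $L(i,\cdot)$ is lower semi-continuous; 3. there is $\underline C\in\mathbb R$ with $L(i,\lambda)\ge\underline C$ for all $i$ and all $\lambda$; 4. for every $i$, $L(i,\lambda)/\|\lambda\|_\infty\to+\infty$ as $\|\lambda\|_\infty\to+\infty$. Put $H(i,p)=\sup_{\lambda\in\mathbb R_+^{\mathcal V(i)}}\big(\sum_{j\in\mathcal V(i)}\lambda_jp_j-L(i,\lambda)\big)$ for $p\in\mathbb R^{\mathcal V(i)}$. For $t\in[0,T]$ let $\mathcal A_t^T$ be the set of deterministic families $\lambda=(\lambda_s(i,j))_{s\in[t,T],\,i\in\mathcal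 I,\,j\in\mathcal V(i)}$ of non-negative numbers such that $s\mapsto\lambda_s(i,j)$ belongs to $L^1(t,T)$ for all $i,j$. For $\lambda\in\mathcal A_t^T$ let $(X_s^{t,i,\lambda})_{s\in[t,T]}$ be the (unique in law, càdlàg) continuous-time Markov chain that starts from $i$ at time $t$ and has the instantaneous transition rates $\lambda_s(k,j)$, i.e. for every $f:\mathcal I\to\mathbb R$ the process $f(X_s)-\int_t^s\sum_{j\in\mathcal V(X_v)}\lambda_v(X_v,j)\big(f(j)-f(X_v)\big)\,dv$ is a martingale on $[t,T]$. Let $$u_i^{T,r}(t)=\sup_{\lambda\in\mathcal A_t^T}\mathbb E\Big[-\int_t^Te^{-r(s-t)}L\big(X_s^{t,i,\lambda},(\lambda_s(X_s^{t,i,\lambda},j))_{j\in\mathcal V(X_s^{t,i,\lambda})}\big)\,ds+e^{-r(T-t)}g\big(X_T^{t,i,\lambda}\big)\Big].$$ A control $\lambda\in\mathcal A_0^T$ is called optimal from $i$ if it attains the supremum that defines $u_i^{T,r}(0)$. **Theorem.** There is exactly one function $V^{T,r}=(V_i^{T,r})_{i\in\mathcal I}$ on $(-\infty,T]$ that solves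 $$\frac{d}{dt}V_i(t)-rV_i(t)+H\big(i,(V_j(t)-V_i(t))_{j\in\mathcal V(i)}\big)=0\quad(i\in\mathcal I,\ t\le T),\qquad V_i(T)=g(i)\quad(i\in\mathcal I),$$ and the following holds. * $u_i^{T,r}(t)=V_i^{T,r}(t)$ for all $i\in\mathcal I$ and $t\in[0,T]$. * Consider, for $i\in\mathcal I$ and $t\in[0,T]$, the condition $$(\lambda_t(i,j))_{j\in\mathcal V(i)}\in\operatorname*{argmax}_{\eta\in\mathbb R_+^{\mathcal V(i)}}\Big(\sum_{j\in\mathcal V(i)}\eta_j\big(u_j^{T,r}(t)-u_i^{T,r}(t)\big)-L(i,\eta)\Big).\tag{$*$}$$ There is a control $\lambda\in\mathcal A_0^T$ that satisfies $(*)$ for all $i\in\mathcal I$ and all $t\in[0,T]$. Every $\lambda\in\mathcal A_0^T$ that satisfies $(*)$ for all $i\in\mathcal I$ and all $t\in[0,T]$ is optimal from every node $i\in\mathcal I$. Conversely, a control that is optimal from every node $i\in\mathcal I$ satisfies $(*)$ for all $i\in\mathcal I$ and almost every $t\in[0,T]$. -/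

import Mathlib

open MeasureTheory Set Filter Topology

noncomputable section

namespace GraphControl

/-- Integral of an extended-real function: integral of the positive part minus integral of the
negative part. It is only applied to functions one of whose parts has a finite integral. -/
def erealIntegral {α : Type*} [MeasurableSpace α] (μ : Measure α) (f : α → EReal) : EReal :=
  ((∫⁻ x, (f x).toENNReal ∂μ : ENNReal) : EReal) - ((∫⁻ x, (-f x).toENNReal ∂μ : ENNReal) : EReal)

variable {N : ℕ}

/-- Cost functions: `L i` has as arguments the vectors of rates out of the node `i`, indexed by the
out-neighbours `nbr i` of `i`. Only its values on nonnegative vectors are ever used. -/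
abbrev Cost (nbr : Fin N → Finset (Fin N)) : Type := (i : Fin N) → (nbr i → ℝ) → EReal

/-- The assumptions on the cost functions, which take values in `ℝ ∪ {+∞}`
(the value `⊥` is excluded by `bddBelow`). The norm on `nbr i → ℝ` is the sup norm. -/
structure CostAssumptions (nbr : Fin N → Finset (Fin N)) (L : Cost nbr) : Prop where
  nondegenerate : ∀ i, ∃ l : nbr i → ℝ, (∀ j, 0 < l j) ∧ L i l < ⊤
  lsc : ∀ i, LowerSemicontinuousOn (L i) {l | 0 ≤ l}
  bddBelow : ∃ C : ℝ, ∀ i, ∀ l : nbr i → ℝ, 0 ≤ l → (C : EReal) ≤ L i l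
  superlinear : ∀ i, Tendsto (fun l : nbr i → ℝ => L i l / ((‖l‖ : ℝ) : EReal))
    (Bornology.cobounded (nbr i → ℝ) ⊓ 𝓟 {l | 0 ≤ l}) (𝓝 ⊤)

/-- The function maximised in the Hamiltonian: `∑ⱼ lⱼ pⱼ - L(i, l)`. -/
def preHamiltonian (nbr : Fin N → Finset (Fin N)) (L : Cost nbr) (i : Fin N)
    (p l : nbr i → ℝ) : EReal :=
  ((∑ j, l j * p j : ℝ) : EReal) - L i l

/-- The Hamiltonian `H(i, p)`. -/
def hamiltonian (nbr : Fin N → Finset (Fin N)) (L : Cost nbr) (i : Fin N) (p : nbr i → ℝ) : EReal :=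
  ⨆ l ∈ {l : nbr i → ℝ | 0 ≤ l}, preHamiltonian nbr L i p l

/-- The set of nonnegative rate vectors at which the supremum in `H(i, p)` is attained. -/
def argmaxSet (nbr : Fin N → Finset (Fin N)) (L : Cost nbr) (i : Fin N) (p : nbr i → ℝ) :
    Set (nbr i → ℝ) :=
  {l | 0 ≤ l ∧ IsMaxOn (preHamiltonian nbr L i p) {l | 0 ≤ l} l}

/-- `V` is differentiable on `(-∞, T]` (from the left at `T`), solves the Hamilton-Jacobi equation
`V_i' - r V_i + H(i, (V_j - V_i)_j) = 0` there, and has the terminal value `g` at `T`. -/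
structure IsHJSolution (nbr : Fin N → Finset (Fin N)) (L : Cost nbr) (g : Fin N → ℝ) (r T : ℝ)
    (V : ℝ → Fin N → ℝ) : Prop where
  equation : ∀ t ≤ T, ∀ i, ∃ d : ℝ, HasDerivWithinAt (fun s => V s i) d (Iic T) t ∧
    ((d - r * V t i : ℝ) : EReal) + hamiltonian nbr L i (fun j => V t j - V t i) = 0
  terminal : ∀ i, V T i = g i

/-- Feedback control functions `s, i, j ↦ λ_s(i, j)`. -/
abbrev Control (nbr : Fin N → Finset (Fin N)) : Type := ℝ → (i : Fin N) → nbr i → ℝ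

/-- The admissible controls on `[t, T]`: nonnegative, with every `s ↦ λ_s(i, j)` in `L¹(t, T)`. -/
def admissible (nbr : Fin N → Finset (Fin N)) (t T : ℝ) : Set (Control nbr) :=
  {c | (∀ s ∈ Icc t T, ∀ i j, 0 ≤ c s i j) ∧ ∀ i j, IntegrableOn (fun s => c s i j) (Icc t T)}

/-- The generator at time `s` of the Markov chain with jump rates `λ_s(i, j)`. -/
def generator {nbr : Fin N → Finset (Fin N)} (c : Control nbr) (s : ℝ) (f : Fin N → ℝ)
    (i : Fin N) : ℝ :=
  ∑ j : nbr i, c s i j * (f j - f i)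

/-- A continuous-time Markov chain on `[t, T]` that starts at time `t` from the node `i` and has
the instantaneous transition rates `c`, on some filtered probability space: an adapted process with
càdlàg paths that solves the martingale problem of the time-dependent generator.
(Only the values `X s` with `s ∈ [t, T]` matter. Any two chains for the same `t`, `T`, `i`, `c` have
the same law.) -/
structure ControlledChain (nbr : Fin N → Finset (Fin N)) (t T : ℝ) (i : Fin N)
    (c : Control nbr) where
  Ω : Type
  mΩ : MeasurableSpace Ω
  μ : Measure Ω
  isProb : IsProbabilityMeasure μ
  filtration : Filtration (Icc t T) mΩ
  X : ℝ → Ω → Fin N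
  adapted : ∀ s : Icc t T, Measurable[filtration s] (X s)
  rightCont : ∀ ω, ∀ s ∈ Ico t T, ContinuousWithinAt (fun u => X u ω) (Ici s) s
  leftLim : ∀ ω, ∀ s ∈ Ioc t T, ∃ k, Tendsto (fun u => X u ω) (𝓝[<] s) (𝓝 k)
  initial : ∀ᵐ ω ∂μ, X t ω = i
  martingale : ∀ f : Fin N → ℝ,
    Martingale (fun (s : Icc t T) ω => f (X s ω) - ∫ u in t..s, generator c u f (X u ω))
      filtration μ

/-- The expected payoff
`E[-∫_t^T e^{-r(s-t)} L(X_s, (λ_s(X_s, j))_j) ds + e^{-r(T-t)} g(X_T)]`, with values in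
`ℝ ∪ {-∞}` when `L` is bounded from below. -/
def ControlledChain.payoff {nbr : Fin N → Finset (Fin N)} {t T : ℝ} {i : Fin N} {c : Control nbr}
    (Z : ControlledChain nbr t T i c) (L : Cost nbr) (g : Fin N → ℝ) (r : ℝ) : EReal :=
  letI := Z.mΩ
  erealIntegral Z.μ fun ω =>
    -erealIntegral (volume.restrict (Icc t T)) (fun s =>
        ((Real.exp (-r * (s - t)) : ℝ) : EReal) * L (Z.X s ω) (c s (Z.X s ω)))
      + ((Real.exp (-r * (T - t)) * g (Z.X T ω) : ℝ) : EReal)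

/-- The value function `u_i(t)`: the supremum, over the admissible controls on `[t, T]`, of the
expected payoff of the corresponding chain. -/
def value (nbr : Fin N → Finset (Fin N)) (L : Cost nbr) (g : Fin N → ℝ) (r T t : ℝ)
    (i : Fin N) : EReal :=
  ⨆ c ∈ admissible nbr t T, ⨆ Z : ControlledChain nbr t T i c, Z.payoff L g r

/-- The control `c` is optimal for the problem on `[0, T]` that starts from the node `i`: it is
admissible, the chain that it controls exists, and its expected payoff is the supremum. -/
def IsOptimal (nbr : Fin N → Finset (Fin N)) (L : Cost nbr) (g : Fin N → ℝ) (r T : ℝ)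
    (i : Fin N) (c : Control nbr) : Prop :=
  c ∈ admissible nbr 0 T ∧ Nonempty (ControlledChain nbr 0 T i c) ∧
    ∀ Z : ControlledChain nbr 0 T i c, Z.payoff L g r = value nbr L g r T 0 i

/-- The differences `(u_j(t) - u_i(t))_j` of the value function. -/
def valueDiff (nbr : Fin N → Finset (Fin N)) (L : Cost nbr) (g : Fin N → ℝ) (r T t : ℝ)
    (i : Fin N) : nbr i → ℝ :=
  fun j => (value nbr L g r T t j).toReal - (value nbr L g r T t i).toReal

end GraphControl

end

noncomputable section

namespace GraphControl

variable {N : ℕ} {nbr : Fin N → Finset (Fin N)} {L : Cost nbr}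

/-! ### The Hamiltonian -/

/-! The theorem rests on one exact identity. Let V solve the Hamilton-Jacobi equation. For every
admissible control λ and every chain X driven by it, the payoff from node i at time t equals V_i(t)
minus the expected time integral, along the chain, of the discounted loss L(k, λ) + H(k, p) - ∑ λ_j
p_j, where k is the current node and p_j = V_j - V_k. It is obtained by differentiating ∑ₖ P(X_s =
k) e^{-r(s-t)} V_k(s) with the forward equation for the marginal laws (`verification`,
`ControlledChain.payoff_eq`). By the definition of H the loss is nonnegative, and it vanishes
exactly on the argmax. So V bounds every payoff, a control that stays in the argmax attains the
bound, and an optimal control has zero loss along its chain. A chain started from i sits at i with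
positive probability at every time (`ControlledChain.prob_start_pos`), so optimality from i forces
the argmax condition at i for almost every time. The identity holds for every solution of the
martingale problem, so uniqueness in law is not needed.

Three existence results complete the argument. A global solution V: superlinearity confines the
maximisers to a ball as long as p is bounded, so H is finite and locally Lipschitz. Moreover H is
bounded above for p ≤ 0 and below for p ≥ 0, and a maximum principle turns this into a bound linear
in T - t that excludes blow-up (`truncated_solution_bound`). A control: the argmax has closed graph
and bounded values, hence a measurable selection (`exists_measurable_selection`). A chain: such a
selection is bounded, so the chain can be built by uniformisation, from a clock of constant rate
whose rings propose jumps that are accepted at random (`exists_controlledChain`). Its martingale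
property is checked ring by ring and summed. -/

theorem coe_sub_lt_coe_iff (x z : ℝ) (a : EReal) :
    (x : EReal) - a < z ↔ ((x - z : ℝ) : EReal) < a := by
  induction a with
  | bot => simp
  | top => exact ⟨fun _ => EReal.coe_lt_top _, fun _ => by simp [EReal.bot_lt_coe]⟩
  | coe a =>
    rw [← EReal.coe_sub, EReal.coe_lt_coe_iff, EReal.coe_lt_coe_iff]
    constructor <;> intro h <;> linarith

theorem coe_sub_le_coe_iff (x z : ℝ) (a : EReal) :
    (x : EReal) - a ≤ z ↔ ((x - z : ℝ) : EReal) ≤ a := by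
  induction a with
  | bot => exact ⟨fun h => by simp at h, fun h => absurd h (EReal.bot_lt_coe _).not_ge⟩
  | top => simp
  | coe a =>
    rw [← EReal.coe_sub, EReal.coe_le_coe_iff, EReal.coe_le_coe_iff]
    constructor <;> intro h <;> linarith

theorem coe_sub_eq_coe_iff (x z : ℝ) (a : EReal) :
    (x : EReal) - a = z ↔ a = ((x - z : ℝ) : EReal) := by
  have h1 := coe_sub_le_coe_iff x z a
  have h2 := coe_sub_lt_coe_iff x z a
  constructor
  · intro h
    exact le_antisymm (not_lt.1 fun h' => (h2.2 h').ne h) (h1.1 h.le)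
  · intro h
    exact le_antisymm (h1.2 h.ge) (not_lt.1 fun h' => (h2.1 h').ne' h)

theorem abs_sum_mul_le {ι : Type*} [Fintype ι] (l p : ι → ℝ) :
    |∑ j, l j * p j| ≤ Fintype.card ι * (‖l‖ * ‖p‖) := by
  refine (Finset.abs_sum_le_sum_abs _ _).trans ?_
  rw [← nsmul_eq_mul, ← Finset.card_univ]
  refine Finset.sum_le_card_nsmul _ _ _ fun j _ => ?_
  rw [abs_mul]
  exact mul_le_mul (norm_le_pi_norm l j) (norm_le_pi_norm p j) (abs_nonneg _) (norm_nonneg _)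

theorem card_nbr_le (nbr : Fin N → Finset (Fin N)) (i : Fin N) : Fintype.card (nbr i) ≤ N := by
  simpa using Finset.card_le_univ (nbr i)

theorem abs_sum_mul_le_nat {i : Fin N} (l p : nbr i → ℝ) :
    |∑ j, l j * p j| ≤ N * (‖l‖ * ‖p‖) := by
  refine (abs_sum_mul_le l p).trans ?_
  gcongr
  exact card_nbr_le nbr i

/-- Joint upper semicontinuity in (p, l) on the nonnegative orthant: the bilinear term is continuous
and L is lower semicontinuous. Real numbers inserted in the strict inequalities separate the two
terms. -/
theorem eventually_preHamiltonian_lt (hL : CostAssumptions nbr L) (i : Fin N) {p l : nbr i → ℝ}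
    (hl : 0 ≤ l) {y : EReal} (hy : preHamiltonian nbr L i p l < y) :
    ∀ᶠ q in 𝓝 (p, l), 0 ≤ q.2 → preHamiltonian nbr L i q.1 q.2 < y := by
  obtain ⟨z, hz1, hz2⟩ := EReal.lt_iff_exists_real_btwn.1 hy
  have h := (coe_sub_lt_coe_iff _ _ _).1 hz1
  obtain ⟨w, hw1, hw2⟩ := EReal.lt_iff_exists_real_btwn.1 h
  have hlsc := hL.lsc i l hl _ hw2
  rw [eventually_nhdsWithin_iff] at hlsc
  have hc : ∀ᶠ q : (nbr i → ℝ) × (nbr i → ℝ) in 𝓝 (p, l), (∑ j, q.2 j * q.1 j) - z < w := by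
    have : Continuous fun q : (nbr i → ℝ) × (nbr i → ℝ) => (∑ j, q.2 j * q.1 j) - z := by fun_prop
    exact this.continuousAt.eventually_lt continuousAt_const (by exact_mod_cast hw1)
  have h2 : ∀ᶠ q : (nbr i → ℝ) × (nbr i → ℝ) in 𝓝 (p, l), q.2 ∈ {l | 0 ≤ l} → (w : EReal) < L i q.2 :=
    (continuous_snd.tendsto (p, l)).eventually hlsc
  filter_upwards [hc, h2] with q hq1 hq2 hq
  refine lt_trans ((coe_sub_lt_coe_iff _ _ _).2 (lt_trans ?_ (hq2 hq))) hz2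
  exact_mod_cast hq1

/-- A vector of rates of finite cost, for each node. -/
theorem exists_finite_cost (hL : CostAssumptions nbr L) (i : Fin N) :
    ∃ l : nbr i → ℝ, 0 ≤ l ∧ ∃ x : ℝ, L i l = x := by
  obtain ⟨l, hl, hx⟩ := hL.nondegenerate i
  obtain ⟨C, hC⟩ := hL.bddBelow
  have h0 : (0 : nbr i → ℝ) ≤ l := fun j => (hl j).le
  refine ⟨l, h0, (L i l).toReal, (EReal.coe_toReal hx.ne ?_).symm⟩
  exact ((EReal.bot_lt_coe C).trans_le (hC i l h0)).ne'

theorem exists_mul_norm_le_cost (hL : CostAssumptions nbr L) (i : Fin N) (A : ℝ) :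
    ∃ B : ℝ, ∀ l : nbr i → ℝ, 0 ≤ l → B < ‖l‖ → ((A * ‖l‖ : ℝ) : EReal) ≤ L i l := by
  have h := (hL.superlinear i).eventually (lt_mem_nhds (EReal.coe_lt_top A))
  rw [eventually_inf_principal, ← comap_norm_atTop, eventually_comap] at h
  obtain ⟨B, hB⟩ := (h.and (eventually_ge_atTop 0)).exists_forall_of_atTop
  refine ⟨max B 0, fun l hl hlB => ?_⟩
  have hl0 : 0 < ‖l‖ := (le_max_right _ _).trans_lt hlB
  have := (hB ‖l‖ ((le_max_left _ _).trans hlB.le)).1 l rfl hl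
  rw [EReal.lt_div_iff (by exact_mod_cast hl0) (EReal.coe_ne_top _), ← EReal.coe_mul] at this
  exact this.le

/-- Superlinear cost makes every large rate vector worse than one fixed vector of finite cost,
uniformly over bounded p. -/
theorem exists_bound_preHamiltonian (hL : CostAssumptions nbr L) (i : Fin N) (R : ℝ) :
    ∃ B : ℝ, 0 ≤ B ∧ ∀ p : nbr i → ℝ, ‖p‖ ≤ R → ∀ l : nbr i → ℝ, 0 ≤ l → B < ‖l‖ →
      ∃ l' : nbr i → ℝ, 0 ≤ l' ∧ ‖l'‖ ≤ B ∧
        preHamiltonian nbr L i p l < preHamiltonian nbr L i p l' := by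
  obtain ⟨l₀, hl₀, x, hx⟩ := exists_finite_cost hL i
  -- The slope N R pays for the linear term at l; the extra 1 leaves ‖l‖ to beat the constant N ‖l₀‖
  -- R + x.
  obtain ⟨B, hB⟩ := exists_mul_norm_le_cost hL i (N * R + 1)
  refine ⟨max (max B ‖l₀‖) (N * (‖l₀‖ * R) + x), ?_, fun p hp l hl hlB => ?_⟩
  · exact (norm_nonneg l₀).trans ((le_max_right _ _).trans (le_max_left _ _))
  refine ⟨l₀, hl₀, (le_max_right _ _).trans (le_max_left _ _), ?_⟩
  have h1 := hB l hl (((le_max_left _ _).trans (le_max_left _ _)).trans_lt hlB)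
  have h2 : N * (‖l₀‖ * R) + x < ‖l‖ := (le_max_right _ _).trans_lt hlB
  rw [preHamiltonian, preHamiltonian, hx, ← EReal.coe_sub, coe_sub_lt_coe_iff]
  refine lt_of_lt_of_le ?_ h1
  rw [EReal.coe_lt_coe_iff]
  have h3 := (le_abs_self _).trans (abs_sum_mul_le_nat l p)
  have h4 := (neg_abs_le _).trans' (neg_le_neg (abs_sum_mul_le_nat l₀ p))
  have h5 : (N : ℝ) * (‖l‖ * ‖p‖) ≤ N * (‖l‖ * R) := by gcongr
  have h6 : (N : ℝ) * (‖l₀‖ * ‖p‖) ≤ N * (‖l₀‖ * R) := by gcongr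
  linarith

/-- An upper semicontinuous function attains its maximum on the compact piece of the orthant outside
of which nothing competes. The uniformity of B in p gives the Lipschitz bound for H and the
boundedness of optimal rates. -/
theorem exists_argmax (hL : CostAssumptions nbr L) (i : Fin N) (R : ℝ) :
    ∃ B : ℝ, 0 ≤ B ∧ ∀ p : nbr i → ℝ, ‖p‖ ≤ R → (argmaxSet nbr L i p).Nonempty ∧
      ∀ l ∈ argmaxSet nbr L i p, ‖l‖ ≤ B := by
  obtain ⟨B, hB0, hB⟩ := exists_bound_preHamiltonian hL i R
  refine ⟨B, hB0, fun p hp => ⟨?_, fun l hl => ?_⟩⟩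
  · have hcomp : IsCompact ({l : nbr i → ℝ | 0 ≤ l} ∩ Metric.closedBall 0 B) :=
      (isCompact_closedBall _ _).inter_left (isClosed_le continuous_const continuous_id)
    have husc : UpperSemicontinuousOn (preHamiltonian nbr L i p)
        ({l : nbr i → ℝ | 0 ≤ l} ∩ Metric.closedBall 0 B) := by
      intro l hl y hy
      have h := eventually_preHamiltonian_lt hL i hl.1 hy
      have h' : ∀ᶠ l' in 𝓝 l, 0 ≤ l' → preHamiltonian nbr L i p l' < y :=
        (Continuous.prodMk continuous_const continuous_id : Continuous fun l' => (p, l')).tendsto l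
          |>.eventually h
      filter_upwards [nhdsWithin_le_nhds h', self_mem_nhdsWithin] with l' h1 h2 using h1 h2.1
    have hne : ({l : nbr i → ℝ | 0 ≤ l} ∩ Metric.closedBall 0 B).Nonempty :=
      ⟨0, le_refl (0 : nbr i → ℝ), by simpa using hB0⟩
    obtain ⟨l, hl, hmax⟩ := husc.exists_isMaxOn hne hcomp
    refine ⟨l, hl.1, fun l' hl' => ?_⟩
    by_cases hn : ‖l'‖ ≤ B
    · exact hmax ⟨hl', by simpa using hn⟩
    · obtain ⟨l'', h1, h2, h3⟩ := hB p hp l' hl' (not_le.1 hn)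
      exact h3.le.trans (hmax ⟨h1, by simpa using h2⟩)
  · by_contra hn
    obtain ⟨l', h1, h2, h3⟩ := hB p hp l hl.1 (not_le.1 hn)
    exact (hl.2 h1).not_gt h3

/-- The real-valued Hamiltonian. -/
def realHam (nbr : Fin N → Finset (Fin N)) (L : Cost nbr) (i : Fin N) (p : nbr i → ℝ) : ℝ :=
  (hamiltonian nbr L i p).toReal

theorem hamiltonian_eq_of_mem {i : Fin N} {p l : nbr i → ℝ} (h : l ∈ argmaxSet nbr L i p) :
    hamiltonian nbr L i p = preHamiltonian nbr L i p l :=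
  le_antisymm (iSup₂_le fun _ hl' => h.2 hl') (le_iSup₂ (f := fun l (_ : l ∈ {l | 0 ≤ l}) =>
    preHamiltonian nbr L i p l) l h.1)

theorem hamiltonian_eq_coe (hL : CostAssumptions nbr L) (i : Fin N) (p : nbr i → ℝ) :
    hamiltonian nbr L i p = (realHam nbr L i p : EReal) := by
  obtain ⟨B, -, hB⟩ := exists_argmax hL i ‖p‖
  obtain ⟨l, hl⟩ := (hB p le_rfl).1
  obtain ⟨l₀, hl₀, x, hx⟩ := exists_finite_cost hL i
  obtain ⟨C, hC⟩ := hL.bddBelow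
  refine (EReal.coe_toReal ?_ ?_).symm <;> rw [hamiltonian_eq_of_mem hl]
  · refine ((coe_sub_le_coe_iff _ ((∑ j, l j * p j) - C) _).2 ?_).trans_lt (EReal.coe_lt_top _) |>.ne
    simpa using hC i l hl.1
  · refine ((EReal.bot_lt_coe ((∑ j, l₀ j * p j) - x)).trans_le ?_).ne'
    have := hl.2 hl₀
    simpa [preHamiltonian, hx] using this

/-- The Fenchel inequality. -/
theorem fenchel_le (hL : CostAssumptions nbr L) (i : Fin N) (p : nbr i → ℝ) {l : nbr i → ℝ}
    (hl : 0 ≤ l) : (((∑ j, l j * p j) - realHam nbr L i p : ℝ) : EReal) ≤ L i l := by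
  rw [← coe_sub_le_coe_iff, ← hamiltonian_eq_coe hL]
  exact le_iSup₂ (f := fun l (_ : l ∈ {l | 0 ≤ l}) => preHamiltonian nbr L i p l) l hl

/-- Maximisers are the equality case of the Fenchel inequality; this is how zero loss is recognised
as optimality. -/
theorem mem_argmaxSet_iff (hL : CostAssumptions nbr L) (i : Fin N) (p : nbr i → ℝ)
    {l : nbr i → ℝ} : l ∈ argmaxSet nbr L i p ↔
      0 ≤ l ∧ L i l = (((∑ j, l j * p j) - realHam nbr L i p : ℝ) : EReal) := by
  rw [← coe_sub_eq_coe_iff, ← hamiltonian_eq_coe hL]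
  refine ⟨fun h => ⟨h.1, (hamiltonian_eq_of_mem h).symm⟩, fun h => ⟨h.1, fun l' hl' => ?_⟩⟩
  exact (le_iSup₂ (f := fun l (_ : l ∈ {l | 0 ≤ l}) => preHamiltonian nbr L i p l) l' hl').trans_eq
    h.2.symm

/-- A maximiser at p is a competitor at q, so H(p) - H(q) ≤ ∑ lⱼ (pⱼ - qⱼ), with l bounded by
`exists_argmax`. -/
theorem realHam_lipschitz (hL : CostAssumptions nbr L) (i : Fin N) (R : ℝ) :
    ∃ K : ℝ, 0 ≤ K ∧ ∀ p q : nbr i → ℝ, ‖p‖ ≤ R → ‖q‖ ≤ R →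
      |realHam nbr L i p - realHam nbr L i q| ≤ K * ‖p - q‖ := by
  obtain ⟨B, hB0, hB⟩ := exists_argmax hL i R
  have key : ∀ p q : nbr i → ℝ, ‖p‖ ≤ R →
      realHam nbr L i p - realHam nbr L i q ≤ N * B * ‖p - q‖ := by
    intro p q hp
    obtain ⟨⟨l, hl⟩, hb⟩ := hB p hp
    have h1 := ((mem_argmaxSet_iff hL i p).1 hl).2
    have h2 := fenchel_le hL i q hl.1
    rw [h1, EReal.coe_le_coe_iff] at h2
    have h3 := (le_abs_self _).trans (abs_sum_mul_le_nat l (p - q))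
    have h4 : ∑ j, l j * (p - q) j = (∑ j, l j * p j) - ∑ j, l j * q j := by
      simp [mul_sub]
    have h5 : (N : ℝ) * (‖l‖ * ‖p - q‖) ≤ N * (B * ‖p - q‖) := by gcongr; exact hb l hl
    rw [h4] at h3
    linarith
  refine ⟨N * B, by positivity, fun p q hp hq => abs_le.2 ⟨?_, key p q hp⟩⟩
  have := key q p hq
  rw [norm_sub_rev] at this
  linarith

theorem continuous_realHam (hL : CostAssumptions nbr L) (i : Fin N) :
    Continuous (realHam nbr L i) := by
  rw [continuous_iff_continuousAt]
  intro p
  obtain ⟨K, hK0, hK⟩ := realHam_lipschitz hL i (‖p‖ + 1)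
  have hlip : LipschitzOnWith K.toNNReal (realHam nbr L i) (Metric.closedBall p 1) := by
    refine LipschitzOnWith.of_dist_le_mul fun x hx y hy => ?_
    have hb : ∀ x ∈ Metric.closedBall p 1, ‖x‖ ≤ ‖p‖ + 1 := fun x hx =>
      norm_le_norm_add_const_of_dist_le (Metric.mem_closedBall.1 hx)
    rw [Real.dist_eq, dist_eq_norm, Real.coe_toNNReal _ hK0]
    exact hK x y (hb x hx) (hb y hy)
  exact hlip.continuousOn.continuousAt (Metric.closedBall_mem_nhds p one_pos)

/-- If a limit pair fell strictly short of the Hamiltonian, semicontinuity of the maximised function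
and continuity of H would make all nearby pairs fall short too. -/
theorem isClosed_argmaxGraph (hL : CostAssumptions nbr L) (i : Fin N) :
    IsClosed {q : (nbr i → ℝ) × (nbr i → ℝ) | q.2 ∈ argmaxSet nbr L i q.1} := by
  refine isClosed_iff_frequently.2 fun ⟨p, l⟩ h => ?_
  have hl : (0 : nbr i → ℝ) ≤ l := by
    refine (isClosed_le continuous_const continuous_snd :
      IsClosed {q : (nbr i → ℝ) × (nbr i → ℝ) | 0 ≤ q.2}).mem_of_frequently_of_tendsto
      (h.mono fun q hq => hq.1) tendsto_id
  refine (mem_argmaxSet_iff hL i p).2 ⟨hl, le_antisymm ?_ (fenchel_le hL i p hl)⟩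
  rw [← not_lt, ← coe_sub_lt_coe_iff]
  intro hlt
  obtain ⟨z, hz1, hz2⟩ := EReal.lt_iff_exists_real_btwn.1 hlt
  have h1 := eventually_preHamiltonian_lt hL i hl hz1
  have h2 : ∀ᶠ q : (nbr i → ℝ) × (nbr i → ℝ) in 𝓝 (p, l), z < realHam nbr L i q.1 :=
    ((continuous_realHam hL i).comp continuous_fst).continuousAt.eventually_const_lt
      (by exact_mod_cast hz2)
  obtain ⟨q, hq, hq1, hq2⟩ := (h.and_eventually (h1.and h2)).exists
  have := hq1 hq.1
  rw [← hamiltonian_eq_of_mem hq, hamiltonian_eq_coe hL, EReal.coe_lt_coe_iff] at this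
  linarith

/-- For p ≤ 0 the linear term only decreases the supremum, so the lower bound of the cost bounds H.
This applies at a node where the solution is largest; the companion bound for p ≥ 0 applies where it
is smallest. -/
theorem exists_realHam_le_of_nonpos (hL : CostAssumptions nbr L) :
    ∃ C : ℝ, ∀ i (p : nbr i → ℝ), p ≤ 0 → realHam nbr L i p ≤ C := by
  obtain ⟨C, hC⟩ := hL.bddBelow
  refine ⟨-C, fun i p hp => ?_⟩
  obtain ⟨B, -, hB⟩ := exists_argmax hL i ‖p‖
  obtain ⟨l, hl⟩ := (hB p le_rfl).1
  have h := hC i l hl.1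
  rw [((mem_argmaxSet_iff hL i p).1 hl).2, EReal.coe_le_coe_iff] at h
  have : ∑ j, l j * p j ≤ 0 := Finset.sum_nonpos fun j _ =>
    mul_nonpos_of_nonneg_of_nonpos (hl.1 j) (hp j)
  linarith

theorem exists_le_realHam_of_nonneg (hL : CostAssumptions nbr L) :
    ∃ C : ℝ, ∀ i (p : nbr i → ℝ), 0 ≤ p → C ≤ realHam nbr L i p := by
  choose l hl x hx using exists_finite_cost hL
  refine ⟨-∑ i, |x i|, fun i p hp => ?_⟩
  have h := fenchel_le hL i p (hl i)
  rw [hx, EReal.coe_le_coe_iff] at h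
  have h1 : 0 ≤ ∑ j, l i j * p j := Finset.sum_nonneg fun j _ => mul_nonneg (hl i j) (hp j)
  have h2 : |x i| ≤ ∑ i, |x i| := Finset.single_le_sum (f := fun i => |x i|)
    (fun _ _ => abs_nonneg _) (Finset.mem_univ i)
  linarith [le_abs_self (x i)]

/-! ### The Hamilton-Jacobi equation -/

/-- The right-hand side of the Hamilton-Jacobi equation, written as `V' = hjField V`. -/
def hjField (nbr : Fin N → Finset (Fin N)) (L : Cost nbr) (r : ℝ) (y : Fin N → ℝ) : Fin N → ℝ :=
  fun i => r * y i - realHam nbr L i fun j => y j - y i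

/-- Coordinatewise truncation to `[-R, R]`. -/
def truncate (R : ℝ) (y : Fin N → ℝ) : Fin N → ℝ := fun i => max (-R) (min R (y i))

theorem norm_truncate_le {R : ℝ} (hR : 0 ≤ R) (y : Fin N → ℝ) : ‖truncate R y‖ ≤ R := by
  refine (pi_norm_le_iff_of_nonneg hR).2 fun i => abs_le.2 ⟨le_max_left _ _, ?_⟩
  exact max_le (by linarith) (min_le_left _ _)

theorem truncate_eq {R : ℝ} {y : Fin N → ℝ} (hy : ‖y‖ ≤ R) : truncate R y = y := by
  funext i
  have := abs_le.1 ((norm_le_pi_norm y i).trans hy)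
  simp [truncate, this.1, this.2]

theorem dist_truncate_le (R : ℝ) (y z : Fin N → ℝ) : dist (truncate R y) (truncate R z) ≤ dist y z := by
  refine (dist_pi_le_iff dist_nonneg).2 fun i => le_trans ?_ (dist_le_pi_dist y z i)
  rw [Real.dist_eq, Real.dist_eq]
  exact (abs_max_sub_max_le_max _ _ _ _).trans (by
    simpa using abs_min_sub_min_le_max R (y i) R (z i))

/-- All coordinates are cut by the same monotone function, so a node that is extremal for y remains
extremal after truncation. -/
theorem truncate_mono_apply (R : ℝ) {y : Fin N → ℝ} {i j : Fin N} (h : y i ≤ y j) :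
    truncate R y i ≤ truncate R y j :=
  max_le_max le_rfl (min_le_min le_rfl h)

theorem hjField_lipschitzOn (hL : CostAssumptions nbr L) (r R : ℝ) :
    ∃ K : NNReal, LipschitzOnWith K (hjField nbr L r) (Metric.closedBall 0 R) := by
  choose K hK0 hK using fun i => realHam_lipschitz hL i (2 * R)
  refine ⟨(|r| + 2 * ∑ i, K i).toNNReal, LipschitzOnWith.of_dist_le_mul fun y hy z hz => ?_⟩
  have hS : 0 ≤ ∑ i, K i := Finset.sum_nonneg fun i _ => hK0 i
  rw [Real.coe_toNNReal _ (by positivity)]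
  refine (dist_pi_le_iff (by positivity)).2 fun i => ?_
  have hnorm : ∀ y ∈ Metric.closedBall (0 : Fin N → ℝ) R,
      ‖(fun j : nbr i => y j - y i : nbr i → ℝ)‖ ≤ 2 * R := by
    intro y hy
    rw [mem_closedBall_zero_iff] at hy
    refine (pi_norm_le_iff_of_nonneg (by linarith [norm_nonneg y])).2 fun j => ?_
    exact (norm_sub_le _ _).trans (by linarith [norm_le_pi_norm y j, norm_le_pi_norm y i])
  have h1 := hK i _ _ (hnorm y hy) (hnorm z hz)
  have h2 : ‖(fun j : nbr i => y j - y i : nbr i → ℝ) - fun j : nbr i => z j - z i‖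
      ≤ 2 * dist y z := by
    refine (pi_norm_le_iff_of_nonneg (by positivity)).2 fun j => ?_
    have e : ((fun j : nbr i => y j - y i : nbr i → ℝ) - fun j : nbr i => z j - z i) j
        = (y j - z j) - (y i - z i) := by simp only [Pi.sub_apply]; ring
    rw [e]
    refine (norm_sub_le _ _).trans ?_
    have := dist_le_pi_dist y z j
    have := dist_le_pi_dist y z i
    rw [Real.dist_eq] at *
    simp only [Real.norm_eq_abs]
    linarith
  have h3 : K i ≤ ∑ i, K i := Finset.single_le_sum (fun i _ => hK0 i) (Finset.mem_univ i)
  have h4 : |y i - z i| ≤ dist y z := dist_le_pi_dist y z i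
  rw [Real.dist_eq]
  calc |hjField nbr L r y i - hjField nbr L r z i|
      = |r * (y i - z i) - (realHam nbr L i (fun j => y j - y i)
          - realHam nbr L i fun j => z j - z i)| := by
        simp only [hjField]; congr 1; ring
    _ ≤ |r| * |y i - z i| + K i * (2 * dist y z) := by
        refine (abs_sub _ _).trans (add_le_add (abs_mul _ _).le (h1.trans ?_))
        gcongr
        exact hK0 i
    _ ≤ |r| * dist y z + (∑ i, K i) * (2 * dist y z) := by gcongr
    _ = (|r| + 2 * ∑ i, K i) * dist y z := by ring

/-- Truncating the argument makes the field globally Lipschitz and bounded, so Picard-Lindelöf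
applies on the whole of [a, T] at once. -/
theorem exists_truncated_solution (hL : CostAssumptions nbr L) (r T : ℝ) (g : Fin N → ℝ) {R a : ℝ}
    (hR : 0 ≤ R) (ha : a ≤ T) :
    ∃ y : ℝ → Fin N → ℝ, y T = g ∧ ∀ t ∈ Icc a T,
      HasDerivWithinAt y (hjField nbr L r (truncate R (y t))) (Icc a T) t := by
  obtain ⟨K, hK⟩ := hjField_lipschitzOn hL r R
  have hmem : ∀ y : Fin N → ℝ, truncate R y ∈ Metric.closedBall 0 R := fun y => by
    simpa using norm_truncate_le hR y
  have hlip : LipschitzWith K fun y : Fin N → ℝ => hjField nbr L r (truncate R y) :=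
    LipschitzWith.of_dist_le_mul fun y z => (hK.dist_le_mul _ (hmem y) _ (hmem z)).trans
      (mul_le_mul_of_nonneg_left (dist_truncate_le R y z) K.2)
  obtain ⟨M, hM⟩ : ∃ M : NNReal, ∀ y : Fin N → ℝ, ‖hjField nbr L r (truncate R y)‖ ≤ M := by
    refine ⟨⟨‖hjField nbr L r 0‖ + K * R, by positivity⟩, fun y => ?_⟩
    have h := hK.dist_le_mul _ (hmem y) 0 (by simpa using hR)
    rw [dist_eq_norm, dist_zero_right] at h
    have := norm_truncate_le hR y
    calc _ ≤ ‖hjField nbr L r 0‖ + ‖hjField nbr L r (truncate R y) - hjField nbr L r 0‖ :=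
          norm_le_norm_add_norm_sub' _ _
      _ ≤ ‖hjField nbr L r 0‖ + K * R := by gcongr; exact h.trans (by gcongr)
  -- Speed at most M keeps the solution within M (T - a) of g, so this radius imposes no restriction
  -- on the length of the interval.
  have hpl : IsPicardLindelof (fun _ y => hjField nbr L r (truncate R y))
      (⟨T, ha, le_rfl⟩ : Icc a T) g (M * (T - a).toNNReal) 0 M K :=
    { lipschitzOnWith := fun t _ => hlip.lipschitzOnWith
      continuousOn := fun x _ => continuousOn_const
      norm_le := fun t _ x _ => hM x
      mul_max_le := by
        simp [ha, Real.coe_toNNReal _ (sub_nonneg.2 ha)] }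
  exact hpl.exists_eq_forall_mem_Icc_hasDerivWithinAt₀

/-- A maximum principle for systems that are solved backwards from time `T`. -/
theorem le_of_deriv_pos_of_max {f f' : ℝ → Fin N → ℝ} {a T M : ℝ}
    (hf : ∀ t ∈ Icc a T, ∀ i, HasDerivWithinAt (fun s => f s i) (f' t i) (Icc a T) t)
    (hT : ∀ i, f T i ≤ M)
    (h : ∀ t ∈ Ico a T, ∀ i, (∀ j, f t j ≤ f t i) → M < f t i → 0 < f' t i) :
    ∀ t ∈ Icc a T, ∀ i, f t i ≤ M := by
  intro t ht i
  by_contra! hlt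
  choose s hs hmax using fun i => isCompact_Icc.exists_isMaxOn (⟨t, ht⟩ : (Icc a T).Nonempty)
    (fun t ht => (hf t ht i).continuousWithinAt : ContinuousOn (fun s => f s i) (Icc a T))
  -- The maximum is taken over time and node together. It is reached before T because it exceeds M,
  -- and there the derivative from the right cannot be positive.
  obtain ⟨k, -, hk⟩ := Finset.exists_max_image Finset.univ (fun i => f (s i) i) ⟨i, Finset.mem_univ i⟩
  have hglob : ∀ u ∈ Icc a T, ∀ j, f u j ≤ f (s k) k := fun u hu j =>
    (hmax j hu).trans (hk j (Finset.mem_univ j))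
  have hM : M < f (s k) k := hlt.trans_le (hglob t ht i)
  have hsT : s k < T := lt_of_le_of_ne (hs k).2 fun e => by
    rw [e] at hM
    exact hM.not_ge (hT k)
  have hpos := h (s k) ⟨(hs k).1, hsT⟩ k (hglob _ (hs k)) hM
  have hd := (hf (s k) (hs k) k).mono (Ioc_subset_Icc_self.trans (Icc_subset_Icc_left (hs k).1) :
    Ioc (s k) T ⊆ Icc a T)
  rw [hasDerivWithinAt_iff_tendsto_slope' (by simp), nhdsWithin_Ioc_eq_nhdsGT hsT] at hd
  refine hpos.not_ge (le_of_tendsto hd ?_)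
  filter_upwards [Ioc_mem_nhdsGT hsT] with u hu
  rw [slope_def_field]
  exact div_nonpos_of_nonpos_of_nonneg
    (sub_nonpos.2 (hglob u ⟨(hs k).1.trans hu.1.le, hu.2⟩ k)) (sub_nonneg.2 hu.1.le)

/-- The barriers are ±(‖y T‖ + A (T - t)). At a largest node above the barrier, H ≤ C < A and the
discount term is nonnegative, so the excess would have positive derivative, against the maximum
principle; smallest nodes are symmetric. The constant A does not depend on the truncation level R.
-/
theorem truncated_solution_bound (hL : CostAssumptions nbr L) {r : ℝ} (hr : 0 ≤ r) :
    ∃ A : ℝ, 0 ≤ A ∧ ∀ (R a T : ℝ) (y : ℝ → Fin N → ℝ), 0 ≤ R → (∀ t ∈ Icc a T,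
      HasDerivWithinAt y (hjField nbr L r (truncate R (y t))) (Icc a T) t) →
      ∀ t ∈ Icc a T, ‖y t‖ ≤ ‖y T‖ + A * (T - t) := by
  obtain ⟨C, hC⟩ := exists_realHam_le_of_nonpos hL
  obtain ⟨D, hD⟩ := exists_le_realHam_of_nonneg hL
  refine ⟨|C| + |D| + 1, by positivity, fun R a T y hR hy t ht => ?_⟩
  set A := |C| + |D| + 1
  have hCA : C < A := by linarith [le_abs_self C, abs_nonneg D]
  have hDA : -A < D := by linarith [neg_abs_le D, abs_nonneg C]
  have hy' : ∀ t ∈ Icc a T, ∀ i, HasDerivWithinAt (fun s => y s i)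
      (hjField nbr L r (truncate R (y t)) i) (Icc a T) t :=
    fun t ht i => hasDerivWithinAt_pi.1 (hy t ht) i
  have hlin : ∀ t, HasDerivWithinAt (fun s => A * (T - s)) (-A) (Icc a T) t := fun t => by
    simpa using ((hasDerivAt_id t).const_sub T |>.const_mul A).hasDerivWithinAt
  have hpos : ∀ {x : ℝ}, 0 < x → 0 ≤ max (-R) (min R x) := fun hx =>
    le_max_of_le_right (le_min hR hx.le)
  have hneg : ∀ {x : ℝ}, x < 0 → max (-R) (min R x) ≤ 0 := fun hx =>
    max_le (by linarith) ((min_le_right _ _).trans hx.le)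
  have up := le_of_deriv_pos_of_max (f := fun t i => y t i - A * (T - t))
    (f' := fun t i => hjField nbr L r (truncate R (y t)) i - -A) (M := ‖y T‖)
    (fun t ht i => (hy' t ht i).sub (hlin t))
    (fun i => by simpa using (le_abs_self _).trans (norm_le_pi_norm (y T) i))
    (fun t ht i hmax hM => by
      have hti : 0 < y t i := by
        have : 0 ≤ A * (T - t) := mul_nonneg (by positivity) (sub_nonneg.2 ht.2.le)
        linarith [norm_nonneg (y T)]
      have h1 := hC i (fun j => truncate R (y t) j - truncate R (y t) i) fun j =>
        sub_nonpos.2 (truncate_mono_apply R (by linarith [hmax j]))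
      have h2 : 0 ≤ r * truncate R (y t) i := mul_nonneg hr (hpos hti)
      simp only [hjField]
      linarith)
  have down := le_of_deriv_pos_of_max (f := fun t i => -y t i - A * (T - t))
    (f' := fun t i => -hjField nbr L r (truncate R (y t)) i - -A) (M := ‖y T‖)
    (fun t ht i => (hy' t ht i).neg.sub (hlin t))
    (fun i => by simpa using (neg_le_abs _).trans (norm_le_pi_norm (y T) i))
    (fun t ht i hmax hM => by
      have hti : y t i < 0 := by
        have : 0 ≤ A * (T - t) := mul_nonneg (by positivity) (sub_nonneg.2 ht.2.le)
        linarith [norm_nonneg (y T)]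
      have h1 := hD i (fun j => truncate R (y t) j - truncate R (y t) i) fun j =>
        sub_nonneg.2 (truncate_mono_apply R (by linarith [hmax j]))
      have h2 : r * truncate R (y t) i ≤ 0 := mul_nonpos_of_nonneg_of_nonpos hr (hneg hti)
      simp only [hjField]
      linarith)
  refine (pi_norm_le_iff_of_nonneg ?_).2 fun i => abs_le.2 ⟨?_, ?_⟩
  · have : 0 ≤ A * (T - t) := mul_nonneg (by positivity) (sub_nonneg.2 ht.2)
    positivity
  · linarith [down t ht i]
  · linarith [up t ht i]

theorem exists_solution_Icc (hL : CostAssumptions nbr L) {r : ℝ} (hr : 0 ≤ r) (g : Fin N → ℝ)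
    {a T : ℝ} (ha : a ≤ T) :
    ∃ y : ℝ → Fin N → ℝ, y T = g ∧ ∀ t ∈ Icc a T,
      HasDerivWithinAt y (hjField nbr L r (y t)) (Icc a T) t := by
  obtain ⟨A, hA0, hA⟩ := truncated_solution_bound hL hr
  have hR : 0 ≤ ‖g‖ + A * (T - a) := by
    have := mul_nonneg hA0 (sub_nonneg.2 ha)
    positivity
  -- The truncation level is the a priori bound itself, so the truncation is never active.
  obtain ⟨y, hyT, hy⟩ := exists_truncated_solution hL r T g hR ha
  refine ⟨y, hyT, fun t ht => ?_⟩
  have hb : ‖y t‖ ≤ ‖g‖ + A * (T - a) := by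
    refine (hA _ a T y hR hy t ht).trans ?_
    rw [hyT]
    gcongr
    exact ht.1
  simpa [truncate_eq hb] using hy t ht

/-- Both solutions are bounded on the compact interval, and the field is Lipschitz on a ball that
contains them. -/
theorem solution_unique_Icc (hL : CostAssumptions nbr L) {r a T : ℝ} {y z : ℝ → Fin N → ℝ}
    (hy : ∀ t ∈ Icc a T, HasDerivWithinAt y (hjField nbr L r (y t)) (Icc a T) t)
    (hz : ∀ t ∈ Icc a T, HasDerivWithinAt z (hjField nbr L r (z t)) (Icc a T) t)
    (hT : y T = z T) : EqOn y z (Icc a T) := by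
  have cy : ContinuousOn y (Icc a T) := fun t ht => (hy t ht).continuousWithinAt
  have cz : ContinuousOn z (Icc a T) := fun t ht => (hz t ht).continuousWithinAt
  obtain ⟨B, hB⟩ := isCompact_Icc.exists_bound_of_continuousOn cy
  obtain ⟨C, hC⟩ := isCompact_Icc.exists_bound_of_continuousOn cz
  obtain ⟨K, hK⟩ := hjField_lipschitzOn hL r (max B C)
  have key : ∀ {y : ℝ → Fin N → ℝ}, (∀ t ∈ Icc a T,
      HasDerivWithinAt y (hjField nbr L r (y t)) (Icc a T) t) → ∀ t ∈ Ioc a T,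
      HasDerivWithinAt y (hjField nbr L r (y t)) (Iic t) t := fun hy t ht =>
    ((hy t ⟨ht.1.le, ht.2⟩).mono (Icc_subset_Icc_right ht.2)).mono_of_mem_nhdsWithin
      (Icc_mem_nhdsLE ht.1)
  exact ODE_solution_unique_of_mem_Icc_left (v := fun _ => hjField nbr L r)
    (s := fun _ => Metric.closedBall 0 (max B C)) (fun _ _ => hK) cy (key hy)
    (fun t ht => by simpa using Or.inl (hB t ⟨ht.1.le, ht.2⟩)) cz (key hz)
    (fun t ht => by simpa using Or.inr (hC t ⟨ht.1.le, ht.2⟩)) hT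

theorem isHJSolution_iff (hL : CostAssumptions nbr L) (g : Fin N → ℝ) (r T : ℝ)
    (V : ℝ → Fin N → ℝ) : IsHJSolution nbr L g r T V ↔
      V T = g ∧ ∀ t ≤ T, HasDerivWithinAt V (hjField nbr L r (V t)) (Iic T) t := by
  have key : ∀ (d : ℝ) (t : ℝ) (i : Fin N), (((d - r * V t i : ℝ) : EReal) +
      hamiltonian nbr L i (fun j => V t j - V t i) = 0 ↔ d = hjField nbr L r (V t) i) := by
    intro d t i
    rw [hamiltonian_eq_coe hL, ← EReal.coe_add, EReal.coe_eq_zero, hjField]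
    constructor <;> intro h <;> linarith
  constructor
  · refine fun h => ⟨funext h.terminal, fun t ht => hasDerivWithinAt_pi.2 fun i => ?_⟩
    obtain ⟨d, hd, he⟩ := h.equation t ht i
    rwa [(key d t i).1 he] at hd
  · refine fun h => ⟨fun t ht i => ⟨_, hasDerivWithinAt_pi.1 (h.2 t ht) i, (key _ t i).2 rfl⟩, fun i =>
      congrFun h.1 i⟩

theorem isHJSolution_unique (hL : CostAssumptions nbr L) {g : Fin N → ℝ} {r T : ℝ}
    {V W : ℝ → Fin N → ℝ} (hV : IsHJSolution nbr L g r T V) (hW : IsHJSolution nbr L g r T W)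
    {t : ℝ} (ht : t ≤ T) : W t = V t := by
  rw [isHJSolution_iff hL] at hV hW
  refine solution_unique_Icc hL (r := r) (a := t) (T := T) (fun s hs => (hW.2 s hs.2).mono fun _ h => h.2)
    (fun s hs => (hV.2 s hs.2).mono fun _ h => h.2) (hW.1.trans hV.1.symm) ⟨le_rfl, ht⟩

/-- Solutions on the intervals [T - n, T] agree on overlaps by uniqueness and are glued. -/
theorem exists_isHJSolution (hL : CostAssumptions nbr L) (g : Fin N → ℝ) {r : ℝ} (hr : 0 ≤ r)
    (T : ℝ) : ∃ V : ℝ → Fin N → ℝ, IsHJSolution nbr L g r T V := by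
  choose y hyT hy using fun n : ℕ => exists_solution_Icc hL hr g
    (sub_le_self T (Nat.cast_nonneg n : (0 : ℝ) ≤ n))
  have hmono : ∀ m n : ℕ, m ≤ n → EqOn (y m) (y n) (Icc (T - m) T) := fun m n hmn => by
    have hmn' : (m : ℝ) ≤ n := by exact_mod_cast hmn
    have hsub : Icc (T - m) T ⊆ Icc (T - n) T := Icc_subset_Icc_left (by linarith)
    exact solution_unique_Icc hL (hy m) (fun t ht => (hy n t (hsub ht)).mono hsub)
      ((hyT m).trans (hyT n).symm)
  have heq : ∀ (n : ℕ) (t : ℝ), t ∈ Icc (T - n) T → y ⌈T - t⌉₊ t = y n t := fun n t ht =>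
    hmono _ _ (Nat.ceil_le.2 (by linarith [ht.1])) ⟨by linarith [Nat.le_ceil (T - t)], ht.2⟩
  refine ⟨fun t => y ⌈T - t⌉₊ t, (isHJSolution_iff hL g r T _).2 ⟨?_, fun t ht => ?_⟩⟩
  · simpa using hyT 0
  -- One more than the index used at t gives T - n < t strictly, so [T - n, T] is a neighbourhood of
  -- t within (-∞, T].
  · set n := ⌈T - t⌉₊ + 1 with hn
    have htn : T - n < t := by
      rw [hn]; push_cast; linarith [Nat.le_ceil (T - t)]
    have h := hy n t ⟨htn.le, ht⟩
    rw [← heq n t ⟨htn.le, ht⟩] at h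
    refine (h.congr (fun s hs => heq n s hs) (heq n t ⟨htn.le, ht⟩)).mono_of_mem_nhdsWithin ?_
    rw [mem_nhdsWithin]
    exact ⟨Ioi (T - n), isOpen_Ioi, htn, fun s hs => ⟨hs.1.le, hs.2⟩⟩

/-! ### Measurable selections of the maximisers -/

/-- A compact-valued multifunction with closed graph has a measurable selection. -/
theorem exists_measurable_selection {E : Type*} [MetricSpace E] [MeasurableSpace E] [BorelSpace E]
    [Nonempty E] {S : Set ℝ} (hS : IsClosed S) {Q : Set E} (hQ : IsCompact Q) {Γ : Set (ℝ × E)}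
    (hΓ : IsClosed Γ) (hne : ∀ t ∈ S, ∃ x ∈ Q, (t, x) ∈ Γ) :
    ∃ f : ℝ → E, Measurable f ∧ ∀ t ∈ S, (t, f t) ∈ Γ := by
  rcases S.eq_empty_or_nonempty with rfl | ⟨t₀, ht₀⟩
  · exact ⟨fun _ => Classical.arbitrary E, measurable_const, by simp⟩
  have : CompactSpace Q := isCompact_iff_compactSpace.1 hQ
  obtain ⟨x₀, hx₀, -⟩ := hne t₀ ht₀
  have : Nonempty Q := ⟨⟨x₀, hx₀⟩⟩
  have hCc : IsCompact cantorSet := isCompact_cantorSet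
  have : CompactSpace cantorSet := isCompact_iff_compactSpace.1 hCc
  -- The compact set Q is a continuous image of the Cantor set. Its points are thus labelled by real
  -- numbers from a compact set, and the selection takes the least admissible label.
  obtain ⟨π, hπc, hπs⟩ := exists_nat_bool_continuous_surjective_of_compact Q
  set θ : cantorSet → E := fun c => (π (cantorSetHomeomorphNatToBool c) : E) with hθ
  have hθc : Continuous θ := by fun_prop
  have hθs : ∀ x ∈ Q, ∃ c, θ c = x := fun x hx => by
    obtain ⟨b, hb⟩ := hπs ⟨x, hx⟩
    exact ⟨cantorSetHomeomorphNatToBool.symm b, by simp [hθ, hb]⟩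
  set D : ℝ → Set cantorSet := fun t => {c | t ∈ S ∧ (t, θ c) ∈ Γ} with hD
  have hDne : ∀ t ∈ S, (D t).Nonempty := fun t ht => by
    obtain ⟨x, hx, hxt⟩ := hne t ht
    obtain ⟨c, rfl⟩ := hθs x hx
    exact ⟨c, ht, hxt⟩
  have hDc : ∀ t ∈ S, IsClosed (D t) := fun t ht => by
    have : D t = (fun c => (t, θ c)) ⁻¹' Γ := by ext c; simp [hD, ht]
    rw [this]
    exact hΓ.preimage (by fun_prop)
  set m : ℝ → ℝ := fun t => sInf ((↑) '' D t) with hm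
  have hmem : ∀ t ∈ S, ∃ c ∈ D t, (c : ℝ) = m t := fun t ht =>
    (((hDc t ht).isCompact.image continuous_subtype_val).sInf_mem ((hDne t ht).image _))
  have hle : ∀ t, ∀ c ∈ D t, m t ≤ c := fun t c hc =>
    csInf_le (hCc.bddBelow.mono (by rintro _ ⟨c, -, rfl⟩; exact c.2)) ⟨c, hc, rfl⟩
  have hmm : Measurable m := by
    refine measurable_of_Iic fun a => ?_
    -- Outside S there is no admissible label and `sInf ∅ = 0`, whence the second piece.
    have h1 : m ⁻¹' Iic a = (Prod.fst '' {q : ℝ × cantorSet | q.1 ∈ S ∧ (q.1, θ q.2) ∈ Γ ∧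
        (q.2 : ℝ) ≤ a}) ∪ (Sᶜ ∩ {_t | (0 : ℝ) ≤ a}) := by
      ext t
      by_cases ht : t ∈ S
      · simp only [mem_preimage, mem_Iic, mem_union, mem_image, mem_inter_iff, mem_compl_iff, ht,
          not_true_eq_false, false_and, or_false]
        constructor
        · intro h
          obtain ⟨c, hc, hcm⟩ := hmem t ht
          exact ⟨(t, c), ⟨ht, hc.2, hcm.trans_le h⟩, rfl⟩
        · rintro ⟨⟨t', c⟩, h, rfl⟩
          exact (hle t' c ⟨h.1, h.2.1⟩).trans h.2.2
      · have hDt : D t = ∅ := by ext c; simp [hD, ht]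
        simp only [hm, hDt, mem_preimage, image_empty, Real.sInf_empty, mem_Iic, mem_union,
          mem_image, mem_inter_iff, mem_compl_iff, ht, not_false_eq_true, true_and,
          mem_ofPred_eq]
        refine ⟨Or.inr, fun h => h.resolve_left ?_⟩
        rintro ⟨⟨t', c⟩, h', rfl⟩
        exact ht h'.1
    rw [h1]
    refine (IsClosed.measurableSet ?_).union (hS.measurableSet.compl.inter (.const _))
    -- The times with an admissible label at most a form the projection of a closed set along a
    -- compact factor, so they form a closed set.
    refine isClosedMap_fst_of_compactSpace _ ?_
    refine (hS.preimage continuous_fst).inter ((hΓ.preimage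
      (f := fun q : ℝ × cantorSet => (q.1, θ q.2)) (by fun_prop)).inter
      (isClosed_le (continuous_subtype_val.comp continuous_snd) continuous_const))
  -- The parametrisation is extended measurably from the Cantor set to ℝ so that it can be composed
  -- with the real-valued m.
  obtain ⟨θ', hθ', hθe⟩ := (MeasurableEmbedding.subtype_coe
    hCc.isClosed.measurableSet).exists_measurable_extend hθc.measurable fun _ => inferInstance
  refine ⟨θ' ∘ m, hθ'.comp hmm, fun t ht => ?_⟩
  obtain ⟨c, hc, hcm⟩ := hmem t ht
  have : θ' (m t) = θ c := by rw [← hcm]; exact congrFun hθe c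
  simpa [this] using hc.2

theorem exists_measurable_argmax (hL : CostAssumptions nbr L) {a b : ℝ}
    {V : ℝ → Fin N → ℝ} (hV : ContinuousOn V (Icc a b)) :
    ∃ c : Control nbr, (∀ i, Measurable fun t => c t i) ∧
      ∀ i, ∀ t ∈ Icc a b, c t i ∈ argmaxSet nbr L i fun j => V t j - V t i := by
  rcases (Icc a b).eq_empty_or_nonempty with he | hab
  · exact ⟨0, fun i => measurable_const, by simp [he]⟩
  rw [nonempty_Icc] at hab
  -- Freezing time outside [a, b] makes the data continuous on ℝ, so the graph of the argmax is
  -- closed in the full product.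
  set W : ℝ → Fin N → ℝ := fun t => V (projIcc a b hab t) with hW
  have hWc : Continuous W := hV.comp_continuous (by fun_prop) fun t => (projIcc a b hab t).2
  have key : ∀ i : Fin N, ∃ c : ℝ → nbr i → ℝ, Measurable c ∧
      ∀ t ∈ Icc a b, c t ∈ argmaxSet nbr L i fun j => V t j - V t i := by
    intro i
    have hpc : Continuous fun t => (fun j => W t j - W t i : nbr i → ℝ) := by fun_prop
    obtain ⟨R, hR⟩ := isCompact_Icc.exists_bound_of_continuousOn (hpc.continuousOn (s := Icc a b))
    obtain ⟨B, -, hB⟩ := exists_argmax hL i R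
    obtain ⟨f, hf, hfm⟩ := exists_measurable_selection (S := Icc a b) isClosed_Icc
      (isCompact_closedBall (0 : nbr i → ℝ) B)
      (Γ := {q : ℝ × (nbr i → ℝ) | q.2 ∈ argmaxSet nbr L i fun j => W q.1 j - W q.1 i})
      ((isClosed_argmaxGraph hL i).preimage
        (f := fun q : ℝ × (nbr i → ℝ) => ((fun j => W q.1 j - W q.1 i : nbr i → ℝ), q.2))
        (by fun_prop))
      (fun t ht => by
        obtain ⟨⟨l, hl⟩, hb⟩ := hB _ (hR t ht)
        exact ⟨l, by simpa using hb l hl, hl⟩)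
    refine ⟨f, hf, fun t ht => ?_⟩
    have := hfm t ht
    simpa [hW, projIcc_of_mem hab ht] using this
  choose c hc hcm using key
  exact ⟨fun t i => c i t, hc, hcm⟩

theorem exists_bound_of_mem_argmax (hL : CostAssumptions nbr L) {a b : ℝ}
    {V : ℝ → Fin N → ℝ} (hV : ContinuousOn V (Icc a b)) :
    ∃ B : ℝ, 0 < B ∧ ∀ c : Control nbr, (∀ i, ∀ t ∈ Icc a b,
      c t i ∈ argmaxSet nbr L i fun j => V t j - V t i) →
      ∀ t ∈ Icc a b, ∀ i j, 0 ≤ c t i j ∧ c t i j ≤ B := by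
  obtain ⟨R, hR⟩ := isCompact_Icc.exists_bound_of_continuousOn hV
  choose B hB0 hB using fun i => exists_argmax hL i (2 * R)
  refine ⟨1 + ∑ i, B i, add_pos_of_pos_of_nonneg one_pos (Finset.sum_nonneg fun i _ => hB0 i),
    fun c hc t ht i j => ⟨(hc i t ht).1 j, ?_⟩⟩
  have hp : ‖(fun j => V t j - V t i : nbr i → ℝ)‖ ≤ 2 * R := by
    refine (pi_norm_le_iff_of_nonneg (by linarith [norm_nonneg (V t), hR t ht])).2 fun j => ?_
    exact (norm_sub_le _ _).trans
      (by linarith [norm_le_pi_norm (V t) j, norm_le_pi_norm (V t) i, hR t ht])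
  have h1 := (hB i _ hp).2 _ (hc i t ht)
  have h2 : B i ≤ ∑ i, B i := Finset.single_le_sum (fun i _ => hB0 i) (Finset.mem_univ i)
  linarith [le_abs_self (c t i j), norm_le_pi_norm (c t i) j, Real.norm_eq_abs (c t i j)]

/-! ### Right-continuous processes with values in a finite set -/

theorem measurable_uncurry_of_rightCont {Ω : Type*} [MeasurableSpace Ω] {X : ℝ → Ω → Fin N}
    (hm : ∀ u, Measurable (X u))
    (hr : ∀ ω u, ContinuousWithinAt (fun v => X v ω) (Ici u) u) :
    Measurable fun q : ℝ × Ω => X q.1 q.2 := by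
  -- ρ n u is a grid point to the right of u within 1 / (n + 1). For fixed n it takes countably many
  -- values, so X along ρ n is jointly measurable, and right-continuity passes to the limit.
  set ρ : ℕ → ℝ → ℝ := fun n u => ((⌊u * (n + 1)⌋ : ℝ) + 1) / (n + 1) with hρ
  have hρ1 : ∀ n u, u ≤ ρ n u := fun n u => by
    rw [hρ, le_div_iff₀ (by positivity)]
    exact (Int.lt_floor_add_one _).le
  have hρ2 : ∀ n u, ρ n u ≤ u + 1 / (n + 1 : ℝ) := fun n u => by
    have : u + 1 / (n + 1 : ℝ) = (u * (n + 1) + 1) / (n + 1) := by field_simp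
    rw [hρ, this]
    simp only
    gcongr
    exact Int.floor_le _
  have hρl : ∀ u, Tendsto (fun n => ρ n u) atTop (𝓝[≥] u) := fun u => by
    refine tendsto_nhdsWithin_iff.2 ⟨?_, Eventually.of_forall fun n => hρ1 n u⟩
    refine tendsto_of_tendsto_of_tendsto_of_le_of_le tendsto_const_nhds ?_ (fun n => hρ1 n u)
      (fun n => hρ2 n u)
    simpa using (tendsto_one_div_add_atTop_nhds_zero_nat (𝕜 := ℝ)).const_add u
  refine measurable_of_tendsto_metrizable (f := fun n q => X (ρ n q.1) q.2) (fun n => ?_) ?_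
  · have h1 : Measurable fun q : Ω × ℤ => X (((q.2 : ℝ) + 1) / (n + 1)) q.1 :=
      measurable_from_prod_countable_left fun k => (hm (((k : ℝ) + 1) / (n + 1)) :)
    exact h1.comp (measurable_snd.prodMk
      (Int.measurable_floor.comp ((measurable_fst.mul_const _) : Measurable fun q : ℝ × Ω => q.1 * (n + 1))))
  · exact tendsto_pi_nhds.2 fun q => (hr q.2 q.1).tendsto.comp (hρl q.1)

/-- Progressive measurability: only the values of X on [t, s] enter, so the σ-algebra on Ω may be
the one of time s. -/
theorem measurable_projIcc_of_rightCont {Ω : Type*} [MeasurableSpace Ω] {X : ℝ → Ω → Fin N}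
    {t s : ℝ} (hts : t ≤ s) (hm : ∀ u ∈ Icc t s, Measurable (X u))
    (hr : ∀ ω, ∀ u ∈ Ico t s, ContinuousWithinAt (fun v => X v ω) (Ici u) u) :
    Measurable fun q : ℝ × Ω => X (projIcc t s hts q.1) q.2 := by
  refine measurable_uncurry_of_rightCont (X := fun u => X (projIcc t s hts u))
    (fun u => hm _ (projIcc t s hts u).2) fun ω u => ?_
  rcases hts.eq_or_lt with rfl | hts'
  · exact (continuousWithinAt_const (b := X t ω)).congr (fun v _ => by simp [coe_projIcc])
      (by simp [coe_projIcc])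
  rcases lt_or_ge u s with hus | hus
  · have h1 : ContinuousWithinAt (fun v => X v ω) (Ici (projIcc t s hts u : ℝ)) (projIcc t s hts u) :=
      hr ω _ ⟨(projIcc t s hts u).2.1, by simp [coe_projIcc, hus, hts']⟩
    exact h1.comp (f := fun v => (projIcc t s hts v : ℝ))
      (continuous_subtype_val.comp continuous_projIcc).continuousWithinAt fun v hv => (monotone_projIcc hts hv : projIcc t s hts u ≤ projIcc t s hts v)
  · refine (continuousWithinAt_const (b := X s ω)).congr (fun v hv => ?_) ?_
    · rw [projIcc_of_right_le hts (hus.trans hv)]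
    · rw [projIcc_of_right_le hts hus]

theorem integral_comp_fin {Ω : Type*} [MeasurableSpace Ω] {μ : Measure Ω} [IsProbabilityMeasure μ]
    {Y : Ω → Fin N} (hY : Measurable Y) (f : Fin N → ℝ) :
    ∫ ω, f (Y ω) ∂μ = ∑ m, μ.real {ω | Y ω = m} * f m := by
  have : IsProbabilityMeasure (μ.map Y) := Measure.isProbabilityMeasure_map hY.aemeasurable
  rw [← integral_map (φ := Y) (f := f) hY.aemeasurable (measurable_of_finite f).aestronglyMeasurable,
    integral_fintype .of_finite]
  refine Finset.sum_congr rfl fun m _ => ?_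
  rw [map_measureReal_apply hY (measurableSet_singleton m)]
  rfl

theorem integrable_comp_fin_prod {Ω : Type*} [MeasurableSpace Ω] {μ : Measure Ω}
    [IsProbabilityMeasure μ] {l : Measure ℝ} [SFinite l] {Y : ℝ × Ω → Fin N} (hY : Measurable Y)
    {φ : ℝ → Fin N → ℝ} (hφ : ∀ m, Integrable (fun u => φ u m) l) :
    Integrable (fun q : ℝ × Ω => φ q.1 (Y q)) (l.prod μ) := by
  have h : (fun q : ℝ × Ω => φ q.1 (Y q)) =
      fun q => ∑ m, ({q | Y q = m} : Set (ℝ × Ω)).indicator (fun q => φ q.1 m) q := by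
    funext q
    simp [Set.indicator_apply]
  rw [h]
  refine integrable_finsetSum _ fun m _ => ?_
  exact ((hφ m).comp_fst μ).indicator (hY (measurableSet_singleton m))

theorem integral_integral_comp_fin {Ω : Type*} [MeasurableSpace Ω] {μ : Measure Ω}
    [IsProbabilityMeasure μ] {l : Measure ℝ} [SFinite l] {Y : ℝ × Ω → Fin N} (hY : Measurable Y)
    {φ : ℝ → Fin N → ℝ} (hφ : ∀ m, Integrable (fun u => φ u m) l) :
    ∫ ω, ∫ u, φ u (Y (u, ω)) ∂l ∂μ = ∫ u, ∑ m, μ.real {ω | Y (u, ω) = m} * φ u m ∂l := by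
  rw [← integral_integral_swap (f := fun u ω => φ u (Y (u, ω))) (integrable_comp_fin_prod hY hφ)]
  congr 1
  funext u
  exact integral_comp_fin (hY.comp measurable_prodMk_left) (φ u)

/-! ### Marginal laws of a controlled chain -/

theorem generator_integrable {t T : ℝ} {c : Control nbr} (hc : c ∈ admissible nbr t T)
    (f : Fin N → ℝ) (m : Fin N) : IntegrableOn (fun u => generator c u f m) (Icc t T) :=
  integrable_finsetSum _ fun j _ => (hc.2 m j).mul_const _

namespace ControlledChain

variable {t T : ℝ} {i : Fin N} {c : Control nbr} (Z : ControlledChain nbr t T i c)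

/-- The law of the chain at time `s`. -/
def prob (s : ℝ) (m : Fin N) : ℝ :=
  letI := Z.mΩ
  Z.μ.real {ω | Z.X s ω = m}

/-- The chain with its time parameter projected to `[t, T]`. -/
def path (htT : t ≤ T) (q : ℝ × Z.Ω) : Fin N := Z.X (projIcc t T htT q.1) q.2

theorem path_eq (htT : t ≤ T) {s : ℝ} (hs : s ∈ Icc t T) (ω : Z.Ω) :
    Z.path htT (s, ω) = Z.X s ω := by
  simp [path, projIcc_of_mem htT hs]

theorem measurable_path (htT : t ≤ T) :
    letI := Z.mΩ
    Measurable (Z.path htT) := by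
  let _ := Z.mΩ
  exact measurable_projIcc_of_rightCont htT
    (fun u hu => (Z.adapted ⟨u, hu⟩).mono (Z.filtration.le _) le_rfl) Z.rightCont

theorem prob_nonneg (s : ℝ) (m : Fin N) : 0 ≤ Z.prob s m := measureReal_nonneg

theorem prob_le_one (s : ℝ) (m : Fin N) : Z.prob s m ≤ 1 := by
  let _ := Z.mΩ
  have := Z.isProb
  exact measureReal_le_one

theorem measurable_prob_projIcc (htT : t ≤ T) (m : Fin N) :
    Measurable fun s : ℝ => Z.prob (projIcc t T htT s) m := by
  let _ := Z.mΩ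
  have := Z.isProb
  have h : MeasurableSet {q : ℝ × Z.Ω | Z.path htT q = m} :=
    Z.measurable_path htT (measurableSet_singleton m)
  exact (measurable_measure_prodMk_left (ν := Z.μ) h).ennreal_toReal

theorem aestronglyMeasurable_prob (m : Fin N) :
    AEStronglyMeasurable (fun s => Z.prob s m) (volume.restrict (Icc t T)) := by
  rcases le_or_gt t T with htT | htT
  · refine (Z.measurable_prob_projIcc htT m).aestronglyMeasurable.congr ?_
    filter_upwards [ae_restrict_mem measurableSet_Icc] with s hs
    simp [projIcc_of_mem htT hs]
  · simp [Icc_eq_empty htT.not_ge]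

theorem integrable_prob_mul {φ : ℝ → ℝ} (hφ : IntegrableOn φ (Icc t T)) (m : Fin N) :
    IntegrableOn (fun s => Z.prob s m * φ s) (Icc t T) :=
  hφ.bdd_mul (Z.aestronglyMeasurable_prob m) (c := 1) <| .of_forall fun s => by
    rw [Real.norm_of_nonneg (Z.prob_nonneg s m)]
    exact Z.prob_le_one s m

theorem integral_X {s : ℝ} (hs : s ∈ Icc t T) (f : Fin N → ℝ) :
    letI := Z.mΩ
    ∫ ω, f (Z.X s ω) ∂Z.μ = ∑ m, Z.prob s m * f m := by
  let _ := Z.mΩ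
  have := Z.isProb
  exact integral_comp_fin ((Z.adapted ⟨s, hs⟩).mono (Z.filtration.le _) le_rfl) f

theorem integrable_X {s : ℝ} (hs : s ∈ Icc t T) (f : Fin N → ℝ) :
    letI := Z.mΩ
    Integrable (fun ω => f (Z.X s ω)) Z.μ := by
  let _ := Z.mΩ
  have := Z.isProb
  have hX : Measurable (Z.X s) := (Z.adapted ⟨s, hs⟩).mono (Z.filtration.le _) le_rfl
  exact Integrable.comp_measurable (g := f) .of_finite hX

theorem integral_integral_X {s : ℝ} (hs : s ∈ Icc t T) {φ : ℝ → Fin N → ℝ}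
    (hφ : ∀ m, IntegrableOn (fun u => φ u m) (Icc t T)) :
    letI := Z.mΩ
    Integrable (fun ω => ∫ u in t..s, φ u (Z.X u ω)) Z.μ ∧
    ∫ ω, (∫ u in t..s, φ u (Z.X u ω)) ∂Z.μ = ∫ u in t..s, ∑ m, Z.prob u m * φ u m := by
  let _ := Z.mΩ
  have := Z.isProb
  have htT : t ≤ T := hs.1.trans hs.2
  have hsub : Ioc t s ⊆ Icc t T := fun u hu => ⟨hu.1.le, hu.2.trans hs.2⟩
  have hφ' : ∀ m, Integrable (fun u => φ u m) (volume.restrict (Ioc t s)) := fun m =>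
    (hφ m).mono_set hsub
  have e1 : ∀ ω, ∫ u in t..s, φ u (Z.X u ω) = ∫ u in Ioc t s, φ u (Z.path htT (u, ω)) := fun ω => by
    rw [intervalIntegral.integral_of_le hs.1]
    exact setIntegral_congr_fun measurableSet_Ioc fun u hu => by simp only [Z.path_eq htT (hsub hu)]
  have e2 : ∫ u in t..s, ∑ m, Z.prob u m * φ u m =
      ∫ u in Ioc t s, ∑ m, Z.μ.real {ω | Z.path htT (u, ω) = m} * φ u m := by
    rw [intervalIntegral.integral_of_le hs.1]
    exact setIntegral_congr_fun measurableSet_Ioc fun u hu => by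
      simp only [Z.path_eq htT (hsub hu)]; rfl
  simp_rw [e1]
  rw [e2]
  exact ⟨(integrable_comp_fin_prod (Z.measurable_path htT) hφ').integral_prod_right,
    integral_integral_comp_fin (Z.measurable_path htT) hφ'⟩

/-- The forward equation. -/
theorem forward (hc : c ∈ admissible nbr t T) {s : ℝ} (hs : s ∈ Icc t T) (f : Fin N → ℝ) :
    ∑ m, Z.prob s m * f m = f i + ∫ u in t..s, ∑ m, Z.prob u m * generator c u f m := by
  let _ := Z.mΩ
  have := Z.isProb
  have htT : t ≤ T := hs.1.trans hs.2
  have h := (Z.martingale f).setIntegral_eq (i := ⟨t, le_rfl, htT⟩) (j := ⟨s, hs⟩) hs.1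
    MeasurableSet.univ
  simp only [Measure.restrict_univ, intervalIntegral.integral_same, sub_zero] at h
  obtain ⟨h1, h2⟩ := Z.integral_integral_X hs (generator_integrable hc f)
  rw [integral_sub (Z.integrable_X hs f) h1, h2, Z.integral_X hs] at h
  have h3 : ∫ ω, f (Z.X t ω) ∂Z.μ = f i := by
    rw [integral_congr_ae (g := fun _ => f i) (Z.initial.mono fun ω hω => by simp only [hω])]
    simp
  rw [h3] at h
  linarith

end ControlledChain

/-! ### Verification -/

/-- The rates are merely integrable, so the marginal laws are only absolutely continuous in time;
integration by parts is therefore needed for primitives of L¹ functions. -/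
theorem integral_parts_of_integrable {b w : ℝ → ℝ} {t T : ℝ} (hb : IntervalIntegrable b volume t T)
    (hw : IntervalIntegrable w volume t T) (p₀ v₀ : ℝ) :
    ∫ s in t..T, (b s * (v₀ + ∫ u in t..s, w u) + (p₀ + ∫ u in t..s, b u) * w s) =
      (p₀ + ∫ u in t..T, b u) * (v₀ + ∫ u in t..T, w u) - p₀ * v₀ := by
  have ac : ∀ {b : ℝ → ℝ} (p₀ : ℝ), IntervalIntegrable b volume t T →
      AbsolutelyContinuousOnInterval (fun s => p₀ + ∫ u in t..s, b u) t T := fun p₀ hb =>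
    AbsolutelyContinuousOnInterval.add
      (LipschitzWith.const p₀).lipschitzOnWith.absolutelyContinuousOnInterval
      (hb.absolutelyContinuousOnInterval_intervalIntegral left_mem_uIcc)
  have h := (ac p₀ hb).integral_deriv_mul_eq_sub (ac v₀ hw)
  simp only [intervalIntegral.integral_same, add_zero] at h
  rw [← h]
  refine intervalIntegral.integral_congr_ae ?_
  filter_upwards [hb.ae_hasDerivAt_integral, hw.ae_hasDerivAt_integral] with s h1 h2 hs
  have hs' := uIoc_subset_uIcc hs
  rw [((h1 hs' t left_mem_uIcc).const_add p₀).deriv, ((h2 hs' t left_mem_uIcc).const_add v₀).deriv]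

/-- The generator is linear in f, and v is the combination of the indicators of the nodes with
coefficients v k. -/
theorem sum_generator_single (c : Control nbr) (u : ℝ) (v : Fin N → ℝ) (m : Fin N) :
    ∑ k, generator c u (Pi.single k 1) m * v k = generator c u v m := by
  simp only [generator, Finset.sum_mul]
  rw [Finset.sum_comm]
  refine Finset.sum_congr rfl fun j _ => ?_
  simp only [mul_assoc, ← Finset.mul_sum, sub_mul, Finset.sum_sub_distrib]
  simp [Pi.single_apply]

/-- The amount by which `c` falls short of attaining the Hamiltonian, up to the cost. -/
def slack (nbr : Fin N → Finset (Fin N)) (L : Cost nbr) (V : ℝ → Fin N → ℝ) (c : Control nbr)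
    (u : ℝ) (m : Fin N) : ℝ :=
  (∑ j, c u m j * (V u j - V u m)) - realHam nbr L m fun j => V u j - V u m

theorem IsHJSolution.continuousOn (hL : CostAssumptions nbr L) {g : Fin N → ℝ} {r T : ℝ}
    {V : ℝ → Fin N → ℝ} (hV : IsHJSolution nbr L g r T V) : ContinuousOn V (Iic T) :=
  fun t ht => (((isHJSolution_iff hL g r T V).1 hV).2 t ht).continuousWithinAt

theorem slack_integrable (hL : CostAssumptions nbr L) {g : Fin N → ℝ} {r T t : ℝ}
    {V : ℝ → Fin N → ℝ} (hV : IsHJSolution nbr L g r T V) {c : Control nbr}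
    (hc : c ∈ admissible nbr t T) (m : Fin N) :
    IntegrableOn (fun u => Real.exp (-r * (u - t)) * slack nbr L V c u m) (Icc t T) := by
  have hVc : ContinuousOn V (Icc t T) := (hV.continuousOn hL).mono fun _ h => h.2
  have hVc' : ∀ j, ContinuousOn (fun u => V u j) (Icc t T) := fun j =>
    (continuous_apply j).comp_continuousOn hVc
  have hexp : ContinuousOn (fun u => Real.exp (-r * (u - t))) (Icc t T) := by fun_prop
  refine IntegrableOn.continuousOn_mul hexp (Integrable.sub ?_ ?_) isCompact_Icc
  · exact integrable_finsetSum _ fun j _ =>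
      (hc.2 m j).mul_continuousOn ((hVc' j).sub (hVc' m)) isCompact_Icc
  · refine ContinuousOn.integrableOn_Icc ((continuous_realHam hL m).comp_continuousOn ?_)
    exact continuousOn_pi.2 fun j => (hVc' j).sub (hVc' m)

/-- In the derivative of ∑ₖ P(X_s = k) e^{-r(s-t)} V_k(s) the forward equation contributes the
generator applied to V. The discount cancels r V in the Hamilton-Jacobi equation and leaves -H.
Together they are the expected discounted slack. -/
theorem verification (hL : CostAssumptions nbr L) {g : Fin N → ℝ} {r T t : ℝ} (htT : t ≤ T)
    {V : ℝ → Fin N → ℝ} (hV : IsHJSolution nbr L g r T V) {i : Fin N} {c : Control nbr}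
    (hc : c ∈ admissible nbr t T) (Z : ControlledChain nbr t T i c) :
    Real.exp (-r * (T - t)) * ∑ m, Z.prob T m * g m -
      ∫ u in t..T, ∑ m, Z.prob u m * (Real.exp (-r * (u - t)) * slack nbr L V c u m) = V t i := by
  obtain ⟨hVT, hVd⟩ := (isHJSolution_iff hL g r T V).1 hV
  have hVc : ContinuousOn V (Icc t T) := (hV.continuousOn hL).mono fun _ h => h.2
  have hVc' : ∀ j, ContinuousOn (fun u => V u j) (Icc t T) := fun j =>
    (continuous_apply j).comp_continuousOn hVc
  set H : ℝ → Fin N → ℝ := fun u m => realHam nbr L m fun j => V u j - V u m with hH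
  have hHc : ∀ m, ContinuousOn (fun u => H u m) (Icc t T) := fun m =>
    (continuous_realHam hL m).comp_continuousOn
      (continuousOn_pi.2 fun j => (hVc' j).sub (hVc' m))
  set e : ℝ → ℝ := fun u => Real.exp (-r * (u - t)) with he
  have hec : Continuous e := by fun_prop
  set v : Fin N → ℝ → ℝ := fun k s => e s * V s k with hv
  set w : Fin N → ℝ → ℝ := fun k s => -(e s * H s k) with hw
  have hvc : ∀ k, ContinuousOn (v k) (Icc t T) := fun k => hec.continuousOn.mul (hVc' k)
  have hwi : ∀ k, IntervalIntegrable (w k) volume t T := fun k =>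
    ContinuousOn.intervalIntegrable (by
      rw [uIcc_of_le htT]; exact (hec.continuousOn.mul (hHc k)).neg)
  have hvd : ∀ k, ∀ s ∈ Ioo t T, HasDerivAt (v k) (w k s) s := fun k s hs => by
    have h1 : HasDerivAt (fun s => V s k) (hjField nbr L r (V s) k) s :=
      (hasDerivWithinAt_pi.1 (hVd s hs.2.le) k).hasDerivAt (Iic_mem_nhds hs.2)
    have h2 : HasDerivAt e (e s * (-r * 1)) s :=
      ((hasDerivAt_id s).sub_const t |>.const_mul (-r)).exp
    refine (h2.mul h1).congr_deriv ?_
    simp only [hw, hH, hjField]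
    ring
  have hve : ∀ k, ∀ s ∈ Icc t T, v k s = v k t + ∫ u in t..s, w k u := fun k s hs => by
    rw [intervalIntegral.integral_eq_sub_of_hasDerivAt_of_le hs.1
      ((hvc k).mono (Icc_subset_Icc_right hs.2)) (fun x hx => hvd k x ⟨hx.1, hx.2.trans_le hs.2⟩)
      ((hwi k).mono_set (by rw [uIcc_of_le hs.1, uIcc_of_le htT]; exact Icc_subset_Icc_right hs.2))]
    ring
  set b : Fin N → ℝ → ℝ := fun k u => ∑ m, Z.prob u m * generator c u (Pi.single k 1) m with hb
  have hbi : ∀ k, IntervalIntegrable (b k) volume t T := fun k => by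
    rw [intervalIntegrable_iff_integrableOn_Icc_of_le htT]
    exact integrable_finsetSum _ fun m _ => Z.integrable_prob_mul (generator_integrable hc _ m) m
  have hpe : ∀ k, ∀ s ∈ Icc t T, Z.prob s k = (Pi.single k 1 : Fin N → ℝ) i + ∫ u in t..s, b k u :=
    fun k s hs => by
      rw [← Z.forward hc hs]
      simp [Pi.single_apply]
  have hT : T ∈ Icc t T := ⟨htT, le_rfl⟩
  have hparts : ∀ k, ∫ s in t..T, (b k s * v k s + Z.prob s k * w k s) =
      Z.prob T k * v k T - (Pi.single k 1 : Fin N → ℝ) i * v k t := fun k => by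
    rw [hpe k T hT, hve k T hT, ← integral_parts_of_integrable (hbi k) (hwi k)]
    refine intervalIntegral.integral_congr fun s hs => ?_
    rw [uIcc_of_le htT] at hs
    rw [hpe k s hs, hve k s hs]
  have hint : ∀ k ∈ Finset.univ, IntervalIntegrable (fun s => b k s * v k s + Z.prob s k * w k s)
      volume t T := fun k _ => by
    refine ((hbi k).mul_continuousOn (by rw [uIcc_of_le htT]; exact hvc k)).add ?_
    rw [intervalIntegrable_iff_integrableOn_Icc_of_le htT]
    exact Z.integrable_prob_mul
      ((intervalIntegrable_iff_integrableOn_Icc_of_le htT).1 (hwi k)) k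
  have hsum : ∫ u in t..T, ∑ m, Z.prob u m * (e u * slack nbr L V c u m) =
      ∑ k, (Z.prob T k * v k T - (Pi.single k 1 : Fin N → ℝ) i * v k t) := by
    rw [← Finset.sum_congr rfl fun k _ => hparts k, ← intervalIntegral.integral_finsetSum hint]
    refine intervalIntegral.integral_congr fun u _ => ?_
    simp only [Finset.sum_add_distrib, hb, Finset.sum_mul]
    rw [Finset.sum_comm, ← Finset.sum_add_distrib]
    refine Finset.sum_congr rfl fun m _ => ?_
    have hg : generator c u (fun k => v k u) m = e u * ∑ j, c u m j * (V u j - V u m) := by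
      simp only [generator, hv, Finset.mul_sum]
      exact Finset.sum_congr rfl fun j _ => by ring
    simp only [mul_assoc, ← Finset.mul_sum]
    rw [sum_generator_single, hg]
    simp only [hw, hH, slack]
    ring
  rw [hsum, Finset.sum_sub_distrib]
  have h1 : ∑ k, Z.prob T k * v k T = e T * ∑ m, Z.prob T m * g m := by
    rw [Finset.mul_sum]
    refine Finset.sum_congr rfl fun k _ => ?_
    simp only [hv, hVT]
    ring
  have h2 : ∑ k, (Pi.single k 1 : Fin N → ℝ) i * v k t = V t i := by
    simp [Pi.single_apply, hv, he]
  rw [h1, h2]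
  ring

/-! ### Marked Poisson clocks -/

open ProbabilityTheory in
theorem expMeasure_real_Ioi {K : ℝ} (hK : 0 < K) {x : ℝ} (hx : 0 ≤ x) :
    (expMeasure K).real (Ioi x) = Real.exp (-(K * x)) := by
  have := isProbabilityMeasure_expMeasure hK
  rw [← compl_Iic, probReal_compl_eq_one_sub measurableSet_Iic, ← cdf_eq_real,
    cdf_expMeasure_eq hK, if_pos hx]
  ring

open ProbabilityTheory in
theorem ae_pos_expMeasure {K : ℝ} (hK : 0 < K) : ∀ᵐ e ∂(expMeasure K), 0 < e := by
  have := isProbabilityMeasure_expMeasure hK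
  have h : (expMeasure K) (Iic 0) = 0 := by
    rw [← ofReal_cdf, cdf_expMeasure_eq hK]
    simp
  rw [ae_iff]
  convert h using 2
  ext e
  simp

open ProbabilityTheory in
theorem integral_expMeasure (K : ℝ) (hK : 0 < K) (f : ℝ → ℝ) :
    ∫ e, f e ∂(expMeasure K) = ∫ e, (if 0 ≤ e then K * Real.exp (-(K * e)) else 0) * f e := by
  have h : expMeasure K = volume.withDensity (exponentialPDF K) := rfl
  have hm : Measurable (exponentialPDF K) := (measurable_exponentialPDFReal K).ennreal_ofReal
  rw [h, integral_withDensity_eq_integral_toReal_smul hm (.of_forall fun e => ENNReal.ofReal_lt_top)]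
  congr 1
  funext e
  rw [exponentialPDF_eq, ENNReal.toReal_ofReal (by split_ifs <;> positivity), smul_eq_mul]

section Clock

variable {M : Type}

/-- The contribution to `∑ h` of a jump from `x.2` at the time `x.1 + z.1` with the mark `z.2`,
if this time is in `(s, u]`. -/
def jumpTerm (h : ℝ → Fin N → M → ℝ) (s u : ℝ) (x : ℝ × Fin N) (z : ℝ × M) : ℝ :=
  (Ioc s u).indicator (fun v => h v x.2 z.2) (x.1 + z.1)

/-- The compensator of `jumpTerm`. -/
def compTerm (q : ℝ → Fin N → ℝ) (s u : ℝ) (x : ℝ × Fin N) (z : ℝ × M) : ℝ :=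
  ∫ v in Ioc s u, (Ico x.1 (x.1 + z.1)).indicator (fun v => q v x.2) v

theorem abs_jumpTerm_le {h : ℝ → Fin N → M → ℝ} {C : ℝ} (hC : ∀ v y m, |h v y m| ≤ C) (s u : ℝ)
    (x : ℝ × Fin N) (z : ℝ × M) :
    |jumpTerm h s u x z| ≤ C * jumpTerm (fun _ _ _ => (1 : ℝ)) s u x z := by
  simp only [jumpTerm, Set.indicator_apply]
  split_ifs
  · simpa using hC _ _ _
  · simp

theorem jumpTerm_one_mem (s u : ℝ) (x : ℝ × Fin N) (z : ℝ × M) :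
    0 ≤ jumpTerm (fun _ _ _ => (1 : ℝ)) s u x z ∧ jumpTerm (fun _ _ _ => (1 : ℝ)) s u x z ≤ 1 := by
  simp only [jumpTerm, Set.indicator_apply]
  split_ifs <;> simp

theorem integrableOn_indicator_one (s u a b : ℝ) :
    IntegrableOn ((Ico a b).indicator fun _ => (1 : ℝ)) (Ioc s u) :=
  (integrable_const (1 : ℝ)).indicator measurableSet_Ico

theorem abs_compTerm_le {q : ℝ → Fin N → ℝ} {C : ℝ} (hC : ∀ v y, |q v y| ≤ C) (s u : ℝ)
    (x : ℝ × Fin N) (z : ℝ × M) :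
    |compTerm q s u x z| ≤ C * compTerm (fun _ _ => (1 : ℝ)) s u x z := by
  simp only [compTerm]
  rw [← integral_const_mul, ← Real.norm_eq_abs]
  refine norm_integral_le_of_norm_le ((integrableOn_indicator_one s u _ _).const_mul C)
    (.of_forall fun v => ?_)
  simp only [Set.indicator_apply]
  split_ifs
  · simpa using hC _ _
  · simp

theorem compTerm_one_mem {s u : ℝ} (hsu : s ≤ u) (x : ℝ × Fin N) (z : ℝ × M) :
    0 ≤ compTerm (fun _ _ => (1 : ℝ)) s u x z ∧ compTerm (fun _ _ => (1 : ℝ)) s u x z ≤ u - s := by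
  have hI : ∀ v, 0 ≤ (Ico x.1 (x.1 + z.1)).indicator (fun _ => (1 : ℝ)) v ∧
      (Ico x.1 (x.1 + z.1)).indicator (fun _ => (1 : ℝ)) v ≤ 1 := fun v => by
    simp only [Set.indicator_apply]; split_ifs <;> simp
  refine ⟨integral_nonneg fun v => (hI v).1, ?_⟩
  calc compTerm (fun _ _ => (1 : ℝ)) s u x z ≤ ∫ v in Ioc s u, (1 : ℝ) :=
        integral_mono (integrableOn_indicator_one s u _ _) (integrable_const _) fun v => (hI v).2
    _ = u - s := by simp [hsu]

variable [MeasurableSpace M]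

/-- The law of a waiting time and a mark. -/
def clockMeasure (K : ℝ) (κ : Measure M) : Measure (ℝ × M) :=
  (ProbabilityTheory.expMeasure K).prod κ

theorem measurable_jumpTerm {h : ℝ → Fin N → M → ℝ}
    (hh : Measurable fun q : ℝ × Fin N × M => h q.1 q.2.1 q.2.2) (s u : ℝ) :
    Measurable fun p : (ℝ × Fin N) × (ℝ × M) => jumpTerm h s u p.1 p.2 := by
  have h1 : Measurable fun p : (ℝ × Fin N) × (ℝ × M) => h (p.1.1 + p.2.1) p.1.2 p.2.2 :=
    hh.comp (f := fun p : (ℝ × Fin N) × (ℝ × M) => (p.1.1 + p.2.1, p.1.2, p.2.2)) (by fun_prop)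
  exact h1.indicator (s := {p : (ℝ × Fin N) × (ℝ × M) | p.1.1 + p.2.1 ∈ Ioc s u})
    (measurableSet_Ioc.preimage (by fun_prop))

theorem measurable_compTerm_integrand {q : ℝ → Fin N → ℝ} (hq : Measurable fun p : ℝ × Fin N => q p.1 p.2) :
    Measurable fun p : ((ℝ × Fin N) × (ℝ × M)) × ℝ =>
      (Ico p.1.1.1 (p.1.1.1 + p.1.2.1)).indicator (fun v => q v p.1.1.2) p.2 := by
  have h1 : Measurable fun p : ((ℝ × Fin N) × (ℝ × M)) × ℝ => q p.2 p.1.1.2 :=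
    hq.comp (f := fun p : ((ℝ × Fin N) × (ℝ × M)) × ℝ => (p.2, p.1.1.2)) (by fun_prop)
  refine h1.indicator (s := {p : ((ℝ × Fin N) × (ℝ × M)) × ℝ |
    p.2 ∈ Ico p.1.1.1 (p.1.1.1 + p.1.2.1)}) ?_
  have h2 : Measurable fun p : ((ℝ × Fin N) × (ℝ × M)) × ℝ => p.1.1.1 := by fun_prop
  have h3 : Measurable fun p : ((ℝ × Fin N) × (ℝ × M)) × ℝ => p.1.1.1 + p.1.2.1 := by fun_prop
  exact (measurableSet_le h2 measurable_snd).inter (measurableSet_lt measurable_snd h3)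

theorem measurable_compTerm {q : ℝ → Fin N → ℝ} (hq : Measurable fun p : ℝ × Fin N => q p.1 p.2)
    (s u : ℝ) : Measurable fun p : (ℝ × Fin N) × (ℝ × M) => compTerm q s u p.1 p.2 :=
  ((measurable_compTerm_integrand hq).stronglyMeasurable.integral_prod_right
    (ν := volume.restrict (Ioc s u))).measurable

variable {K : ℝ} {κ : Measure M} [IsProbabilityMeasure κ]

theorem isProbabilityMeasure_clockMeasure (hK : 0 < K) (κ : Measure M) [IsProbabilityMeasure κ] :
    IsProbabilityMeasure (clockMeasure K κ) := by
  have := ProbabilityTheory.isProbabilityMeasure_expMeasure hK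
  exact inferInstanceAs (IsProbabilityMeasure ((ProbabilityTheory.expMeasure K).prod κ))

/-- The exponential law has constant hazard rate: its density K e^{-K e} is K times the probability
of surviving beyond e. The left side integrates the density of the ring time, the right side the
survival probability. -/
theorem integral_jumpTerm_eq_compTerm (hK : 0 < K) {h : ℝ → Fin N → M → ℝ}
    (hh : Measurable fun q : ℝ × Fin N × M => h q.1 q.2.1 q.2.2) {C : ℝ}
    (hC : ∀ v y m, |h v y m| ≤ C) (s u : ℝ) (x : ℝ × Fin N) :
    ∫ z, jumpTerm h s u x z ∂(clockMeasure K κ) =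
      ∫ z, compTerm (fun v y => K * ∫ m, h v y m ∂κ) s u x z ∂(clockMeasure K κ) := by
  have := ProbabilityTheory.isProbabilityMeasure_expMeasure hK
  have := isProbabilityMeasure_clockMeasure hK κ
  set q : ℝ → Fin N → ℝ := fun v y => K * ∫ m, h v y m ∂κ with hq
  have hq0m : Measurable fun p : ℝ × Fin N => ∫ m, h p.1 p.2 m ∂κ := by
    have h1 : Measurable fun p : (ℝ × Fin N) × M => h p.1.1 p.1.2 p.2 :=
      hh.comp (f := fun p : (ℝ × Fin N) × M => (p.1.1, p.1.2, p.2)) (by fun_prop)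
    exact (h1.stronglyMeasurable.integral_prod_right (ν := κ)).measurable
  have hqm : Measurable fun p : ℝ × Fin N => q p.1 p.2 := hq0m.const_mul K
  have hC0 : ∀ (y : Fin N), 0 ≤ C := fun y => by
    obtain ⟨m⟩ := nonempty_of_isProbabilityMeasure κ
    exact (abs_nonneg _).trans (hC 0 y m)
  have hqC : ∀ v y, |q v y| ≤ K * C := fun v y => by
    rw [hq, abs_mul, abs_of_pos hK]
    gcongr
    have := norm_integral_le_of_norm_le_const (μ := κ) (C := C) (f := fun m => h v y m)
      (.of_forall fun m => hC v y m)
    simpa using this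
  have hj : Integrable (fun z => jumpTerm h s u x z) (clockMeasure K κ) := by
    refine Integrable.of_bound ((measurable_jumpTerm hh s u).comp
      measurable_prodMk_left).aestronglyMeasurable C (.of_forall fun z => ?_)
    refine (abs_jumpTerm_le hC s u x z).trans ?_
    exact mul_le_of_le_one_right (hC0 x.2) (jumpTerm_one_mem s u x z).2
  have e1 : ∫ z, jumpTerm h s u x z ∂(clockMeasure K κ) =
      ∫ v in Ioc s u, (if 0 ≤ v - x.1 then K * Real.exp (-(K * (v - x.1))) else 0) *
        ∫ m, h v x.2 m ∂κ := by
    rw [clockMeasure, integral_prod _ hj]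
    have e2 : ∀ e, ∫ m, jumpTerm h s u x (e, m) ∂κ =
        (Ioc s u).indicator (fun v => ∫ m, h v x.2 m ∂κ) (x.1 + e) := fun e => by
      simp only [jumpTerm, Set.indicator_apply]
      split_ifs <;> simp
    simp_rw [e2]
    rw [integral_expMeasure K hK, ← integral_indicator measurableSet_Ioc,
      ← integral_add_left_eq_self ((Ioc s u).indicator fun v =>
        (if 0 ≤ v - x.1 then K * Real.exp (-(K * (v - x.1))) else 0) * ∫ m, h v x.2 m ∂κ) x.1]
    refine integral_congr_ae (.of_forall fun e => ?_)
    simp only [Set.indicator_apply, add_sub_cancel_left, mul_ite, mul_zero]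
  have e3 : ∫ z, compTerm q s u x z ∂(clockMeasure K κ) =
      ∫ v in Ioc s u, ∫ z, (Ico x.1 (x.1 + z.1)).indicator (fun v => q v x.2) v ∂(clockMeasure K κ) := by
    refine integral_integral_swap (f := fun (z : ℝ × M) (v : ℝ) =>
      (Ico x.1 (x.1 + z.1)).indicator (fun v => q v x.2) v) ?_
    refine Integrable.of_bound (C := K * C) ?_ (.of_forall fun p => ?_)
    · exact ((measurable_compTerm_integrand (M := M) hqm).comp
        (f := fun p : (ℝ × M) × ℝ => ((x, p.1), p.2)) (by fun_prop)).aestronglyMeasurable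
    · simp only [Function.uncurry, Set.indicator_apply]
      split_ifs
      · exact hqC _ _
      · simpa using mul_nonneg hK.le (hC0 x.2)
  rw [e1, e3]
  refine setIntegral_congr_fun measurableSet_Ioc fun v _ => ?_
  by_cases hv : x.1 ≤ v
  · have e4 : ∀ z : ℝ × M, (Ico x.1 (x.1 + z.1)).indicator (fun v => q v x.2) v =
        (Ioi (v - x.1)).indicator (fun _ => q v x.2) z.1 := fun z => by
      simp only [Set.indicator_apply, mem_Ico, hv, true_and, mem_Ioi, sub_lt_iff_lt_add']
    simp_rw [e4]
    rw [clockMeasure, integral_fun_fst, integral_indicator measurableSet_Ioi]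
    simp only [sub_nonneg, hv, if_true, probReal_univ, setIntegral_const,
      expMeasure_real_Ioi hK (sub_nonneg.2 hv), smul_eq_mul, hq]
    ring
  · simp [hv]

end Clock

/-! ### The jump chain -/

section JumpChain

variable {M : Type} [MeasurableSpace M]

/-- The time of the `n`-th clock ring and the state after it. -/
def jumpState (step : ℝ → Fin N → M → Fin N) (t : ℝ) (i : Fin N) (ω : ℕ → ℝ × M) : ℕ → ℝ × Fin N
  | 0 => (t, i)
  | n + 1 => ((jumpState step t i ω n).1 + (ω n).1,
      step ((jumpState step t i ω n).1 + (ω n).1) (jumpState step t i ω n).2 (ω n).2)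

/-- The σ-algebra generated by the first `n` waiting times and marks. -/
abbrev past (M : Type) [MeasurableSpace M] (n : ℕ) : MeasurableSpace (ℕ → ℝ × M) :=
  MeasurableSpace.comap (fun ω (k : Finset.range n) => ω k) inferInstance

theorem past_le (n : ℕ) : past M n ≤ MeasurableSpace.pi :=
  Measurable.comap_le (by fun_prop)

theorem measurable_eval_past {k n : ℕ} (hk : k < n) :
    Measurable[past M n] fun ω : ℕ → ℝ × M => ω k :=
  (measurable_pi_apply (⟨k, Finset.mem_range.2 hk⟩ : Finset.range n)).comp
    (comap_measurable fun (ω : ℕ → ℝ × M) (k : Finset.range n) => ω k)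

theorem past_mono {m n : ℕ} (hmn : m ≤ n) : past M m ≤ past M n := by
  refine Measurable.comap_le (m₁ := past M n) ?_
  exact @measurable_pi_lambda _ _ _ (past M n) _ _ fun k =>
    measurable_eval_past ((Finset.mem_range.1 k.2).trans_le hmn)

variable {step : ℝ → Fin N → M → Fin N} {t : ℝ} {i : Fin N}

theorem measurable_jumpState (hstep : Measurable fun q : ℝ × Fin N × M => step q.1 q.2.1 q.2.2)
    (n : ℕ) : Measurable[past M n] fun ω => jumpState step t i ω n := by
  induction n with
  | zero => exact @measurable_const _ _ _ (past M 0) _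
  | succ n ih =>
    have h1 : Measurable[past M (n + 1)] fun ω => (jumpState step t i ω n, ω n) :=
      Measurable.prodMk (m := past M (n + 1)) (ih.mono (past_mono n.le_succ) le_rfl)
        (measurable_eval_past n.lt_succ_self)
    have h2 : Measurable fun p : (ℝ × Fin N) × (ℝ × M) =>
        (p.1.1 + p.2.1, step (p.1.1 + p.2.1) p.1.2 p.2.2) :=
      Measurable.prodMk (by fun_prop) (hstep.comp
        (f := fun p : (ℝ × Fin N) × (ℝ × M) => (p.1.1 + p.2.1, p.1.2, p.2.2)) (by fun_prop))
    exact h2.comp h1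

variable {ν : Measure (ℝ × M)} [IsProbabilityMeasure ν]

/-- The state after n rings and the event B depend on the first n coordinates, of which coordinate n
is independent. By Fubini that coordinate is integrated first. -/
theorem setIntegral_past_eq_zero
    (hstep : Measurable fun q : ℝ × Fin N × M => step q.1 q.2.1 q.2.2) {n : ℕ}
    {B : Set (ℕ → ℝ × M)} (hB : MeasurableSet[past M n] B) {Ψ : (ℝ × Fin N) × (ℝ × M) → ℝ}
    (hΨ : Measurable Ψ) {C : ℝ} (hC : ∀ p, |Ψ p| ≤ C) (h0 : ∀ x, ∫ z, Ψ (x, z) ∂ν = 0) :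
    ∫ ω in B, Ψ (jumpState step t i ω n, ω n) ∂(Measure.infinitePi fun _ : ℕ => ν) = 0 := by
  set P := Measure.infinitePi fun _ : ℕ => ν
  set R : (ℕ → ℝ × M) → (Finset.range n → ℝ × M) := fun ω k => ω k with hR
  have hRm : Measurable R := by fun_prop
  obtain ⟨B', hB', rfl⟩ := hB
  have : Nonempty (ℝ × Fin N) := ⟨(t, i)⟩
  -- Doob-Dynkin: the state after n rings as a measurable function of the first n coordinates.
  obtain ⟨F, hF, hFe⟩ := Measurable.exists_eq_measurable_comp (f := R)
    (measurable_jumpState (t := t) (i := i) hstep n)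
  have hFe' : ∀ ω, jumpState step t i ω n = F (R ω) := fun ω => congrFun hFe ω
  have hind : ProbabilityTheory.IndepFun R (fun ω => ω n) P := by
    have h := (ProbabilityTheory.iIndepFun_infinitePi (P := fun _ : ℕ => ν) (X := fun _ z => z)
      (fun _ => measurable_id)).indepFun_finset (Finset.range n) {n}
      (by simp) (fun k => by fun_prop)
    exact h.comp measurable_id (measurable_pi_apply (⟨n, by simp⟩ : ({n} : Finset ℕ)))
  have hmap : P.map (fun ω => (R ω, ω n)) = (P.map R).prod ν := by
    rw [(ProbabilityTheory.indepFun_iff_map_prod_eq_prod_map_map hRm.aemeasurable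
      (measurable_pi_apply n).aemeasurable).1 hind]
    congr 1
    exact (measurePreserving_eval_infinitePi (fun _ : ℕ => ν) n).map_eq
  have : IsProbabilityMeasure (P.map R) := Measure.isProbabilityMeasure_map hRm.aemeasurable
  set G : (Finset.range n → ℝ × M) × (ℝ × M) → ℝ := fun p => B'.indicator (fun x => Ψ (F x, p.2)) p.1
    with hG
  have hGm : Measurable G := by
    have : Measurable fun p : (Finset.range n → ℝ × M) × (ℝ × M) => Ψ (F p.1, p.2) := by fun_prop
    exact this.indicator (s := Prod.fst ⁻¹' B') (measurable_fst hB')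
  have hGi : Integrable G ((P.map R).prod ν) := by
    refine Integrable.of_bound hGm.aestronglyMeasurable C (.of_forall fun p => ?_)
    by_cases hp : p.1 ∈ B'
    · simpa [hG, hp] using hC (F p.1, p.2)
    · simpa [hG, hp] using (abs_nonneg _).trans (hC (F p.1, p.2))
  calc ∫ ω in R ⁻¹' B', Ψ (jumpState step t i ω n, ω n) ∂P
      = ∫ ω, G (R ω, ω n) ∂P := by
        rw [← integral_indicator (hRm hB')]
        refine integral_congr_ae (.of_forall fun ω => ?_)
        by_cases hω : R ω ∈ B' <;> simp [hG, hω, hFe']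
    _ = ∫ p, G p ∂((P.map R).prod ν) := by
        rw [← hmap, integral_map (by fun_prop) hGm.aestronglyMeasurable]
    _ = ∫ x, ∫ z, G (x, z) ∂ν ∂(P.map R) := integral_prod _ hGi
    _ = 0 := by
        have : ∀ x, ∫ z, G (x, z) ∂ν = 0 := fun x => by
          by_cases hx : x ∈ B' <;> simp [hG, hx, h0]
        simp [this]

end JumpChain

/-! ### Paths of the jump chain -/

section JumpPaths

variable {M : Type} {step : ℝ → Fin N → M → Fin N} {t : ℝ} {i : Fin N}

/-- All waiting times are positive and the clock passes the time `T`. -/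
def IsGood (step : ℝ → Fin N → M → Fin N) (t : ℝ) (i : Fin N) (T : ℝ) (ω : ℕ → ℝ × M) : Prop :=
  (∀ n, 0 < (ω n).1) ∧ ∃ n, T < (jumpState step t i ω n).1

open Classical in
/-- The state at time `s`, for a good point of the sample space. -/
def chainPath (step : ℝ → Fin N → M → Fin N) (t : ℝ) (i : Fin N) (T s : ℝ) (ω : ℕ → ℝ × M) : Fin N :=
  if IsGood step t i T ω then
    (jumpState step t i ω (sInf {n | s < (jumpState step t i ω (n + 1)).1})).2
  else i

theorem ringTime_mono {ω : ℕ → ℝ × M} (hω : ∀ n, 0 < (ω n).1) :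
    Monotone fun n => (jumpState step t i ω n).1 :=
  monotone_nat_of_le_succ fun n => by simpa [jumpState] using (hω n).le

theorem chainPath_eq {T s : ℝ} {ω : ℕ → ℝ × M} (hω : IsGood step t i T ω) {k : ℕ}
    (h1 : (jumpState step t i ω k).1 ≤ s) (h2 : s < (jumpState step t i ω (k + 1)).1) :
    chainPath step t i T s ω = (jumpState step t i ω k).2 := by
  have : sInf {n | s < (jumpState step t i ω (n + 1)).1} = k := by
    refine le_antisymm (Nat.sInf_le h2) (le_csInf ⟨k, h2⟩ fun n hn => ?_)
    by_contra! hnk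
    exact (lt_of_lt_of_le hn (ringTime_mono hω.1 hnk)).not_ge h1
  rw [chainPath, if_pos hω, this]

theorem exists_ring_interval {T s : ℝ} {ω : ℕ → ℝ × M} (hω : IsGood step t i T ω)
    (hs : s ∈ Icc t T) :
    ∃ k, (jumpState step t i ω k).1 ≤ s ∧ s < (jumpState step t i ω (k + 1)).1 := by
  classical
  have hex : ∃ n, s < (jumpState step t i ω n).1 := hω.2.imp fun n hn => hs.2.trans_lt hn
  obtain ⟨k, hk⟩ : ∃ k, Nat.find hex = k + 1 := Nat.exists_eq_succ_of_ne_zero fun h => by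
    have := Nat.find_spec hex
    rw [h] at this
    exact this.not_ge hs.1
  exact ⟨k, not_lt.1 (Nat.find_min hex (by omega)), hk ▸ Nat.find_spec hex⟩

theorem ring_interval_unique {s : ℝ} {ω : ℕ → ℝ × M} (hω : ∀ n, 0 < (ω n).1) {k l : ℕ}
    (hk : (jumpState step t i ω k).1 ≤ s) (hl : s < (jumpState step t i ω (l + 1)).1) : k ≤ l := by
  by_contra! h
  exact (hl.trans_le (ringTime_mono hω h)).not_ge hk

theorem chainPath_rightCont {T : ℝ} (ω : ℕ → ℝ × M) {s : ℝ} (hs : s ∈ Ico t T) :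
    ContinuousWithinAt (fun u => chainPath step t i T u ω) (Ici s) s := by
  by_cases hω : IsGood step t i T ω
  · obtain ⟨k, h1, h2⟩ := exists_ring_interval hω ⟨hs.1, hs.2.le⟩
    refine (tendsto_const_nhds (x := chainPath step t i T s ω)).congr' ?_
    filter_upwards [Ico_mem_nhdsGE h2] with u hu
    rw [chainPath_eq hω h1 h2, chainPath_eq hω (h1.trans hu.1) hu.2]
  · simpa [chainPath, hω] using continuousWithinAt_const

theorem chainPath_leftLim {T : ℝ} (ω : ℕ → ℝ × M) {s : ℝ} (hs : s ∈ Ioc t T) :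
    ∃ k, Tendsto (fun u => chainPath step t i T u ω) (𝓝[<] s) (𝓝 k) := by
  classical
  by_cases hω : IsGood step t i T ω
  · have hex : ∃ n, s ≤ (jumpState step t i ω n).1 := hω.2.imp fun n hn => hs.2.trans hn.le
    obtain ⟨k, hk⟩ : ∃ k, Nat.find hex = k + 1 := Nat.exists_eq_succ_of_ne_zero fun h => by
      have := Nat.find_spec hex
      rw [h] at this
      exact this.not_gt hs.1
    have h1 : (jumpState step t i ω k).1 < s := not_le.1 (Nat.find_min hex (by omega))
    have h2 : s ≤ (jumpState step t i ω (k + 1)).1 := hk ▸ Nat.find_spec hex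
    refine ⟨(jumpState step t i ω k).2, tendsto_const_nhds.congr' ?_⟩
    filter_upwards [Ioo_mem_nhdsLT h1] with u hu
    rw [chainPath_eq hω hu.1.le (hu.2.trans_le h2)]
  · exact ⟨i, by simp [chainPath, hω]⟩

/-- The intervals between successive rings are disjoint; their union up to ring n is a single
interval starting at t. -/
theorem sum_indicator_ring {ω : ℕ → ℝ × M} (hω : ∀ n, 0 < (ω n).1) (v : ℝ) (n : ℕ) :
    ∑ k ∈ Finset.range n, (Ico (jumpState step t i ω k).1
      ((jumpState step t i ω k).1 + (ω k).1)).indicator (fun _ => (1 : ℝ)) v ≤ 1 := by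
  have hm := ringTime_mono (step := step) (t := t) (i := i) hω
  have : ∑ k ∈ Finset.range n, (Ico (jumpState step t i ω k).1
      ((jumpState step t i ω k).1 + (ω k).1)).indicator (fun _ => (1 : ℝ)) v =
      (Ico t (jumpState step t i ω n).1).indicator (fun _ => (1 : ℝ)) v := by
    induction n with
    | zero => simp [jumpState]
    | succ n ih =>
      rw [Finset.sum_range_succ, ih]
      have h1 : t ≤ (jumpState step t i ω n).1 := hm n.zero_le
      have h2 : (jumpState step t i ω (n + 1)).1 = (jumpState step t i ω n).1 + (ω n).1 := rfl
      have h3 := hω n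
      simp only [Set.indicator_apply, mem_Ico, h2]
      split_ifs <;> grind
  rw [this]
  simp only [Set.indicator_apply]
  split_ifs <;> norm_num

/-- A telescoping sum over the rings in (s, u]; only finitely many terms are nonzero. -/
theorem hasSum_jumpTerm {T s u : ℝ} {ω : ℕ → ℝ × M} (hω : IsGood step t i T ω)
    (hs : s ∈ Icc t T) (hu : u ∈ Icc t T) (hsu : s ≤ u) (f : Fin N → ℝ) :
    HasSum (fun k => jumpTerm (fun v y m => f (step v y m) - f y) s u
      (jumpState step t i ω k) (ω k)) (f (chainPath step t i T u ω) - f (chainPath step t i T s ω)) := by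
  obtain ⟨a, ha1, ha2⟩ := exists_ring_interval hω hs
  obtain ⟨b, hb1, hb2⟩ := exists_ring_interval hω hu
  have hab : a ≤ b := ring_interval_unique hω.1 ha1 (hsu.trans_lt hb2)
  have hm := ringTime_mono (step := step) (t := t) (i := i) hω.1
  have hterm : ∀ k, jumpTerm (fun v y m => f (step v y m) - f y) s u (jumpState step t i ω k) (ω k) =
      (Ioc s u).indicator (fun _ => f (jumpState step t i ω (k + 1)).2 - f (jumpState step t i ω k).2)
        (jumpState step t i ω (k + 1)).1 := fun k => by
    simp only [jumpTerm, Set.indicator_apply, jumpState]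
  simp_rw [hterm]
  -- Freezing the index below a makes the sum telescope from ring a on. The increments with k < a
  -- vanish, and those with a ≤ k < b come from the rings in (s, u].
  set F : ℕ → ℝ := fun k => f (jumpState step t i ω (max k a)).2 with hF
  have hval : f (chainPath step t i T u ω) - f (chainPath step t i T s ω) =
      ∑ k ∈ Finset.range b, (F (k + 1) - F k) := by
    rw [Finset.sum_range_sub, chainPath_eq hω ha1 ha2, chainPath_eq hω hb1 hb2]
    simp [hF, hab]
  have hcongr : ∀ k ∈ Finset.range b, F (k + 1) - F k =
      (Ioc s u).indicator (fun _ => f (jumpState step t i ω (k + 1)).2 -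
        f (jumpState step t i ω k).2) (jumpState step t i ω (k + 1)).1 := fun k hk => by
    rw [Finset.mem_range] at hk
    rcases lt_or_ge k a with hka | hka
    · rw [Set.indicator_of_notMem fun h => ((hm (Nat.succ_le_of_lt hka)).trans ha1).not_gt h.1]
      simp [hF, max_eq_right hka.le, max_eq_right (Nat.succ_le_of_lt hka)]
    · have hmem : (jumpState step t i ω (k + 1)).1 ∈ Ioc s u :=
        ⟨ha2.trans_le (hm (Nat.succ_le_succ hka)), (hm (Nat.succ_le_of_lt hk)).trans hb1⟩
      rw [Set.indicator_of_mem hmem]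
      simp [hF, max_eq_left hka, max_eq_left (hka.trans k.le_succ)]
  rw [hval, Finset.sum_congr rfl hcongr]
  refine hasSum_sum_of_ne_finset_zero (L := .unconditional ℕ) fun k hk => ?_
  refine Set.indicator_of_notMem (fun h => ?_) _
  rw [Finset.mem_range, not_lt] at hk
  exact (hb2.trans_le (hm (Nat.succ_le_succ hk))).not_ge h.2

/-- Up to time u the intervals between rings 0 to b + 1 cover each instant exactly once, and the
path is constant on each. -/
theorem hasSum_compTerm {T s u : ℝ} {ω : ℕ → ℝ × M} (hω : IsGood step t i T ω)
    (hs : s ∈ Icc t T) (hu : u ∈ Icc t T) (hsu : s ≤ u) {q : ℝ → Fin N → ℝ}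
    (hq : ∀ y, IntegrableOn (fun v => q v y) (Ioc s u)) :
    HasSum (fun k => compTerm q s u (jumpState step t i ω k) (ω k))
      (∫ v in s..u, q v (chainPath step t i T v ω)) := by
  obtain ⟨b, hb1, hb2⟩ := exists_ring_interval hω hu
  have hm := ringTime_mono (step := step) (t := t) (i := i) hω.1
  have hval : ∫ v in s..u, q v (chainPath step t i T v ω) =
      ∑ k ∈ Finset.range (b + 1), compTerm q s u (jumpState step t i ω k) (ω k) := by
    simp only [compTerm]
    rw [intervalIntegral.integral_of_le hsu, ← integral_finsetSum _ fun k _ =>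
      (hq (jumpState step t i ω k).2).indicator measurableSet_Ico]
    refine setIntegral_congr_fun measurableSet_Ioc fun v hv => ?_
    obtain ⟨k, hk1, hk2⟩ := exists_ring_interval hω ⟨hs.1.trans hv.1.le, hv.2.trans hu.2⟩
    have hkb : k ≤ b := ring_interval_unique hω.1 hk1 (hv.2.trans_lt hb2)
    rw [chainPath_eq hω hk1 hk2, Finset.sum_eq_single_of_mem k (Finset.mem_range.2 (by omega)),
      Set.indicator_of_mem (s := Ico (jumpState step t i ω k).1
        ((jumpState step t i ω k).1 + (ω k).1)) ⟨hk1, hk2⟩]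
    intro l _ hlk
    refine Set.indicator_of_notMem (fun h => hlk ?_) _
    exact le_antisymm (ring_interval_unique hω.1 h.1 hk2) (ring_interval_unique hω.1 hk1 h.2)
  rw [hval]
  refine hasSum_sum_of_ne_finset_zero (L := .unconditional ℕ) fun k hk => ?_
  rw [Finset.mem_range, not_lt] at hk
  rw [compTerm, setIntegral_congr_fun (g := fun _ => 0) measurableSet_Ioc, integral_zero]
  intro v hv
  refine Set.indicator_of_notMem (fun h => ?_) _
  exact ((hv.2.trans_lt hb2).trans_le (hm hk)).not_ge h.1

end JumpPaths

/-! ### The martingale problem for the jump chain -/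

section JumpLaw

variable {M : Type} [MeasurableSpace M] {step : ℝ → Fin N → M → Fin N} {t : ℝ} {i : Fin N}
  {K : ℝ} [hK : Fact (0 < K)] {κ : Measure M} [IsProbabilityMeasure κ]

instance : IsProbabilityMeasure (clockMeasure K κ) := isProbabilityMeasure_clockMeasure hK.out κ

/-- The law of a sequence of independent waiting times and marks. -/
abbrev clockProduct (K : ℝ) [Fact (0 < K)] (κ : Measure M) [IsProbabilityMeasure κ] :
    Measure (ℕ → ℝ × M) :=
  Measure.infinitePi fun _ => clockMeasure K κ

variable (K κ) in
theorem ae_waiting_pos : ∀ᵐ ω ∂(clockProduct K κ), ∀ n, 0 < (ω n).1 := by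
  have := ProbabilityTheory.isProbabilityMeasure_expMeasure hK.out
  refine ae_all_iff.2 fun n => ?_
  have h : ∀ᵐ z ∂(clockMeasure K κ), 0 < z.1 :=
    Measure.quasiMeasurePreserving_fst.ae (ae_pos_expMeasure hK.out)
  exact (measurePreserving_eval_infinitePi (fun _ : ℕ => clockMeasure K κ) n).quasiMeasurePreserving.ae h

variable (hstep : Measurable fun q : ℝ × Fin N × M => step q.1 q.2.1 q.2.2)
include hstep

theorem measurable_jumpState_eval (n : ℕ) :
    Measurable fun ω : ℕ → ℝ × M => (jumpState step t i ω n, ω n) :=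
  ((measurable_jumpState hstep n).mono (past_le n) le_rfl).prodMk (measurable_pi_apply n)

theorem integrable_jumpTerm {h : ℝ → Fin N → M → ℝ}
    (hh : Measurable fun q : ℝ × Fin N × M => h q.1 q.2.1 q.2.2) {C : ℝ}
    (hC : ∀ v y m, |h v y m| ≤ C) (s u : ℝ) (k : ℕ) :
    Integrable (fun ω => jumpTerm h s u (jumpState step t i ω k) (ω k)) (clockProduct K κ) := by
  refine Integrable.of_bound ((measurable_jumpTerm hh s u).comp
    (measurable_jumpState_eval hstep k)).aestronglyMeasurable C (.of_forall fun ω => ?_)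
  have hC0 : 0 ≤ C := (abs_nonneg _).trans (hC 0 i (ω 0).2)
  refine (abs_jumpTerm_le hC s u _ _).trans ?_
  exact mul_le_of_le_one_right hC0 (jumpTerm_one_mem s u _ _).2

theorem integrable_compTerm {q : ℝ → Fin N → ℝ} (hq : Measurable fun p : ℝ × Fin N => q p.1 p.2)
    {C : ℝ} (hC : ∀ v y, |q v y| ≤ C) {s u : ℝ} (hsu : s ≤ u) (k : ℕ) :
    Integrable (fun ω => compTerm q s u (jumpState step t i ω k) (ω k)) (clockProduct K κ) := by
  refine Integrable.of_bound ((measurable_compTerm hq s u).comp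
    (measurable_jumpState_eval hstep k)).aestronglyMeasurable (C * (u - s)) (.of_forall fun ω => ?_)
  have hC0 : 0 ≤ C := (abs_nonneg _).trans (hC 0 i)
  refine (abs_compTerm_le hC s u _ _).trans ?_
  exact mul_le_mul_of_nonneg_left (compTerm_one_mem hsu _ _).2 hC0

omit hstep [IsProbabilityMeasure κ] in
theorem abs_mul_integral_le [IsProbabilityMeasure κ] {h : ℝ → Fin N → M → ℝ} {C : ℝ}
    (hC : ∀ v y m, |h v y m| ≤ C) (v : ℝ) (y : Fin N) :
    |K * ∫ m, h v y m ∂κ| ≤ K * C := by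
  rw [abs_mul, abs_of_pos hK.out]
  refine mul_le_mul_of_nonneg_left ?_ hK.out.le
  have := norm_integral_le_of_norm_le_const (μ := κ) (C := C) (f := fun m => h v y m)
    (.of_forall fun m => hC v y m)
  simpa using this

omit hstep hK [IsProbabilityMeasure κ] in
theorem measurable_mul_integral [SFinite κ] {h : ℝ → Fin N → M → ℝ}
    (hh : Measurable fun q : ℝ × Fin N × M => h q.1 q.2.1 q.2.2) :
    Measurable fun p : ℝ × Fin N => K * ∫ m, h p.1 p.2 m ∂κ := by
  have h1 : Measurable fun p : (ℝ × Fin N) × M => h p.1.1 p.1.2 p.2 :=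
    hh.comp (f := fun p : (ℝ × Fin N) × M => (p.1.1, p.1.2, p.2)) (by fun_prop)
  exact ((h1.stronglyMeasurable.integral_prod_right (ν := κ)).measurable).const_mul K

/-- A single ring, compensated, has mean zero given the rings before it: the one-ring identity
`integral_jumpTerm_eq_compTerm` is inserted in `setIntegral_past_eq_zero`. -/
theorem setIntegral_jump_sub_comp {h : ℝ → Fin N → M → ℝ}
    (hh : Measurable fun q : ℝ × Fin N × M => h q.1 q.2.1 q.2.2) {C : ℝ}
    (hC : ∀ v y m, |h v y m| ≤ C) {s u : ℝ} (hsu : s ≤ u) {k : ℕ} {B : Set (ℕ → ℝ × M)}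
    (hB : MeasurableSet[past M k] B) :
    ∫ ω in B, (jumpTerm h s u (jumpState step t i ω k) (ω k) -
      compTerm (fun v y => K * ∫ m, h v y m ∂κ) s u (jumpState step t i ω k) (ω k))
      ∂(clockProduct K κ) = 0 := by
  obtain ⟨m⟩ := nonempty_of_isProbabilityMeasure κ
  have hC0 : 0 ≤ C := (abs_nonneg _).trans (hC 0 i m)
  have hjm := measurable_jumpTerm hh s u
  have hcm := measurable_compTerm (M := M) (q := fun v y => K * ∫ m, h v y m ∂κ)
    (measurable_mul_integral (K := K) (κ := κ) hh) s u
  have hjb : ∀ x z, |jumpTerm h s u x z| ≤ C := fun x z => (abs_jumpTerm_le hC s u x z).trans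
    (mul_le_of_le_one_right hC0 (jumpTerm_one_mem s u _ _).2)
  have hcb : ∀ x (z : ℝ × M), |compTerm (fun v y => K * ∫ m, h v y m ∂κ) s u x z| ≤ K * C * (u - s) :=
    fun x z => (abs_compTerm_le (abs_mul_integral_le hC) s u x z).trans
      (mul_le_mul_of_nonneg_left (compTerm_one_mem hsu _ _).2 (mul_nonneg hK.out.le hC0))
  refine setIntegral_past_eq_zero (ν := clockMeasure K κ) hstep hB
    (Ψ := fun p => jumpTerm h s u p.1 p.2 - compTerm (fun v y => K * ∫ m, h v y m ∂κ) s u p.1 p.2)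
    (hjm.sub hcm) (C := C + K * C * (u - s))
    (fun p => (abs_sub _ _).trans (add_le_add (hjb _ _) (hcb _ _))) fun x => ?_
  have hji : Integrable (fun z => jumpTerm h s u x z) (clockMeasure K κ) :=
    Integrable.of_bound (hjm.comp measurable_prodMk_left).aestronglyMeasurable C
      (.of_forall fun z => hjb x z)
  have hci : Integrable (fun z => compTerm (fun v y => K * ∫ m, h v y m ∂κ) s u x z)
      (clockMeasure K κ) :=
    Integrable.of_bound (hcm.comp measurable_prodMk_left).aestronglyMeasurable _
      (.of_forall fun z => hcb x z)
  rw [integral_sub hji hci, integral_jumpTerm_eq_compTerm hK.out hh hC, sub_self]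

/-- Disjoint intervals between rings occupy at most the length u - s of (s, u], which bounds all
partial sums. -/
theorem summable_compTerm_one {s u : ℝ} (hsu : s ≤ u) :
    Summable fun k => ∫ ω, compTerm (fun _ _ => (1 : ℝ)) s u (jumpState step t i ω k) (ω k)
      ∂(clockProduct K κ) := by
  have hint : ∀ k, Integrable (fun ω => compTerm (fun _ _ => (1 : ℝ)) s u
      (jumpState step t i ω k) (ω k)) (clockProduct K κ) := fun k =>
    integrable_compTerm hstep measurable_const (C := 1) (by simp) hsu k
  refine summable_of_sum_range_le (c := u - s)
    (fun k => integral_nonneg fun ω => (compTerm_one_mem hsu _ _).1) fun n => ?_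
  rw [← integral_finsetSum _ fun k _ => hint k]
  have hle : ∀ᵐ ω ∂(clockProduct K κ), ∑ k ∈ Finset.range n,
      compTerm (fun _ _ => (1 : ℝ)) s u (jumpState step t i ω k) (ω k) ≤ u - s := by
    filter_upwards [ae_waiting_pos K κ] with ω hω
    simp only [compTerm]
    rw [← integral_finsetSum _ fun k _ => integrableOn_indicator_one s u _ _]
    calc _ ≤ ∫ v in Ioc s u, (1 : ℝ) := integral_mono
          (integrable_finsetSum _ fun k _ => integrableOn_indicator_one s u _ _)
          (integrable_const _) fun v => sum_indicator_ring hω v n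
      _ = u - s := by simp [hsu]
  calc _ ≤ ∫ _ω, (u - s) ∂(clockProduct K κ) :=
        integral_mono_ae (integrable_finsetSum _ fun k _ => hint k) (integrable_const _) hle
    _ = u - s := by simp

/-- The case h = 1: the probability that a ring falls in (s, u] is at most K times the expected
waiting time spent there. Summability thus passes from waiting times to rings. -/
theorem integral_jumpTerm_one_le {s u : ℝ} (hsu : s ≤ u) (k : ℕ) :
    ∫ ω, jumpTerm (fun _ _ _ => (1 : ℝ)) s u (jumpState step t i ω k) (ω k) ∂(clockProduct K κ) ≤
      K * ∫ ω, compTerm (fun _ _ => (1 : ℝ)) s u (jumpState step t i ω k) (ω k)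
        ∂(clockProduct K κ) := by
  have h1 : Measurable fun _ : ℝ × Fin N × M => (1 : ℝ) := measurable_const
  have h := setIntegral_jump_sub_comp (K := K) (κ := κ) (t := t) (i := i) hstep
    (h := fun _ _ _ => 1) h1 (C := 1) (by simp) hsu (k := k) MeasurableSet.univ
  simp only [Measure.restrict_univ, integral_const, probReal_univ, one_smul, mul_one] at h
  have hKc : ∀ (_ : ℝ) (_ : Fin N), |K| ≤ K := fun _ _ => (abs_of_pos hK.out).le
  have hi := integrable_compTerm (K := K) (κ := κ) (i := i) (t := t) hstep (q := fun _ _ => K)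
    measurable_const hKc hsu k
  rw [integral_sub (integrable_jumpTerm hstep h1 (C := 1) (by simp) s u k) hi, sub_eq_zero] at h
  rw [h, ← integral_const_mul]
  refine integral_mono hi ((integrable_compTerm hstep measurable_const (C := 1) (by simp)
    hsu k).const_mul K) fun ω => ?_
  exact (le_abs_self _).trans (abs_compTerm_le hKc s u _ _)

theorem summable_jumpTerm_one {s u : ℝ} (hsu : s ≤ u) :
    Summable fun k => ∫ ω, jumpTerm (fun _ _ _ => (1 : ℝ)) s u (jumpState step t i ω k) (ω k)
      ∂(clockProduct K κ) :=
  Summable.of_nonneg_of_le (fun _ => integral_nonneg fun _ => (jumpTerm_one_mem s u _ _).1)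
    (fun k => integral_jumpTerm_one_le hstep hsu k) ((summable_compTerm_one hstep hsu).mul_left K)

/-- The expected number of rings before T is finite, so by Borel-Cantelli only finitely many rings
occur and the clock passes T. -/
theorem ae_isGood {T : ℝ} (htT : t ≤ T) : ∀ᵐ ω ∂(clockProduct K κ), IsGood step t i T ω := by
  -- All rings are at or after t, hence above t - 1; a ring outside (t - 1, T] must be later than T.
  have hsum := summable_jumpTerm_one (K := K) (κ := κ) (t := t) (i := i) hstep
    (s := t - 1) (u := T) (by linarith)
  have hm : ∀ k, MeasurableSet {ω : ℕ → ℝ × M |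
      (jumpState step t i ω k).1 + (ω k).1 ∈ Ioc (t - 1) T} := fun k => by
    have h := measurable_jumpState_eval (t := t) (i := i) hstep k
    exact ((h.fst.fst).add h.snd.fst) measurableSet_Ioc
  have hP : ∀ k, clockProduct K κ {ω : ℕ → ℝ × M |
      (jumpState step t i ω k).1 + (ω k).1 ∈ Ioc (t - 1) T} =
      ENNReal.ofReal (∫ ω, jumpTerm (fun _ _ _ => (1 : ℝ)) (t - 1) T (jumpState step t i ω k) (ω k)
      ∂(clockProduct K κ)) := fun k => by
    rw [← ofReal_measureReal, ← integral_indicator_one (hm k)]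
    rfl
  have hBC := ae_eventually_notMem (μ := clockProduct K κ)
    (s := fun k => {ω : ℕ → ℝ × M | (jumpState step t i ω k).1 + (ω k).1 ∈ Ioc (t - 1) T}) (by
    simp_rw [hP]; exact hsum.tsum_ofReal_ne_top)
  filter_upwards [hBC, ae_waiting_pos K κ] with ω h1 h2
  refine ⟨h2, ?_⟩
  obtain ⟨k, hk⟩ := h1.exists
  refine ⟨k + 1, ?_⟩
  by_contra! hle
  refine hk ⟨?_, hle⟩
  have := ringTime_mono (step := step) (t := t) (i := i) h2 (Nat.zero_le (k + 1))
  exact lt_of_lt_of_le (sub_one_lt t) this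

end JumpLaw

/-! ### The filtration of the jump chain and its compensated increments -/

section JumpFiltration

variable {M : Type} [MeasurableSpace M] {step : ℝ → Fin N → M → Fin N} {t : ℝ} {i : Fin N}

/-- The state after the last of the first `n` rings that are not later than `s`. -/
def lastState (step : ℝ → Fin N → M → Fin N) (t : ℝ) (i : Fin N) (s : ℝ) (ω : ℕ → ℝ × M) : ℕ → Fin N
  | 0 => i
  | n + 1 => if (jumpState step t i ω (n + 1)).1 ≤ s then (jumpState step t i ω (n + 1)).2
      else lastState step t i s ω n

-- Before ring k + 1 the path at time s is a function of the first k coordinates, which is what the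
-- filtration requires.
omit [MeasurableSpace M] in
theorem lastState_eq_chainPath {T s : ℝ} {ω : ℕ → ℝ × M} (hω : IsGood step t i T ω)
    (hs : s ∈ Icc t T) {k : ℕ} (hk : s < (jumpState step t i ω (k + 1)).1) :
    lastState step t i s ω k = chainPath step t i T s ω := by
  obtain ⟨n, h1, h2⟩ := exists_ring_interval hω hs
  have hnk : n ≤ k := ring_interval_unique hω.1 h1 hk
  rw [chainPath_eq hω h1 h2]
  clear hk
  induction k, hnk using Nat.le_induction with
  | base => cases n with
    | zero => rfl
    | succ n => simp [lastState, h1]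
  | succ k hnk ih =>
    have := h2.trans_le (ringTime_mono (step := step) (t := t) (i := i) hω.1 (Nat.succ_le_succ hnk))
    simp [lastState, this.not_ge, ih]

/-- The events that are determined, before the ring `k + 1` and for every `k`, by the first `k`
rings. -/
abbrev chainSigma (P : Measure (ℕ → ℝ × M)) (step : ℝ → Fin N → M → Fin N) (t : ℝ) (i : Fin N) (s : ℝ) :
    MeasurableSpace (ℕ → ℝ × M) where
  MeasurableSet' A := MeasurableSet A ∧ ∀ k, ∃ B, MeasurableSet[past M k] B ∧
    ∀ᵐ ω ∂P, s < (jumpState step t i ω (k + 1)).1 → (ω ∈ A ↔ ω ∈ B)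
  measurableSet_empty := ⟨.empty, fun _ => ⟨∅, @MeasurableSet.empty _ (past M _), by simp⟩⟩
  measurableSet_compl A hA := ⟨hA.1.compl, fun k => by
    obtain ⟨B, hB, h⟩ := hA.2 k
    refine ⟨Bᶜ, MeasurableSet.compl hB, ?_⟩
    filter_upwards [h] with ω hω hs
    simp [hω hs]⟩
  measurableSet_iUnion A hA := ⟨.iUnion fun n => (hA n).1, fun k => by
    choose B hB h using fun n => (hA n).2 k
    refine ⟨⋃ n, B n, MeasurableSet.iUnion hB, ?_⟩
    filter_upwards [ae_all_iff.2 h] with ω hω hs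
    simp [hω _ hs]⟩

/-- The filtration of the jump chain. -/
def chainFiltration (P : Measure (ℕ → ℝ × M)) (step : ℝ → Fin N → M → Fin N) (t T : ℝ) (i : Fin N) :
    Filtration (Icc t T) (MeasurableSpace.pi : MeasurableSpace (ℕ → ℝ × M)) where
  seq s := chainSigma P step t i s
  mono' s u hsu A hA := ⟨hA.1, fun k => by
    obtain ⟨B, hB, h⟩ := hA.2 k
    refine ⟨B, hB, ?_⟩
    filter_upwards [h] with ω hω hs
    exact hω (lt_of_le_of_lt (show (s : ℝ) ≤ u from hsu) hs)⟩
  le' _ _ hA := hA.1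

variable (hstep : Measurable fun q : ℝ × Fin N × M => step q.1 q.2.1 q.2.2)
include hstep

theorem measurable_lastState (s : ℝ) (n : ℕ) :
    Measurable[past M n] fun ω => lastState step t i s ω n := by
  induction n with
  | zero => exact @measurable_const _ _ _ (past M 0) _
  | succ n ih =>
    have h := measurable_jumpState (t := t) (i := i) hstep (n + 1)
    refine Measurable.ite (m := past M (n + 1)) ?_ (measurable_snd.comp h)
      (ih.mono (past_mono n.le_succ) le_rfl)
    exact (measurable_fst.comp h) measurableSet_Iic

theorem measurable_ringTime (n : ℕ) : Measurable fun ω => (jumpState step t i ω n).1 :=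
  (measurable_jumpState_eval hstep n).fst.fst

theorem measurableSet_isGood (T : ℝ) : MeasurableSet {ω : ℕ → ℝ × M | IsGood step t i T ω} := by
  have h1 : MeasurableSet {ω : ℕ → ℝ × M | ∀ n, 0 < (ω n).1} := by
    rw [ofPred_forall]
    exact .iInter fun n => measurableSet_lt measurable_const (by fun_prop)
  have h2 : MeasurableSet {ω : ℕ → ℝ × M | ∃ n, T < (jumpState step t i ω n).1} := by
    rw [ofPred_exists]
    exact .iUnion fun n => measurableSet_lt measurable_const (measurable_ringTime hstep n)
  exact h1.inter h2

theorem measurable_chainPath {T s : ℝ} (hs : s ∈ Icc t T) :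
    Measurable (chainPath step t i T s : (ℕ → ℝ × M) → Fin N) := by
  refine measurable_to_countable' fun y => ?_
  have h : chainPath step t i T s ⁻¹' {y} =
      ({ω : ℕ → ℝ × M | IsGood step t i T ω} ∩ ⋃ k, {ω | s < (jumpState step t i ω (k + 1)).1} ∩
        (fun ω => lastState step t i s ω k) ⁻¹' {y}) ∪
      ({ω : ℕ → ℝ × M | IsGood step t i T ω}ᶜ ∩ {_ω | i = y}) := by
    ext ω
    by_cases hω : IsGood step t i T ω
    · simp only [mem_preimage, mem_singleton_iff, mem_union, mem_inter_iff, mem_ofPred_eq, hω,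
        true_and, mem_iUnion, mem_compl_iff, not_true_eq_false, false_and, or_false]
      constructor
      · rintro h
        obtain ⟨k, -, hk⟩ := exists_ring_interval hω hs
        exact ⟨k, hk, by rw [lastState_eq_chainPath hω hs hk, h]⟩
      · rintro ⟨k, hk, h⟩
        rwa [← lastState_eq_chainPath hω hs hk]
    · simp [hω, chainPath]
  rw [h]
  have hG := measurableSet_isGood (t := t) (i := i) hstep T
  refine (hG.inter (.iUnion fun k => ?_)).union (hG.compl.inter (.const _))
  exact (measurableSet_lt measurable_const (measurable_ringTime hstep _)).inter
    (((measurable_lastState hstep s k).mono (past_le k) le_rfl) (measurableSet_singleton y))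

variable {K : ℝ} [hK : Fact (0 < K)] {κ : Measure M} [IsProbabilityMeasure κ]

/-- Before ring k + 1 the path agrees with `lastState` at good points only; this is why `chainSigma`
asks for almost sure agreement. -/
theorem measurable_chainPath_chainSigma {T s : ℝ} (hs : s ∈ Icc t T) :
    Measurable[chainSigma (clockProduct K κ) step t i s] (chainPath step t i T s) := by
  refine @measurable_to_countable' _ _ _ _ (chainSigma (clockProduct K κ) step t i s) _ fun y => ?_
  refine ⟨measurable_chainPath hstep hs (measurableSet_singleton y), fun k =>
    ⟨(fun ω => lastState step t i s ω k) ⁻¹' {y},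
      measurable_lastState hstep s k (measurableSet_singleton y), ?_⟩⟩
  filter_upwards [ae_isGood (i := i) hstep (hs.1.trans hs.2)] with ω hω hk
  simp [lastState_eq_chainPath hω hs hk]

/-- If ring k + 1 has occurred by time s, both terms vanish on (s, u]. Otherwise A coincides almost
surely with an event of the first k rings, and the one-ring identity applies. -/
theorem setIntegral_chainSigma_jump_sub_comp {h : ℝ → Fin N → M → ℝ}
    (hh : Measurable fun q : ℝ × Fin N × M => h q.1 q.2.1 q.2.2) {C : ℝ}
    (hC : ∀ v y m, |h v y m| ≤ C) {s u : ℝ} (hsu : s ≤ u) (k : ℕ) {A : Set (ℕ → ℝ × M)}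
    (hA : MeasurableSet[chainSigma (clockProduct K κ) step t i s] A) :
    ∫ ω in A, (jumpTerm h s u (jumpState step t i ω k) (ω k) -
      compTerm (fun v y => K * ∫ m, h v y m ∂κ) s u (jumpState step t i ω k) (ω k))
      ∂(clockProduct K κ) = 0 := by
  classical
  obtain ⟨B, hB, hAB⟩ := hA.2 k
  rw [← setIntegral_jump_sub_comp (κ := κ) (K := K) (t := t) (i := i) hstep hh hC hsu hB,
    ← integral_indicator hA.1, ← integral_indicator (past_le k B hB)]
  refine integral_congr_ae ?_
  filter_upwards [hAB] with ω hω
  by_cases hs : s < (jumpState step t i ω (k + 1)).1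
  · simp only [Set.indicator_apply, hω hs]
  · have hle : (jumpState step t i ω k).1 + (ω k).1 ≤ s := not_lt.1 hs
    have h1 : jumpTerm h s u (jumpState step t i ω k) (ω k) = 0 :=
      Set.indicator_of_notMem (fun hm => hm.1.not_ge hle) _
    have h2 : compTerm (fun v y => K * ∫ m, h v y m ∂κ) s u (jumpState step t i ω k) (ω k) = 0 := by
      refine setIntegral_eq_zero_of_forall_eq_zero fun v hv => ?_
      exact Set.indicator_of_notMem (fun hm => (hm.2.trans_le hle).not_gt hv.1) _
    simp [Set.indicator_apply, h1, h2]

/-- The increment is the sum over rings of compensated terms, each of integral zero on A. Sum and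
integral are exchanged because the expected number of rings and the expected time between them are
summable. -/
theorem setIntegral_chain_increment {T s u : ℝ} (hs : s ∈ Icc t T) (hu : u ∈ Icc t T) (hsu : s ≤ u)
    (f : Fin N → ℝ) {A : Set (ℕ → ℝ × M)}
    (hA : MeasurableSet[chainSigma (clockProduct K κ) step t i s] A) :
    ∫ ω in A, (f (chainPath step t i T u ω) - f (chainPath step t i T s ω) -
      ∫ v in s..u, K * ∫ m, (f (step v (chainPath step t i T v ω) m) - f (chainPath step t i T v ω)) ∂κ)
      ∂(clockProduct K κ) = 0 := by
  set h : ℝ → Fin N → M → ℝ := fun v y m => f (step v y m) - f y with hhdef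
  set q : ℝ → Fin N → ℝ := fun v y => K * ∫ m, h v y m ∂κ with hq
  have hf : Measurable f := .of_discrete
  have hh : Measurable fun p : ℝ × Fin N × M => h p.1 p.2.1 p.2.2 :=
    (hf.comp hstep).sub (hf.comp (by fun_prop))
  obtain ⟨C, hC⟩ : ∃ C, ∀ v y m, |h v y m| ≤ C :=
    ⟨∑ j, |f j| + ∑ j, |f j|, fun v y m => (abs_sub _ _).trans (add_le_add
      (Finset.single_le_sum (f := fun j => |f j|) (fun _ _ => abs_nonneg _) (Finset.mem_univ _))
      (Finset.single_le_sum (f := fun j => |f j|) (fun _ _ => abs_nonneg _) (Finset.mem_univ _)))⟩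
  have hqC : ∀ v y, |q v y| ≤ K * C := abs_mul_integral_le hC
  have hqm : Measurable fun p : ℝ × Fin N => q p.1 p.2 := measurable_mul_integral hh
  have hqi : ∀ y, IntegrableOn (fun v => q v y) (Ioc s u) := fun y =>
    Integrable.of_bound (hqm.comp (f := fun v => (v, y)) (by fun_prop)).aestronglyMeasurable (K * C)
      (.of_forall fun v => hqC v y)
  set ψ : ℕ → (ℕ → ℝ × M) → ℝ := fun k ω => jumpTerm h s u (jumpState step t i ω k) (ω k) -
    compTerm q s u (jumpState step t i ω k) (ω k) with hψ
  have hj1 := fun k => integrable_jumpTerm (κ := κ) (K := K) (t := t) (i := i) hstep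
    (h := fun _ _ _ => (1 : ℝ)) measurable_const (C := 1) (by simp) s u k
  have hc1 := fun k => integrable_compTerm (κ := κ) (K := K) (t := t) (i := i) hstep
    (q := fun _ _ => (1 : ℝ)) measurable_const (C := 1) (by simp) hsu k
  have hψi : ∀ k, Integrable (ψ k) (clockProduct K κ) := fun k =>
    (integrable_jumpTerm hstep hh hC s u k).sub (integrable_compTerm hstep hqm hqC hsu k)
  have hψs : Summable fun k => ∫ ω in A, ‖ψ k ω‖ ∂(clockProduct K κ) := by
    refine Summable.of_nonneg_of_le (fun k => integral_nonneg fun _ => norm_nonneg _) (fun k => ?_)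
      (((summable_jumpTerm_one (K := K) (κ := κ) (t := t) (i := i) hstep hsu).mul_left C).add
        ((summable_compTerm_one (K := K) (κ := κ) (t := t) (i := i) hstep hsu).mul_left (K * C)))
    rw [← integral_const_mul, ← integral_const_mul,
      ← integral_add ((hj1 k).const_mul C) ((hc1 k).const_mul (K * C))]
    refine (setIntegral_le_integral (hψi k).norm (.of_forall fun _ => norm_nonneg _)).trans ?_
    refine integral_mono (hψi k).norm (((hj1 k).const_mul C).add ((hc1 k).const_mul (K * C)))
      fun ω => ?_
    exact (abs_sub _ _).trans (add_le_add (abs_jumpTerm_le hC s u _ _) (abs_compTerm_le hqC s u _ _))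
  have key := hasSum_integral_of_summable_integral_norm (μ := (clockProduct K κ).restrict A)
    (fun k => (hψi k).restrict) hψs
  have hzero : ∀ k, ∫ ω in A, ψ k ω ∂(clockProduct K κ) = 0 := fun k =>
    setIntegral_chainSigma_jump_sub_comp hstep hh hC hsu k hA
  simp_rw [hzero] at key
  rw [← key.unique hasSum_zero]
  refine setIntegral_congr_ae hA.1 ?_
  filter_upwards [ae_isGood (i := i) (K := K) (κ := κ) hstep (hs.1.trans hs.2)] with ω hω _
  exact (((hasSum_jumpTerm hω hs hu hsu f).sub (hasSum_compTerm hω hs hu hsu hqi)).tsum_eq).symm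

end JumpFiltration

/-- Applied with the σ-algebra of time s, it shows that the compensator is adapted. -/
theorem stronglyMeasurable_integral_of_rightCont {Ω : Type*} [MeasurableSpace Ω]
    {X : ℝ → Ω → Fin N} {t s : ℝ} (hts : t ≤ s) (hm : ∀ u ∈ Icc t s, Measurable (X u))
    (hr : ∀ ω, ∀ u ∈ Ico t s, ContinuousWithinAt (fun v => X v ω) (Ici u) u)
    {q : ℝ → Fin N → ℝ} (hq : Measurable fun p : ℝ × Fin N => q p.1 p.2) :
    StronglyMeasurable fun ω => ∫ u in t..s, q u (X u ω) := by
  have h1 : Measurable fun p : ℝ × Ω => q p.1 (X (projIcc t s hts p.1) p.2) :=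
    hq.comp (measurable_fst.prodMk (measurable_projIcc_of_rightCont hts hm hr))
  have h2 : StronglyMeasurable fun ω => ∫ u in Ioc t s, q u (X (projIcc t s hts u) ω) :=
    h1.stronglyMeasurable.integral_prod_left (μ := volume.restrict (Ioc t s))
  convert h2 using 2 with ω
  rw [intervalIntegral.integral_of_le hts]
  exact setIntegral_congr_fun measurableSet_Ioc fun u hu => by
    simp [projIcc_of_mem hts (Ioc_subset_Icc_self hu)]

/-! ### The jump chain as a solution of the martingale problem -/

section JumpMartingale

variable {M : Type} [MeasurableSpace M] {step : ℝ → Fin N → M → Fin N} {t : ℝ} {i : Fin N}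
  {K : ℝ} [hK : Fact (0 < K)] {κ : Measure M} [IsProbabilityMeasure κ]
  (hstep : Measurable fun q : ℝ × Fin N × M => step q.1 q.2.1 q.2.2)
include hstep

theorem chain_martingale (T : ℝ) (f : Fin N → ℝ) :
    Martingale (fun (s : Icc t T) ω => f (chainPath step t i T s ω) - ∫ v in t..s,
        K * ∫ m, (f (step v (chainPath step t i T v ω) m) - f (chainPath step t i T v ω)) ∂κ)
      (chainFiltration (clockProduct K κ) step t T i) (clockProduct K κ) := by
  set q : ℝ → Fin N → ℝ := fun v y => K * ∫ m, (f (step v y m) - f y) ∂κ with hq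
  have hf : Measurable f := .of_discrete
  have hh : Measurable fun p : ℝ × Fin N × M => f (step p.1 p.2.1 p.2.2) - f p.2.1 :=
    (hf.comp hstep).sub (hf.comp (by fun_prop))
  have hfb : ∀ y, |f y| ≤ ∑ j, |f j| := fun y =>
    Finset.single_le_sum (f := fun j => |f j|) (fun _ _ => abs_nonneg _) (Finset.mem_univ y)
  have hqC : ∀ v y, |q v y| ≤ K * (∑ j, |f j| + ∑ j, |f j|) :=
    abs_mul_integral_le fun v y m => (abs_sub _ _).trans (add_le_add (hfb _) (hfb _))
  have hqm : Measurable fun p : ℝ × Fin N => q p.1 p.2 :=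
    measurable_mul_integral (h := fun v y m => f (step v y m) - f y) hh
  have hI : ∀ (s : Icc t T) (m : MeasurableSpace (ℕ → ℝ × M)),
      (∀ u ∈ Icc t (s : ℝ), Measurable[m] (chainPath step t i T u)) →
      StronglyMeasurable[m] fun ω => f (chainPath step t i T s ω) -
        ∫ v in t..s, q v (chainPath step t i T v ω) := fun s m hm => by
    refine StronglyMeasurable.sub (hf.comp (hm s ⟨s.2.1, le_rfl⟩)).stronglyMeasurable ?_
    exact stronglyMeasurable_integral_of_rightCont s.2.1 hm
      (fun ω u hu => chainPath_rightCont ω ⟨hu.1, hu.2.trans_le s.2.2⟩) hqm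
  have hbd : ∀ (s : Icc t T) (ω : ℕ → ℝ × M),
      IntervalIntegrable (fun v => q v (chainPath step t i T v ω)) volume t s := fun s ω => by
    rw [intervalIntegrable_iff_integrableOn_Icc_of_le s.2.1]
    have h1 : Measurable fun v : ℝ => q v (chainPath step t i T (projIcc t s s.2.1 v) ω) :=
      hqm.comp (measurable_id.prodMk ((measurable_projIcc_of_rightCont s.2.1
        (fun u hu => measurable_chainPath hstep ⟨hu.1, hu.2.trans s.2.2⟩)
        fun ω u hu => chainPath_rightCont ω ⟨hu.1, hu.2.trans_le s.2.2⟩).comp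
          measurable_prodMk_right))
    have h2 : IntegrableOn (fun v : ℝ => q v (chainPath step t i T (projIcc t s s.2.1 v) ω))
        (Icc t s) := Integrable.of_bound h1.aestronglyMeasurable _ (.of_forall fun v => hqC _ _)
    refine h2.congr_fun (fun v hv => ?_) measurableSet_Icc
    simp [projIcc_of_mem s.2.1 hv]
  have hint : ∀ s : Icc t T, Integrable (fun ω => f (chainPath step t i T s ω) -
        ∫ v in t..s, q v (chainPath step t i T v ω)) (clockProduct K κ) := fun s => by
    refine Integrable.of_bound (hI s MeasurableSpace.pi fun u hu =>
      measurable_chainPath hstep ⟨hu.1, hu.2.trans s.2.2⟩).aestronglyMeasurable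
      (∑ j, |f j| + K * (∑ j, |f j| + ∑ j, |f j|) * |(s : ℝ) - t|) (.of_forall fun ω => ?_)
    have hle := intervalIntegral.norm_integral_le_of_norm_le_const (a := t) (b := s)
      (f := fun v => q v (chainPath step t i T v ω)) fun v _ => hqC _ _
    exact (abs_sub _ _).trans (add_le_add (hfb _) hle)
  refine ⟨fun s => hI s _ fun u hu A hA => ?_, fun s u hsu => ?_⟩
  · exact (chainFiltration (clockProduct K κ) step t T i).mono
      (show (⟨u, hu.1, hu.2.trans s.2.2⟩ : Icc t T) ≤ s from hu.2) _
      (measurable_chainPath_chainSigma hstep ⟨hu.1, hu.2.trans s.2.2⟩ hA)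
  · refine (ae_eq_condExp_of_forall_setIntegral_eq (Filtration.le _ s) (hint u)
      (fun A _ _ => (hint s).integrableOn) (fun A hA _ => ?_) ?_).symm
    · rw [eq_comm, ← sub_eq_zero, ← integral_sub (hint u).integrableOn (hint s).integrableOn]
      rw [← setIntegral_chain_increment (K := K) (κ := κ) hstep s.2 u.2 hsu f hA]
      refine integral_congr_ae (.of_forall fun ω => ?_)
      have := intervalIntegral.integral_interval_sub_left (hbd u ω) (hbd s ω)
      simp only [hq] at this ⊢
      rw [← this]
      ring
    · refine (hI s _ fun u hu A hA => ?_).aestronglyMeasurable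
      exact (chainFiltration (clockProduct K κ) step t T i).mono
        (show (⟨u, hu.1, hu.2.trans s.2.2⟩ : Icc t T) ≤ s from hu.2) _
        (measurable_chainPath_chainSigma hstep ⟨hu.1, hu.2.trans s.2.2⟩ hA)

/-- The jump chain solves the martingale problem of any control with the same generator. -/
theorem nonempty_controlledChain {T : ℝ} (htT : t ≤ T) (c : Control nbr)
    (hc : ∀ᵐ v ∂(volume.restrict (Icc t T)), ∀ f y,
      generator c v f y = K * ∫ m, (f (step v y m) - f y) ∂κ) :
    Nonempty (ControlledChain nbr t T i c) := by
  refine ⟨{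
    Ω := ℕ → ℝ × M
    mΩ := MeasurableSpace.pi
    μ := clockProduct K κ
    isProb := inferInstance
    filtration := chainFiltration (clockProduct K κ) step t T i
    X := chainPath step t i T
    adapted := fun s => measurable_chainPath_chainSigma hstep s.2
    rightCont := fun ω s hs => chainPath_rightCont ω hs
    leftLim := fun ω s hs => chainPath_leftLim ω hs
    initial := ?_
    martingale := fun f => ?_ }⟩
  · filter_upwards [ae_isGood (i := i) (K := K) (κ := κ) hstep htT] with ω hω
    exact chainPath_eq (k := 0) hω le_rfl (by simpa [jumpState] using hω.1 0)
  · convert chain_martingale (K := K) (κ := κ) (i := i) hstep T f using 4 with s ω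
    -- The compensator is a time integral, so equality of the generators at almost every time
    -- suffices.
    refine intervalIntegral.integral_congr_ae_restrict ?_
    rw [uIoc_of_le s.2.1]
    have hsub : Ioc t (s : ℝ) ⊆ Icc t T := fun u hu => ⟨hu.1.le, hu.2.trans s.2.2⟩
    filter_upwards [ae_restrict_of_ae_restrict_of_subset hsub hc] with v hv
    exact hv f _

end JumpMartingale

/-! ### Chains with bounded rates -/

/-- The law of a uniform node and an independent uniform number. -/
def markMeasure (N : ℕ) : Measure (Fin N × ℝ) :=
  ((N : ENNReal)⁻¹ • Measure.count).prod (volume.restrict (Icc 0 1))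

theorem isProbabilityMeasure_markMeasure (hN : 0 < N) : IsProbabilityMeasure (markMeasure N) := by
  have h1 : IsProbabilityMeasure ((N : ENNReal)⁻¹ • Measure.count : Measure (Fin N)) := ⟨by
    simp [Measure.count_univ, ENNReal.inv_mul_cancel, hN.ne']⟩
  have h2 : IsProbabilityMeasure (volume.restrict (Icc (0 : ℝ) 1)) := ⟨by simp⟩
  exact inferInstanceAs (IsProbabilityMeasure (Measure.prod _ _))

/-- Thinning: node j is proposed with probability 1/N and accepted with probability a j. -/
theorem integral_markMeasure {N : ℕ} (hN : 0 < N) {a b : Fin N → ℝ} (ha : ∀ j, 0 ≤ a j ∧ a j ≤ 1) :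
    ∫ m, (if m.2 < a m.1 then b m.1 else 0) ∂(markMeasure N) = (N : ℝ)⁻¹ * ∑ j, a j * b j := by
  have := isProbabilityMeasure_markMeasure hN
  have hm : Measurable fun m : Fin N × ℝ => if m.2 < a m.1 then b m.1 else 0 := by
    refine Measurable.ite (measurableSet_lt measurable_snd ?_) ?_ measurable_const
    · exact (Measurable.of_discrete (f := a)).comp measurable_fst
    · exact (Measurable.of_discrete (f := b)).comp measurable_fst
  have hi : Integrable (fun m : Fin N × ℝ => if m.2 < a m.1 then b m.1 else 0) (markMeasure N) := by
    refine Integrable.of_bound hm.aestronglyMeasurable (∑ j, |b j|) (.of_forall fun m => ?_)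
    split_ifs
    · exact Finset.single_le_sum (f := fun j => |b j|) (fun _ _ => abs_nonneg _) (Finset.mem_univ _)
    · simpa using Finset.sum_nonneg fun j _ => abs_nonneg (b j)
  rw [markMeasure, integral_prod _ hi, integral_smul_measure, integral_count]
  simp only [ENNReal.toReal_inv, ENNReal.toReal_natCast, smul_eq_mul]
  congr 1
  refine Finset.sum_congr rfl fun j _ => ?_
  have h1 : ∀ x : ℝ, (if x < a j then b j else 0) = (Iio (a j)).indicator (fun _ => b j) x :=
    fun x => by simp [Set.indicator_apply]
  simp_rw [h1]
  rw [integral_indicator measurableSet_Iio, Measure.restrict_restrict measurableSet_Iio]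
  have h2 : Iio (a j) ∩ Icc 0 1 = Ico 0 (a j) := by
    ext x
    simp only [mem_inter_iff, mem_Iio, mem_Icc, mem_Ico]
    exact ⟨fun h => ⟨h.2.1, h.1⟩, fun h => ⟨h.2, h.1, h.2.le.trans (ha j).2⟩⟩
  rw [h2]
  simp [(ha j).1]

/-- Chains with bounded measurable rates exist. -/
theorem exists_controlledChain {t T B : ℝ} (htT : t ≤ T) {c : Control nbr}
    (hc : c ∈ admissible nbr t T) (hB : ∀ s ∈ Icc t T, ∀ i j, c s i j ≤ B) (i : Fin N) :
    Nonempty (ControlledChain nbr t T i c) := by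
  have hN : 0 < N := i.pos
  wlog hB0 : 0 < B generalizing B
  · exact this (B := max B 1) (fun s hs i j => (hB s hs i j).trans (le_max_left _ _))
      (lt_max_of_lt_right one_pos)
  have := isProbabilityMeasure_markMeasure hN
  -- Uniformisation: rings at rate N B, a uniform proposal j and acceptance with probability c / B
  -- give the jump rate N B · (1/N) · (c / B) = c.
  have hK : Fact (0 < N * B) := ⟨by positivity⟩
  set d : (k : Fin N) → nbr k → ℝ → ℝ := fun k j => (hc.2 k j).aestronglyMeasurable.mk with hd
  have hdm : ∀ k j, Measurable (d k j) := fun k j =>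
    (hc.2 k j).aestronglyMeasurable.stronglyMeasurable_mk.measurable
  have hdc : ∀ᵐ v ∂(volume.restrict (Icc t T)), ∀ k j, c v k j = d k j v :=
    ae_all_iff.2 fun k => ae_all_iff.2 fun j => (hc.2 k j).aestronglyMeasurable.ae_eq_mk
  -- The measurable versions agree with the rates only almost everywhere; clipping to [0, B] keeps
  -- the acceptance probability in [0, 1] at all times.
  set a : ℝ → Fin N → Fin N → ℝ := fun v y j =>
    if h : j ∈ nbr y then min B (max 0 (d y ⟨j, h⟩ v)) / B else 0 with ha
  have ha01 : ∀ v y j, 0 ≤ a v y j ∧ a v y j ≤ 1 := fun v y j => by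
    simp only [ha]
    split_ifs
    · exact ⟨by positivity, (div_le_one hB0).2 (min_le_left _ _)⟩
    · simp
  have ham : Measurable fun p : ℝ × Fin N × Fin N => a p.1 p.2.1 p.2.2 := by
    refine measurable_from_prod_countable_left fun p => ?_
    simp only [ha]
    split_ifs
    · exact (measurable_const.min (measurable_const.max (hdm _ _))).div_const _
    · exact measurable_const
  set step : ℝ → Fin N → Fin N × ℝ → Fin N := fun v y m => if m.2 < a v y m.1 then m.1 else y
    with hstepdef
  have hstep : Measurable fun q : ℝ × Fin N × (Fin N × ℝ) => step q.1 q.2.1 q.2.2 := by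
    refine Measurable.ite (measurableSet_lt (by fun_prop) ?_) (by fun_prop) (by fun_prop)
    exact ham.comp (f := fun q : ℝ × Fin N × (Fin N × ℝ) => (q.1, q.2.1, q.2.2.1)) (by fun_prop)
  refine nonempty_controlledChain (K := N * B) (κ := markMeasure N) hstep htT c ?_
  filter_upwards [hdc, ae_restrict_mem measurableSet_Icc] with v hv hvt f y
  have h1 : ∀ m : Fin N × ℝ, f (step v y m) - f y = if m.2 < a v y m.1 then f m.1 - f y else 0 :=
    fun m => by
      simp only [hstepdef]
      split_ifs <;> simp
  simp_rw [h1]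
  rw [integral_markMeasure hN (b := fun j => f j - f y) (ha01 v y)]
  have h2 : ∀ j : nbr y, c v y j = B * a v y j := fun j => by
    simp only [ha, j.2, dif_pos, Subtype.coe_eta, ← hv]
    rw [max_eq_right (hc.1 v hvt y j), min_eq_right (hB v hvt y j), mul_div_cancel₀ _ hB0.ne']
  have h3 : generator c v f y = ∑ j ∈ nbr y, B * a v y j * (f j - f y) := by
    rw [← Finset.sum_coe_sort]
    exact Finset.sum_congr rfl fun j _ => by rw [h2]
  rw [h3, Finset.sum_subset (Finset.subset_univ _) fun j _ hj => by simp [ha, hj]]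
  simp only [Finset.mul_sum]
  refine Finset.sum_congr rfl fun j _ => ?_
  have : (N : ℝ) ≠ 0 := by positivity
  field_simp

/-! ### Positivity of the holding probabilities -/

/-- At a first zero b, choose a < b with ∫ Λ < 1/2 on [a, b] and let x maximise p on [a, b]. Then p
x = p x - p b ≤ ∫ Λ p over [x, b], which is less than p x / 2, a contradiction. Only integrability
of Λ is needed. -/
theorem pos_of_sub_le_integral {p Λ : ℝ → ℝ} {t T : ℝ} (hpc : ContinuousOn p (Icc t T))
    (hp : ∀ s ∈ Icc t T, 0 ≤ p s) (hpt : 0 < p t) (hΛ : ∀ s ∈ Icc t T, 0 ≤ Λ s)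
    (hΛi : IntegrableOn Λ (Icc t T))
    (h : ∀ a ∈ Icc t T, ∀ b ∈ Icc t T, a ≤ b → p a - p b ≤ ∫ u in a..b, Λ u * p u)
    {s : ℝ} (hs : s ∈ Icc t T) : 0 < p s := by
  refine (hp s hs).lt_of_ne fun hs0 => ?_
  have hcomp : IsCompact (Icc t T ∩ p ⁻¹' {0}) :=
    isCompact_Icc.of_isClosed_subset (hpc.preimage_isClosed_of_isClosed isClosed_Icc
      isClosed_singleton) inter_subset_left
  obtain ⟨b, ⟨hb, hpb⟩, hmin⟩ := hcomp.exists_isLeast ⟨s, hs, hs0.symm⟩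
  have hpb : p b = 0 := hpb
  have htb : t < b := hb.1.lt_of_ne fun h => by rw [h, hpb] at hpt; exact hpt.false
  have hΛii : ∀ {x y : ℝ}, x ∈ Icc t T → y ∈ Icc t T → IntervalIntegrable Λ volume x y :=
    fun hx hy => (hΛi.mono_set (uIcc_subset_Icc hx hy)).intervalIntegrable
  have ht : t ∈ Icc t T := ⟨le_rfl, hb.1.trans hb.2⟩
  have hcont : ContinuousWithinAt (fun x => ∫ u in t..x, Λ u) (Icc t b) b := by
    have := intervalIntegral.continuousOn_primitive_interval (μ := volume) (f := Λ) (a := t) (b := b)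
      (hΛi.mono_set (uIcc_subset_Icc ht hb))
    rw [uIcc_of_le hb.1] at this
    exact this b ⟨hb.1, le_rfl⟩
  have hev : ∀ᶠ x in 𝓝[Icc t b] b, (∫ u in t..b, Λ u) - 1 / 2 < ∫ u in t..x, Λ u :=
    hcont.eventually (lt_mem_nhds (by linarith))
  have hev' := nhdsWithin_mono b (Ico_subset_Icc_self : Ico t b ⊆ Icc t b) hev
  have : (𝓝[Ico t b] b).NeBot := by
    rw [nhdsWithin_Ico_eq_nhdsLT htb]; infer_instance
  obtain ⟨a, ha1, ha2⟩ := (Filter.Eventually.and hev' self_mem_nhdsWithin).exists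
  have haT : a ∈ Icc t T := ⟨ha2.1, ha2.2.le.trans hb.2⟩
  have hsub : Icc a b ⊆ Icc t T := Icc_subset_Icc ha2.1 hb.2
  obtain ⟨x, hx, hxm⟩ := isCompact_Icc.exists_isMaxOn (nonempty_Icc.2 ha2.2.le) (hpc.mono hsub)
  have hpa : 0 < p a := (hp a haT).lt_of_ne fun h => (hmin ⟨haT, h.symm⟩).not_gt ha2.2
  have hpx : 0 < p x := hpa.trans_le (hxm ⟨le_rfl, ha2.2.le⟩)
  have hxT := hsub hx
  have h1 := h x hxT b hb hx.2
  have h2 : ∫ u in x..b, Λ u * p u ≤ ∫ u in x..b, Λ u * p x := by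
    refine intervalIntegral.integral_mono_on hx.2 ?_ ((hΛii hxT hb).mul_const _) fun u hu => ?_
    · exact (hΛii hxT hb).mul_continuousOn (hpc.mono (uIcc_subset_Icc hxT hb))
    · have hu' : u ∈ Icc a b := ⟨hx.1.trans hu.1, hu.2⟩
      exact mul_le_mul_of_nonneg_left (hxm hu') (hΛ u (hsub hu'))
  rw [intervalIntegral.integral_mul_const] at h2
  have h3 : ∫ u in a..x, Λ u ≥ 0 := intervalIntegral.integral_nonneg hx.1 fun u hu =>
    hΛ u (hsub ⟨hu.1, hu.2.trans hx.2⟩)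
  have h4 := intervalIntegral.integral_add_adjacent_intervals (hΛii ht haT) (hΛii haT hxT)
  have h5 := intervalIntegral.integral_add_adjacent_intervals (hΛii ht hxT) (hΛii hxT hb)
  have h6 : ∫ u in x..b, Λ u < 1 / 2 := by linarith
  nlinarith

/-- Inflow to i is nonnegative, and outflow is at most the total rate out of i times the mass at i.
This is what links optimality from i to the argmax condition at i. -/
theorem ControlledChain.prob_start_pos {t T : ℝ} {i : Fin N} {c : Control nbr}
    (hc : c ∈ admissible nbr t T) (Z : ControlledChain nbr t T i c) {s : ℝ} (hs : s ∈ Icc t T) :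
    0 < Z.prob s i := by
  set b : ℝ → ℝ := fun u => ∑ m, Z.prob u m * generator c u (Pi.single i 1) m with hb
  have hbi : IntegrableOn b (Icc t T) :=
    integrable_finsetSum _ fun m _ => Z.integrable_prob_mul (generator_integrable hc _ m) m
  have htT := hs.1.trans hs.2
  have hbii : ∀ {x y : ℝ}, x ∈ Icc t T → y ∈ Icc t T → IntervalIntegrable b volume x y :=
    fun hx hy => (hbi.mono_set (uIcc_subset_Icc hx hy)).intervalIntegrable
  have ht : t ∈ Icc t T := ⟨le_rfl, htT⟩
  have hp : ∀ u ∈ Icc t T, Z.prob u i = 1 + ∫ v in t..u, b v := fun u hu => by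
    have := Z.forward hc hu (Pi.single i 1)
    simpa [Pi.single_apply] using this
  have hpc : ContinuousOn (fun u => Z.prob u i) (Icc t T) := by
    have := intervalIntegral.continuousOn_primitive_interval (μ := volume) (f := b) (a := t) (b := T)
      (by rwa [uIcc_of_le htT])
    rw [uIcc_of_le htT] at this
    exact (continuousOn_const.add this).congr hp
  have hΛi : IntegrableOn (fun u => ∑ j, c u i j) (Icc t T) :=
    integrable_finsetSum _ fun j _ => hc.2 i j
  have hle : ∀ u ∈ Icc t T, -b u ≤ (∑ j, c u i j) * Z.prob u i := fun u hu => by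
    have h1 : ∀ m, -(Z.prob u m * generator c u (Pi.single i 1) m) ≤
        if m = i then (∑ j, c u i j) * Z.prob u i else 0 := fun m => by
      split_ifs with hm
      · subst hm
        rw [mul_comm (∑ j, c u m j), ← mul_neg]
        refine mul_le_mul_of_nonneg_left ?_ (Z.prob_nonneg u m)
        rw [generator, ← Finset.sum_neg_distrib]
        refine Finset.sum_le_sum fun j _ => ?_
        have h0 := hc.1 u hu m j
        have h1 : (0 : ℝ) ≤ (Pi.single m 1 : Fin N → ℝ) j := by
          rw [Pi.single_apply]; split_ifs <;> simp
        simp only [Pi.single_eq_same]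
        nlinarith
      · rw [neg_nonpos]
        refine mul_nonneg (Z.prob_nonneg u m) (Finset.sum_nonneg fun j _ => ?_)
        refine mul_nonneg (hc.1 u hu m j) ?_
        rw [Pi.single_apply, Pi.single_apply, if_neg hm, sub_zero]
        split_ifs <;> simp
    calc -b u = ∑ m, -(Z.prob u m * generator c u (Pi.single i 1) m) := by
          rw [hb, Finset.sum_neg_distrib]
      _ ≤ _ := Finset.sum_le_sum fun m _ => h1 m
      _ = _ := by simp
  refine pos_of_sub_le_integral hpc (fun u _ => Z.prob_nonneg u i) ?_
    (fun u hu => Finset.sum_nonneg fun j _ => hc.1 u hu i j) hΛi (fun x hx y hy hxy => ?_) hs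
  · rw [hp t ht]; simp
  · have h1 := intervalIntegral.integral_add_adjacent_intervals (hbii ht hx) (hbii hx hy)
    have h2 : Z.prob x i - Z.prob y i = ∫ u in x..y, -b u := by
      rw [hp x hx, hp y hy, intervalIntegral.integral_neg]
      linarith
    rw [h2]
    refine intervalIntegral.integral_mono_on hxy (hbii hx hy).neg ?_ fun u hu =>
      hle u ⟨hx.1.trans hu.1, hu.2.trans hy.2⟩
    exact ((hΛi.mono_set (uIcc_subset_Icc hx hy)).intervalIntegrable).mul_continuousOn
      (hpc.mono (uIcc_subset_Icc hx hy))

/-! ### Integrals of extended-real functions -/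

/-- For x = a + b this is x⁺ - x⁻ = a + b⁺ - b⁻ with the subtractions moved across, so that a = ∞ is
allowed and the identity can be integrated term by term. -/
theorem toENNReal_add_coe_add (a : ENNReal) (b : ℝ) :
    ((a : EReal) + b).toENNReal + ENNReal.ofReal (-b) =
      a + ENNReal.ofReal b + (-((a : EReal) + b)).toENNReal := by
  induction a with
  | top => simp
  | coe x =>
    have h : ((x : ENNReal) : EReal) + b = ((x + b : ℝ) : EReal) := by
      rw [EReal.coe_add]; rfl
    rw [h, ← EReal.coe_neg, EReal.real_coe_toENNReal, EReal.real_coe_toENNReal,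
      ← ENNReal.ofReal_coe_nnreal]
    have hx0 : 0 ≤ (x : ℝ) := x.2
    generalize (x : ℝ) = y at hx0
    rcases le_total 0 b with hb | hb <;> rcases le_total 0 (y + b) with hx | hx
    · rw [ENNReal.ofReal_of_nonpos (neg_nonpos.2 hb), ENNReal.ofReal_of_nonpos (neg_nonpos.2 hx),
        ENNReal.ofReal_add hx0 hb]
    · obtain rfl : y = 0 := by linarith
      obtain rfl : b = 0 := by linarith
      simp
    · rw [ENNReal.ofReal_of_nonpos hb, ENNReal.ofReal_of_nonpos (neg_nonpos.2 hx),
        ← ENNReal.ofReal_add hx (by linarith)]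
      simp
    · rw [ENNReal.ofReal_of_nonpos hb, ENNReal.ofReal_of_nonpos hx, add_zero, zero_add,
        ← ENNReal.ofReal_add hx0 (by linarith)]
      congr 1
      ring

section ERealIntegral

variable {α : Type*} [MeasurableSpace α] {μ : Measure α} {h : α → ENNReal} {b : α → ℝ}

/-- The negative part of h + b is at most that of b, hence has finite integral and may be cancelled
even if h has infinite integral. -/
theorem lintegral_toENNReal_add_coe (hh : AEMeasurable h μ) (hb : Integrable b μ) :
    ∫⁻ x, (-((h x : EReal) + b x)).toENNReal ∂μ ≠ ⊤ ∧
      ((∫⁻ x, ((h x : EReal) + b x).toENNReal ∂μ : ENNReal) : EReal) =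
        (∫⁻ x, h x ∂μ : ENNReal) + ((∫ x, b x ∂μ : ℝ) : EReal) +
          (∫⁻ x, (-((h x : EReal) + b x)).toENNReal ∂μ : ENNReal) := by
  have hp : ∫⁻ x, ENNReal.ofReal (b x) ∂μ ≠ ⊤ := hb.lintegral_lt_top.ne
  have hn : ∫⁻ x, ENNReal.ofReal (-b x) ∂μ ≠ ⊤ := hb.neg.lintegral_lt_top.ne
  have hle : ∫⁻ x, (-((h x : EReal) + b x)).toENNReal ∂μ ≤ ∫⁻ x, ENNReal.ofReal (-b x) ∂μ := by
    refine lintegral_mono fun x => ?_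
    rw [← EReal.real_coe_toENNReal, EReal.coe_neg]
    refine EReal.toENNReal_le_toENNReal (EReal.neg_le_neg_iff.2 ?_)
    exact le_add_of_nonneg_left (EReal.coe_ennreal_nonneg _)
  have hf := ne_top_of_le_ne_top hn hle
  refine ⟨hf, ?_⟩
  have hbm : AEMeasurable b μ := hb.aestronglyMeasurable.aemeasurable
  have key : ∫⁻ x, ((h x : EReal) + b x).toENNReal ∂μ + ∫⁻ x, ENNReal.ofReal (-b x) ∂μ =
      ∫⁻ x, h x ∂μ + ∫⁻ x, ENNReal.ofReal (b x) ∂μ +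
        ∫⁻ x, (-((h x : EReal) + b x)).toENNReal ∂μ := by
    have hbn : AEMeasurable (fun x => ENNReal.ofReal (-b x)) μ := hbm.neg.ennreal_ofReal
    have hhb : AEMeasurable (fun x => h x + ENNReal.ofReal (b x)) μ := hh.add hbm.ennreal_ofReal
    rw [← lintegral_add_right' _ hbn, ← lintegral_add_left' hh, ← lintegral_add_left' hhb]
    exact lintegral_congr fun x => toENNReal_add_coe_add _ _
  rw [integral_eq_lintegral_pos_part_sub_lintegral_neg_part hb]
  generalize ∫⁻ x, ((h x : EReal) + b x).toENNReal ∂μ = A at *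
  generalize ∫⁻ x, (-((h x : EReal) + b x)).toENNReal ∂μ = F at *
  generalize ∫⁻ x, ENNReal.ofReal (b x) ∂μ = P at *
  generalize ∫⁻ x, ENNReal.ofReal (-b x) ∂μ = Q at *
  generalize ∫⁻ x, h x ∂μ = H at *
  lift F to NNReal using hf
  lift P to NNReal using hp
  lift Q to NNReal using hn
  induction H with
  | top =>
    have hA : A = ⊤ := by
      by_contra hA
      lift A to NNReal using hA
      simp [← ENNReal.coe_add] at key
    rw [hA, EReal.coe_ennreal_top, EReal.top_add_coe]
    exact (EReal.top_add_of_ne_bot (EReal.coe_ennreal_ne_bot _)).symm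
  | coe H =>
    have hA : A ≠ ⊤ := by
      rintro rfl
      simp [← ENNReal.coe_add] at key
    lift A to NNReal using hA
    have key' : (A : ℝ) + Q = H + P + F := by exact_mod_cast key
    have e : ∀ x : NNReal, ((x : ENNReal) : EReal) = ((x : ℝ) : EReal) := fun _ => rfl
    simp only [e, ENNReal.coe_toReal, ← EReal.coe_add, EReal.coe_eq_coe_iff]
    linarith

theorem erealIntegral_eq_add {f : α → EReal} (hh : AEMeasurable h μ) (hb : Integrable b μ)
    (hf : ∀ᵐ x ∂μ, f x = (h x : EReal) + b x) :
    erealIntegral μ f = (∫⁻ x, h x ∂μ : ENNReal) + ((∫ x, b x ∂μ : ℝ) : EReal) := by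
  obtain ⟨h1, h2⟩ := lintegral_toENNReal_add_coe hh hb
  rw [erealIntegral, lintegral_congr_ae (f := fun x => (f x).toENNReal)
      (g := fun x => ((h x : EReal) + b x).toENNReal) (hf.mono fun x hx => by simp only [hx]),
    lintegral_congr_ae (f := fun x => (-f x).toENNReal) (g := fun x => (-((h x : EReal) + b x)).toENNReal)
      (hf.mono fun x hx => by simp only [hx]), h2]
  generalize ∫⁻ x, (-((h x : EReal) + b x)).toENNReal ∂μ = F at *
  lift F to NNReal using h1
  exact EReal.add_sub_cancel_right (b := (F : ℝ))

/-- Exchanges positive and negative parts; the positive part of f has finite integral, so the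
difference can be negated. -/
theorem erealIntegral_eq_neg_add {f : α → EReal} (hh : AEMeasurable h μ) (hb : Integrable b μ)
    (hf : ∀ᵐ x ∂μ, f x = -(h x : EReal) + b x) :
    erealIntegral μ f = -(∫⁻ x, h x ∂μ : ENNReal) + ((∫ x, b x ∂μ : ℝ) : EReal) := by
  have hneg : erealIntegral μ (fun x => -f x) =
      (∫⁻ x, h x ∂μ : ENNReal) + ((∫ x, -b x ∂μ : ℝ) : EReal) := by
    refine erealIntegral_eq_add hh hb.neg (hf.mono fun x hx => ?_)
    rw [hx, EReal.neg_add (.inr (EReal.coe_ne_top _)) (.inr (EReal.coe_ne_bot _)), neg_neg,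
      EReal.coe_neg, sub_eq_add_neg]
  have hfin : ∫⁻ x, (f x).toENNReal ∂μ ≠ ⊤ := by
    have h1 := (lintegral_toENNReal_add_coe hh hb.neg).1
    rwa [lintegral_congr_ae (g := fun x => (f x).toENNReal)] at h1
    refine hf.mono fun x hx => ?_
    simp only [Pi.neg_apply, hx]
    rw [EReal.neg_add (.inr (EReal.coe_ne_top _)) (.inr (EReal.coe_ne_bot _)),
      EReal.coe_neg, sub_eq_add_neg, neg_neg]
  have hsw : erealIntegral μ f = -erealIntegral μ (fun x => -f x) := by
    simp only [erealIntegral, neg_neg]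
    rw [EReal.neg_sub (.inl (EReal.coe_ennreal_ne_bot _)) (.inr (by simpa using hfin)),
      sub_eq_add_neg, add_comm]
  rw [hsw, hneg, EReal.neg_add (.inr (EReal.coe_ne_top _)) (.inr (EReal.coe_ne_bot _)),
    integral_neg, EReal.coe_neg, sub_eq_add_neg, neg_neg]

end ERealIntegral

/-! ### The payoff of a control -/

/-- The discounted difference between the cost of `c` and the value it would have at a maximiser. -/
def loss (nbr : Fin N → Finset (Fin N)) (L : Cost nbr) (V : ℝ → Fin N → ℝ) (r t : ℝ)
    (c : Control nbr) (s : ℝ) (m : Fin N) : ENNReal :=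
  ENNReal.ofReal (Real.exp (-r * (s - t))) *
    (L m (c s m) - (slack nbr L V c s m : EReal)).toENNReal

theorem slack_le (hL : CostAssumptions nbr L) (V : ℝ → Fin N → ℝ) {c : Control nbr} {s : ℝ}
    {m : Fin N} (hc : 0 ≤ c s m) : (slack nbr L V c s m : EReal) ≤ L m (c s m) :=
  fenchel_le hL m _ hc

theorem loss_eq_zero_iff (hL : CostAssumptions nbr L) {V : ℝ → Fin N → ℝ} {r t : ℝ}
    {c : Control nbr} {s : ℝ} {m : Fin N} (hc : 0 ≤ c s m) :
    loss nbr L V r t c s m = 0 ↔ c s m ∈ argmaxSet nbr L m fun j => V s j - V s m := by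
  rw [mem_argmaxSet_iff hL, loss, mul_eq_zero, EReal.toENNReal_eq_zero_iff]
  have h1 : ENNReal.ofReal (Real.exp (-r * (s - t))) ≠ 0 := by simp [Real.exp_pos]
  have h2 := slack_le hL V hc
  constructor
  · rintro (h | h)
    · exact absurd h h1
    · exact ⟨hc, le_antisymm (EReal.sub_nonpos.1 h) h2⟩
  · rintro ⟨-, h⟩
    right
    rw [h]
    exact (EReal.sub_nonpos).2 le_rfl

/-- Splits the discounted cost into a nonnegative, possibly infinite part and a real part that is
integrable in time, the form required by `erealIntegral_eq_add`. -/
theorem exp_mul_cost (hL : CostAssumptions nbr L) (V : ℝ → Fin N → ℝ) (r t : ℝ)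
    {c : Control nbr} {s : ℝ} {m : Fin N} (hc : 0 ≤ c s m) :
    ((Real.exp (-r * (s - t)) : ℝ) : EReal) * L m (c s m) =
      (loss nbr L V r t c s m : EReal) +
        ((Real.exp (-r * (s - t)) * slack nbr L V c s m : ℝ) : EReal) := by
  have h0 : (0 : EReal) ≤ L m (c s m) - (slack nbr L V c s m : EReal) :=
    (EReal.sub_nonneg (.inr (EReal.coe_ne_top _)) (.inr (EReal.coe_ne_bot _))).2 (slack_le hL V hc)
  have he : (0 : EReal) ≤ (Real.exp (-r * (s - t)) : ℝ) := EReal.coe_nonneg.2 (Real.exp_pos _).le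
  rw [loss, EReal.coe_ennreal_mul, EReal.coe_toENNReal h0, EReal.coe_ennreal_ofReal,
    max_eq_left (Real.exp_pos _).le, EReal.coe_mul,
    ← EReal.left_distrib_of_nonneg_of_ne_top he (EReal.coe_ne_top _)]
  rw [EReal.sub_add_cancel]

theorem aemeasurable_cost (hL : CostAssumptions nbr L) {t T : ℝ} {c : Control nbr}
    (hc : c ∈ admissible nbr t T) (m : Fin N) :
    AEMeasurable (fun s => L m (c s m)) (volume.restrict (Icc t T)) := by
  -- L is semicontinuous on the orthant only; composing with the positive part extends it to a
  -- semicontinuous, hence measurable, function on the whole space.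
  have h1 : LowerSemicontinuous fun l : nbr m → ℝ => L m (l ⊔ 0) := fun l => by
    have h2 : ContinuousWithinAt (fun l : nbr m → ℝ => l ⊔ 0) univ l := by
      have : Continuous fun l : nbr m → ℝ => l ⊔ 0 :=
        continuous_pi fun j => (continuous_apply j).max continuous_const
      exact this.continuousWithinAt
    intro y hy
    have h3 := hL.lsc m (l ⊔ 0) (le_sup_right : (0 : nbr m → ℝ) ≤ l ⊔ 0) y hy
    have h4 := (h2.tendsto_nhdsWithin (t := {l | 0 ≤ l})
      (fun l _ => (le_sup_right : (0 : nbr m → ℝ) ≤ l ⊔ 0))).eventually h3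
    rwa [nhdsWithin_univ] at h4
  have h2 : AEMeasurable (fun s => c s m) (volume.restrict (Icc t T)) :=
    aemeasurable_pi_lambda _ fun j => (hc.2 m j).aestronglyMeasurable.aemeasurable
  refine (h1.measurable.comp_aemeasurable h2).congr ?_
  filter_upwards [ae_restrict_mem measurableSet_Icc] with s hs
  have : (0 : nbr m → ℝ) ≤ c s m := hc.1 s hs m
  simp [sup_eq_left.2 this]

theorem aemeasurable_loss (hL : CostAssumptions nbr L) {g : Fin N → ℝ} {r T t : ℝ}
    {V : ℝ → Fin N → ℝ} (hV : IsHJSolution nbr L g r T V) {c : Control nbr}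
    (hc : c ∈ admissible nbr t T) (m : Fin N) :
    AEMeasurable (fun s => loss nbr L V r t c s m) (volume.restrict (Icc t T)) := by
  have h1 : AEMeasurable (fun s => slack nbr L V c s m) (volume.restrict (Icc t T)) := by
    have h := (slack_integrable hL hV hc m).aestronglyMeasurable.aemeasurable
    have he : Measurable fun s => Real.exp (r * (s - t)) := by fun_prop
    refine (he.aemeasurable.mul h).congr (.of_forall fun s => ?_)
    simp only [Pi.mul_apply]
    rw [← mul_assoc, ← Real.exp_add]
    simp
  have h2 : AEMeasurable (fun s => L m (c s m) + ((-slack nbr L V c s m : ℝ) : EReal))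
      (volume.restrict (Icc t T)) := (aemeasurable_cost hL hc m).add h1.neg.coe_real_ereal
  have h3 : Measurable fun s => ENNReal.ofReal (Real.exp (-r * (s - t))) := by fun_prop
  refine (h3.aemeasurable.mul h2.ereal_toENNReal).congr (.of_forall fun s => ?_)
  simp only [Pi.mul_apply, loss, EReal.coe_neg, sub_eq_add_neg]

namespace ControlledChain

variable {t T : ℝ} {i : Fin N} {c : Control nbr}

/-- The expected total loss along the chain. -/
def totalLoss (Z : ControlledChain nbr t T i c) (φ : ℝ → Fin N → ENNReal) : ENNReal :=
  letI := Z.mΩ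
  ∫⁻ ω, (∫⁻ s in Icc t T, φ s (Z.X s ω)) ∂Z.μ

section

variable (Z : ControlledChain nbr t T i c) {φ : ℝ → Fin N → ENNReal}
  (hφ : ∀ m, AEMeasurable (fun s => φ s m) (volume.restrict (Icc t T)))
include hφ

/-- There are finitely many nodes, so one null set of times, independent of the path, suffices to
replace φ by a measurable version. -/
theorem exists_measurable_density (htT : t ≤ T) :
    letI := Z.mΩ
    ∃ ψ : ℝ → Fin N → ENNReal, (Measurable fun q : ℝ × Z.Ω => ψ q.1 (Z.path htT q)) ∧
      ∀ᵐ s ∂(volume.restrict (Icc t T)), ∀ m ω, φ s m = ψ s m ∧ Z.path htT (s, ω) = Z.X s ω := by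
  let _ := Z.mΩ
  refine ⟨fun s m => (hφ m).mk _ s, ?_, ?_⟩
  · have h : Measurable fun p : ℝ × Fin N => (hφ p.2).mk _ p.1 :=
      measurable_from_prod_countable_left fun m => (hφ m).measurable_mk
    exact h.comp (measurable_fst.prodMk (Z.measurable_path htT))
  · filter_upwards [ae_all_iff.2 fun m => (hφ m).ae_eq_mk, ae_restrict_mem measurableSet_Icc]
      with s h1 h2 m ω
    exact ⟨h1 m, Z.path_eq htT h2 ω⟩

theorem aemeasurable_density (htT : t ≤ T) :
    letI := Z.mΩ
    (∀ ω, AEMeasurable (fun s => φ s (Z.X s ω)) (volume.restrict (Icc t T))) ∧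
      AEMeasurable (fun ω => ∫⁻ s in Icc t T, φ s (Z.X s ω)) Z.μ := by
  let _ := Z.mΩ
  obtain ⟨ψ, hψ, h⟩ := Z.exists_measurable_density hφ htT
  have hc : ∀ ω, (fun s => ψ s (Z.path htT (s, ω))) =ᵐ[volume.restrict (Icc t T)]
      fun s => φ s (Z.X s ω) := fun ω => by
    filter_upwards [h] with s hs
    rw [(hs i ω).2, (hs _ ω).1]
  refine ⟨fun ω => AEMeasurable.congr (hψ.comp measurable_prodMk_right).aemeasurable (hc ω), ?_⟩
  refine AEMeasurable.congr (f := fun ω => ∫⁻ s in Icc t T, ψ s (Z.path htT (s, ω)))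
    hψ.lintegral_prod_left'.aemeasurable (.of_forall fun ω => lintegral_congr_ae (hc ω))

/-- By Tonelli the expected loss vanishes at almost every time; at such a time every node of
positive probability has zero loss. -/
theorem ae_eq_zero_of_totalLoss_eq_zero (htT : t ≤ T) (h0 : Z.totalLoss φ = 0) :
    ∀ᵐ s ∂(volume.restrict (Icc t T)), ∀ m, 0 < Z.prob s m → φ s m = 0 := by
  let _ := Z.mΩ
  have := Z.isProb
  obtain ⟨ψ, hψ, h⟩ := Z.exists_measurable_density hφ htT
  have hc : ∀ ω, (fun s => φ s (Z.X s ω)) =ᵐ[volume.restrict (Icc t T)]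
      fun s => ψ s (Z.path htT (s, ω)) := fun ω => by
    filter_upwards [h] with s hs
    rw [(hs i ω).2, (hs _ ω).1]
  rw [totalLoss, lintegral_congr fun ω => lintegral_congr_ae (hc ω),
    ← lintegral_lintegral_swap (f := fun s ω => ψ s (Z.path htT (s, ω))) hψ.aemeasurable,
    lintegral_eq_zero_iff (Measurable.lintegral_prod_right' hψ)] at h0
  filter_upwards [h0, h] with s hs1 hs2 m hm
  by_contra hne
  have h1 := (lintegral_eq_zero_iff (hψ.comp measurable_prodMk_left)).1 hs1
  have h2 : Z.μ {ω | Z.X s ω = m} = 0 := by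
    refine measure_mono_null (fun ω hω => ?_) (ae_iff.1 h1)
    have hω' : Z.X s ω = m := hω
    have h3 : ψ s (Z.path htT (s, ω)) ≠ 0 := by
      rwa [(hs2 m ω).2, hω', ← (hs2 m ω).1]
    exact h3
  exact hm.ne' (by simp only [prob, measureReal_def, h2, ENNReal.toReal_zero])

end

/-- The cost is loss plus discounted slack, and by `verification` the slack together with the
terminal reward has expectation exactly V t i. Everything about optimality follows from this
identity. -/
theorem payoff_eq (hL : CostAssumptions nbr L) {g : Fin N → ℝ} {r : ℝ} (htT : t ≤ T)
    {V : ℝ → Fin N → ℝ} (hV : IsHJSolution nbr L g r T V)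
    (hc : c ∈ admissible nbr t T) (Z : ControlledChain nbr t T i c) :
    Z.payoff L g r = -(Z.totalLoss (loss nbr L V r t c) : EReal) + ((V t i : ℝ) : EReal) := by
  let _ := Z.mΩ
  have := Z.isProb
  obtain ⟨hm1, hm2⟩ := Z.aemeasurable_density (aemeasurable_loss hL hV hc) htT
  set σ : ℝ → Fin N → ℝ := fun s m => Real.exp (-r * (s - t)) * slack nbr L V c s m with hσ
  have hσi : ∀ m, IntegrableOn (fun s => σ s m) (Icc t T) := slack_integrable hL hV hc
  have hT : T ∈ Icc t T := ⟨htT, le_rfl⟩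
  have hσX : ∀ ω, IntegrableOn (fun s => σ s (Z.X s ω)) (Icc t T) := fun ω => by
    have h1 : IntegrableOn (fun s => ∑ m, {s | Z.path htT (s, ω) = m}.indicator (fun s => σ s m) s)
        (Icc t T) := integrable_finsetSum _ fun m _ => (hσi m).indicator
      (((Z.measurable_path htT).comp measurable_prodMk_right) (measurableSet_singleton m))
    refine h1.congr_fun (fun s hs => ?_) measurableSet_Icc
    simp [Set.indicator_apply, Z.path_eq htT hs]
  obtain ⟨hi1, hi2⟩ := Z.integral_integral_X hT hσi
  have hgi : Integrable (fun ω => Real.exp (-r * (T - t)) * g (Z.X T ω)) Z.μ :=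
    (Z.integrable_X hT g).const_mul _
  have hin : ∀ ω, erealIntegral (volume.restrict (Icc t T)) (fun s =>
      ((Real.exp (-r * (s - t)) : ℝ) : EReal) * L (Z.X s ω) (c s (Z.X s ω))) =
      (∫⁻ s in Icc t T, loss nbr L V r t c s (Z.X s ω) : ENNReal) +
        ((∫ s in t..T, σ s (Z.X s ω) : ℝ) : EReal) := fun ω => by
    rw [intervalIntegral.integral_of_le htT, ← integral_Icc_eq_integral_Ioc]
    refine erealIntegral_eq_add (hm1 ω) (hσX ω) ?_
    filter_upwards [ae_restrict_mem measurableSet_Icc] with s hs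
    exact exp_mul_cost hL V r t (hc.1 s hs _)
  have hout := erealIntegral_eq_neg_add (μ := Z.μ)
    (h := fun ω => ∫⁻ s in Icc t T, loss nbr L V r t c s (Z.X s ω))
    (b := fun ω => Real.exp (-r * (T - t)) * g (Z.X T ω) - ∫ s in t..T, σ s (Z.X s ω))
    (f := fun ω => -erealIntegral (volume.restrict (Icc t T)) (fun s =>
        ((Real.exp (-r * (s - t)) : ℝ) : EReal) * L (Z.X s ω) (c s (Z.X s ω)))
      + ((Real.exp (-r * (T - t)) * g (Z.X T ω) : ℝ) : EReal)) hm2 (hgi.sub hi1)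
    (.of_forall fun ω => by
      rw [hin ω, EReal.neg_add (.inr (EReal.coe_ne_top _)) (.inr (EReal.coe_ne_bot _)),
        EReal.coe_sub, sub_eq_add_neg, sub_eq_add_neg, add_assoc]
      congr 1
      exact add_comm _ _)
  rw [payoff, hout, integral_sub hgi hi1, integral_const_mul, Z.integral_X hT, hi2,
    verification hL htT hV hc Z]
  rfl

end ControlledChain

/-! ### The value function -/

section Value

variable {g : Fin N → ℝ} {r T : ℝ} {V : ℝ → Fin N → ℝ}

theorem ControlledChain.payoff_eq_of_argmax (hL : CostAssumptions nbr L) {t : ℝ} (htT : t ≤ T)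
    (hV : IsHJSolution nbr L g r T V) {i : Fin N} {c : Control nbr} (hc : c ∈ admissible nbr t T)
    (hmax : ∀ i, ∀ s ∈ Icc t T, c s i ∈ argmaxSet nbr L i fun j => V s j - V s i)
    (Z : ControlledChain nbr t T i c) : Z.payoff L g r = ((V t i : ℝ) : EReal) := by
  have h0 : Z.totalLoss (loss nbr L V r t c) = 0 := by
    let _ := Z.mΩ
    have h1 : ∀ ω, ∫⁻ s in Icc t T, loss nbr L V r t c s (Z.X s ω) = 0 := fun ω => by
      rw [setLIntegral_congr_fun (g := fun _ => 0) measurableSet_Icc fun s hs =>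
        (loss_eq_zero_iff hL (hc.1 s hs _)).2 (hmax _ s hs)]
      simp
    rw [totalLoss, lintegral_congr h1, lintegral_zero]
  rw [Z.payoff_eq hL htT hV hc, h0]
  simp

theorem nonempty_controlledChain_of_argmax (hL : CostAssumptions nbr L) {t : ℝ} (htT : t ≤ T)
    (hV : IsHJSolution nbr L g r T V) {c : Control nbr} (hc : c ∈ admissible nbr t T)
    (hmax : ∀ i, ∀ s ∈ Icc t T, c s i ∈ argmaxSet nbr L i fun j => V s j - V s i) (i : Fin N) :
    Nonempty (ControlledChain nbr t T i c) := by
  obtain ⟨B, -, hB⟩ := exists_bound_of_mem_argmax hL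
    ((hV.continuousOn hL).mono fun s (hs : s ∈ Icc t T) => hs.2)
  exact exists_controlledChain htT hc (fun s hs i j => (hB c hmax s hs i j).2) i

theorem exists_admissible_argmax (hL : CostAssumptions nbr L) (t : ℝ)
    (hV : IsHJSolution nbr L g r T V) : ∃ c ∈ admissible nbr t T,
      ∀ i, ∀ s ∈ Icc t T, c s i ∈ argmaxSet nbr L i fun j => V s j - V s i := by
  have hVc : ContinuousOn V (Icc t T) := (hV.continuousOn hL).mono fun _ hs => hs.2
  obtain ⟨c, hcm, hmax⟩ := exists_measurable_argmax hL hVc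
  obtain ⟨B, -, hB⟩ := exists_bound_of_mem_argmax hL hVc
  refine ⟨c, ⟨fun s hs i j => (hB c hmax s hs i j).1, fun i j => ?_⟩, hmax⟩
  refine Integrable.of_bound ((measurable_pi_apply j).comp (hcm i)).aestronglyMeasurable B ?_
  filter_upwards [ae_restrict_mem measurableSet_Icc] with s hs
  obtain ⟨h1, h2⟩ := hB c hmax s hs i j
  simpa [abs_of_nonneg h1] using h2

/-- The loss is nonnegative, which gives the upper bound for every chain. A measurable argmax
selection is bounded, so its chain exists and attains it. -/
theorem value_eq (hL : CostAssumptions nbr L) {t : ℝ} (htT : t ≤ T)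
    (hV : IsHJSolution nbr L g r T V) (i : Fin N) :
    value nbr L g r T t i = ((V t i : ℝ) : EReal) := by
  refine le_antisymm (iSup₂_le fun c hc => iSup_le fun Z => ?_) ?_
  · rw [Z.payoff_eq hL htT hV hc]
    refine add_le_of_nonpos_left ?_
    simpa using EReal.neg_le_neg_iff.2 (EReal.coe_ennreal_nonneg (Z.totalLoss (loss nbr L V r t c)))
  · obtain ⟨c, hc, hmax⟩ := exists_admissible_argmax hL t hV
    obtain ⟨Z⟩ := nonempty_controlledChain_of_argmax hL htT hV hc hmax i
    rw [← Z.payoff_eq_of_argmax hL htT hV hc hmax]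
    exact le_iSup₂_of_le c hc (le_iSup (fun Z : ControlledChain nbr t T i c => Z.payoff L g r) Z)

theorem valueDiff_eq (hL : CostAssumptions nbr L) {t : ℝ} (htT : t ≤ T)
    (hV : IsHJSolution nbr L g r T V) (i : Fin N) :
    valueDiff nbr L g r T t i = fun j : nbr i => V t j - V t i := by
  funext j
  simp only [valueDiff, value_eq hL htT hV, EReal.toReal_coe]

theorem isOptimal_of_argmax (hL : CostAssumptions nbr L) (hT : 0 ≤ T)
    (hV : IsHJSolution nbr L g r T V) {c : Control nbr} (hc : c ∈ admissible nbr 0 T)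
    (hmax : ∀ i, ∀ s ∈ Icc 0 T, c s i ∈ argmaxSet nbr L i fun j => V s j - V s i) (i : Fin N) :
    IsOptimal nbr L g r T i c :=
  ⟨hc, nonempty_controlledChain_of_argmax hL hT hV hc hmax i, fun Z => by
    rw [Z.payoff_eq_of_argmax hL hT hV hc hmax, value_eq hL hT hV]⟩

/-- The value V 0 i is finite, so attaining it forces zero total loss. Since the chain is at i with
positive probability at each time, the loss at i vanishes almost everywhere. -/
theorem IsOptimal.ae_argmax (hL : CostAssumptions nbr L) (hT : 0 ≤ T)
    (hV : IsHJSolution nbr L g r T V) {c : Control nbr} {i : Fin N}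
    (hc : IsOptimal nbr L g r T i c) :
    ∀ᵐ s ∂(volume.restrict (Icc 0 T)), c s i ∈ argmaxSet nbr L i fun j => V s j - V s i := by
  obtain ⟨hca, ⟨Z⟩, hopt⟩ := hc
  have h1 := hopt Z
  rw [Z.payoff_eq hL hT hV hca, value_eq hL hT hV] at h1
  have h0 : Z.totalLoss (loss nbr L V r 0 c) = 0 := by
    generalize Z.totalLoss (loss nbr L V r 0 c) = x at h1
    induction x with
    | top => simp at h1
    | coe x =>
      have e : ((x : ENNReal) : EReal) = ((x : ℝ) : EReal) := rfl
      have h2 : -(x : ℝ) + V 0 i = V 0 i := by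
        rw [e] at h1
        exact_mod_cast h1
      have h3 : (x : ℝ) = 0 := by linarith
      exact_mod_cast h3
  filter_upwards [Z.ae_eq_zero_of_totalLoss_eq_zero (aemeasurable_loss hL hV hca) hT h0,
    ae_restrict_mem measurableSet_Icc] with s hs hsT
  exact (loss_eq_zero_iff hL (hca.1 s hsT i)).1 (hs i (Z.prob_start_pos hca hsT))

end Value

end GraphControl

end

theorem mainTheorem5 (N : ℕ) (nbr : Fin N → Finset (Fin N)) (hnbr : ∀ i, i ∉ nbr i)
    (L : GraphControl.Cost nbr) (hL : GraphControl.CostAssumptions nbr L)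
    (g : Fin N → ℝ) (r T : ℝ) (hr : 0 ≤ r) (hT : 0 < T) :
    ∃ V : ℝ → Fin N → ℝ,
      -- `V` is the solution of the Hamilton-Jacobi equation on `(-∞, T]`
      GraphControl.IsHJSolution nbr L g r T V ∧
      (∀ W : ℝ → Fin N → ℝ, GraphControl.IsHJSolution nbr L g r T W → ∀ t ≤ T, W t = V t) ∧
      -- the value function equals it
      (∀ i, ∀ t ∈ Set.Icc 0 T, GraphControl.value nbr L g r T t i = ((V t i : ℝ) : EReal)) ∧
      -- admissible selections of the argmax exist
      (∃ c ∈ GraphControl.admissible nbr 0 T, ∀ i, ∀ t ∈ Set.Icc 0 T,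
        c t i ∈ GraphControl.argmaxSet nbr L i (GraphControl.valueDiff nbr L g r T t i)) ∧
      -- every admissible selection of the argmax is optimal from every node
      (∀ c ∈ GraphControl.admissible nbr 0 T,
        (∀ i, ∀ t ∈ Set.Icc 0 T,
          c t i ∈ GraphControl.argmaxSet nbr L i (GraphControl.valueDiff nbr L g r T t i)) →
        ∀ i, GraphControl.IsOptimal nbr L g r T i c) ∧
      -- a control that is optimal from every node is such a selection at almost every time
      (∀ c, (∀ i, GraphControl.IsOptimal nbr L g r T i c) →
        ∀ i, ∀ᵐ t ∂(MeasureTheory.volume.restrict (Set.Icc 0 T)),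
          c t i ∈ GraphControl.argmaxSet nbr L i (GraphControl.valueDiff nbr L g r T t i)) := by
  obtain ⟨V, hV⟩ := GraphControl.exists_isHJSolution hL g hr T
  refine ⟨V, hV, fun W hW t ht => GraphControl.isHJSolution_unique hL hV hW ht,
    fun i t ht => GraphControl.value_eq hL ht.2 hV i, ?_, fun c hc hmax i => ?_, fun c hc i => ?_⟩
  · obtain ⟨c, hc, hmax⟩ := GraphControl.exists_admissible_argmax hL 0 hV
    refine ⟨c, hc, fun i t ht => ?_⟩
    rw [GraphControl.valueDiff_eq hL ht.2 hV]
    exact hmax i t ht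
  · refine GraphControl.isOptimal_of_argmax hL hT.le hV hc (fun k t ht => ?_) i
    rw [← GraphControl.valueDiff_eq hL ht.2 hV]
    exact hmax k t ht
  · filter_upwards [(hc i).ae_argmax hL hT.le hV, ae_restrict_mem measurableSet_Icc] with t h ht
    rw [GraphControl.valueDiff_eq hL ht.2 hV]
    exact h
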